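/- Let $X=(P,Q)$ be a vector field on $\mathbb{R}^2$ with $P,Q$ real homogeneous polynomials of the same degree $n$, such that the origin is an isolated singular point of $X$ (that is, $X(0)=0$ and $X$ has no other zero near $0$). The characteristic directions of $X$ are the zeros $\omega\in\mathbb{P}^1(\mathbb{R})=\mathbb{R}\cup\{\infty\}$ of the directional polynomial $xQ(x,y)-yP(x,y)$, where $s\in\mathbb{R}$ stands for $[1:s]$ and $\infty$ for $[0:1]$. Assume that every characteristic direction has multiplicity one, i.e. $X\in\mathcal{V}^{hom}$. Critical values. Let $\hat X(\hat x,\hat y)=(\hat xP(1,\hat y),\,Q(1,\hat y)-\hat yP(1,\hat y))$ and $\bar X(\bar x,\bar y)=(P(\bar x,1)-\bar xQ(\bar x,1),\,\bar yQ(\bar x,1))$ be the desingularised directional blow-ups, with critical manifolds $\{\hat x=0\}$ and $\{\bar y=0\}$. The critical value of $X$ at a characteristic direction $\omega$ is the ratio of hyperbolicity $\lambda_1/\lambda_2$ of the Jacobian of $\hat X$ at $(0,\omega)$ if $\omega\in\mathbb{R}$ (of $\bar X$ at $(0,0)$ if $\omega=\infty$), where $\lambda_1$ is the eigenvalue in the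 direction of the critical manifold and $\lambda_2$ is the other eigenvalue. Block regularisation. For a compact set $N\subset\mathbb{R}^2$ with smooth boundary curve $n=\partial N$, let $n^+$ (resp. $n^-$) be the set of points of $n$ whose $X$-orbit is outside $N$ during some time interval $(-\varepsilon,0)$ (resp. $(0,\varepsilon)$), and let $\tau$ be the set of points of $n$ at which $X$ is tangent to $n$. $N$ is an isolating block if $n^+\cup n^-=n$, $n^+\cap n^-=\tau$ and $\tau$ is a codimension-one submanifold of $n$ (a finite set). Let $a^+\subset n^+$ (resp. $a^-\subset n^-$) be the set of points whose forward (resp. backward) orbit stays in $N$ for all time; the block map $\pi:n^+\setminus a^+\to n^-\setminus a^-$ sends a point to the point at which its orbit leaves $N$. The singular point $0$ of $X$ is $C^0$ block-regularisable if there is an isolating block $N$ whose maximal invariant set is $\{0\}$ and whose block map extends uniquely to a homeomorphism $n^+\to n^-$. Theorem. The vector field $X$ is $C^0$ block-regularisable (at $0$) if and only if it has exactly one characteristic direction, and hence exactly one critical value $r^*$, counted by characteristic directions, and $r^*<0$. -/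

import Mathlib

open Set Filter Topology

namespace PlanarReg

/-! ### Isolating blocks and block regularisation for a vector field `v` on the plane -/

/-- `h` is a smooth function defining the set `N` near the point `p` as `{h ≤ 0}`, with `p` on the
boundary `{h = 0}` and `dh ≠ 0` there. -/
def IsDefiningFunctionAt (N : Set (ℝ × ℝ)) (p : ℝ × ℝ) (h : ℝ × ℝ → ℝ) : Prop :=
  ContDiff ℝ (⊤ : ℕ∞) h ∧ h p = 0 ∧ fderiv ℝ h p ≠ 0 ∧ ∀ᶠ q in 𝓝 p, (q ∈ N ↔ h q ≤ 0)

/-- The entry set `n⁺`: boundary points whose orbit is outside `N` immediately before. -/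
def entrySet (v : ℝ × ℝ → ℝ × ℝ) (N : Set (ℝ × ℝ)) : Set (ℝ × ℝ) :=
  {x | x ∈ frontier N ∧ ∃ ε > 0, ∃ γ : ℝ → ℝ × ℝ, γ 0 = x ∧
    IsIntegralCurveOn γ (fun _ => v) (Ioo (-ε) ε) ∧ ∀ t ∈ Ioo (-ε) 0, γ t ∉ N}

/-- The exit set `n⁻`: boundary points whose orbit is outside `N` immediately afterwards. -/
def exitSet (v : ℝ × ℝ → ℝ × ℝ) (N : Set (ℝ × ℝ)) : Set (ℝ × ℝ) :=
  {x | x ∈ frontier N ∧ ∃ ε > 0, ∃ γ : ℝ → ℝ × ℝ, γ 0 = x ∧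
    IsIntegralCurveOn γ (fun _ => v) (Ioo (-ε) ε) ∧ ∀ t ∈ Ioo 0 ε, γ t ∉ N}

/-- The tangency set `τ`: boundary points at which `v` is tangent to the boundary of `N`. -/
def tangencySet (v : ℝ × ℝ → ℝ × ℝ) (N : Set (ℝ × ℝ)) : Set (ℝ × ℝ) :=
  {x | x ∈ frontier N ∧ ∃ h, IsDefiningFunctionAt N x h ∧ fderiv ℝ h x (v x) = 0}

/-- The maximal invariant set in `N`: the points with a complete orbit inside `N`. -/
def maximalInvariantSet (v : ℝ × ℝ → ℝ × ℝ) (N : Set (ℝ × ℝ)) : Set (ℝ × ℝ) :=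
  {x | ∃ γ : ℝ → ℝ × ℝ, γ 0 = x ∧ IsIntegralCurve γ (fun _ => v) ∧ ∀ t, γ t ∈ N}

/-- Isolating block (Conley--Easton) in the plane: a compact two-dimensional submanifold with smooth
boundary `n` such that `n = n⁺ ∪ n⁻`, `n⁺ ∩ n⁻ = τ`, and `τ` is a codimension-one submanifold of the
curve `n`. As `τ` is closed in the compact curve `n`, the last condition says that it is finite. -/
structure IsIsolatingBlock (v : ℝ × ℝ → ℝ × ℝ) (N : Set (ℝ × ℝ)) : Prop where
  isCompact : IsCompact N
  smooth_boundary : ∀ p ∈ frontier N, ∃ h, IsDefiningFunctionAt N p h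
  union_eq : entrySet v N ∪ exitSet v N = frontier N
  inter_eq : entrySet v N ∩ exitSet v N = tangencySet v N
  finite_tangency : (tangencySet v N).Finite

/-- The asymptotic entry set `a⁺`: entry points whose forward orbit stays in `N` forever. -/
def asymptoticEntrySet (v : ℝ × ℝ → ℝ × ℝ) (N : Set (ℝ × ℝ)) : Set (ℝ × ℝ) :=
  {x | x ∈ entrySet v N ∧ ∃ γ : ℝ → ℝ × ℝ, γ 0 = x ∧
    IsIntegralCurveOn γ (fun _ => v) (Ici 0) ∧ ∀ t ∈ Ici (0 : ℝ), γ t ∈ N}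

/-- The graph of the block map `π : n⁺ \ a⁺ → n⁻ \ a⁻`: the orbit of the entry point `x` runs inside
`N` until it leaves `N` at the exit point `y`. (For a tangency point, `T = 0` and `y = x`.) -/
def BlockMapGraph (v : ℝ × ℝ → ℝ × ℝ) (N : Set (ℝ × ℝ)) (x y : ℝ × ℝ) : Prop :=
  x ∈ entrySet v N ∧ y ∈ exitSet v N ∧
    ∃ T ≥ 0, ∃ γ : ℝ → ℝ × ℝ, γ 0 = x ∧ γ T = y ∧
      IsIntegralCurveOn γ (fun _ => v) (Icc 0 T) ∧ ∀ t ∈ Icc 0 T, γ t ∈ N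

/-- The homeomorphism `e : n⁺ ≃ n⁻` extends the block map. -/
def ExtendsBlockMap (v : ℝ × ℝ → ℝ × ℝ) (N : Set (ℝ × ℝ))
    (e : entrySet v N ≃ₜ exitSet v N) : Prop :=
  ∀ x : entrySet v N, (x : ℝ × ℝ) ∉ asymptoticEntrySet v N → BlockMapGraph v N x (e x)

/-- The singular point `z` of `v` is `C⁰` block-regularisable: some isolating block with maximal
invariant set `{z}` is trivialisable, i.e. its block map extends uniquely to a homeomorphism
`n⁺ → n⁻`. -/
def IsC0Regularisable (v : ℝ × ℝ → ℝ × ℝ) (z : ℝ × ℝ) : Prop :=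
  ∃ N : Set (ℝ × ℝ), IsIsolatingBlock v N ∧ maximalInvariantSet v N = {z} ∧
    ∃! e : entrySet v N ≃ₜ exitSet v N, ExtendsBlockMap v N e

/-! ### Homogeneous vector fields, characteristic directions and critical values -/

/-- The vector field `X = (P, Q)`. -/
noncomputable def field (P Q : MvPolynomial (Fin 2) ℝ) (z : ℝ × ℝ) : ℝ × ℝ :=
  (MvPolynomial.eval ![z.1, z.2] P, MvPolynomial.eval ![z.1, z.2] Q)

/-- `z` is an isolated singular point (zero) of `v`. -/
def IsIsolatedSingularPoint (v : ℝ × ℝ → ℝ × ℝ) (z : ℝ × ℝ) : Prop :=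
  v z = 0 ∧ ∀ᶠ w in 𝓝[≠] z, v w ≠ 0

/-- The directional polynomial `x Q(x,y) - y P(x,y)`. -/
noncomputable def directionalPoly (P Q : MvPolynomial (Fin 2) ℝ) : MvPolynomial (Fin 2) ℝ :=
  MvPolynomial.X 0 * Q - MvPolynomial.X 1 * P

/-- The directional polynomial in the chart `(1, y)` of the projective line,
`Q(1,y) - y P(1,y)`. -/
noncomputable def hatPoly (P Q : MvPolynomial (Fin 2) ℝ) : Polynomial ℝ :=
  MvPolynomial.aeval ![1, Polynomial.X] (directionalPoly P Q)

/-- The directional polynomial in the chart `(x, 1)` of the projective line,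
`x Q(x,1) - P(x,1)`. -/
noncomputable def barPoly (P Q : MvPolynomial (Fin 2) ℝ) : Polynomial ℝ :=
  MvPolynomial.aeval ![Polynomial.X, 1] (directionalPoly P Q)

/-- The characteristic directions, as points of the real projective line `OnePoint ℝ`:
the real number `s` is the direction `[1 : s]`, and `∞` is the direction `[0 : 1]`. -/
def IsCharDirection (P Q : MvPolynomial (Fin 2) ℝ) : OnePoint ℝ → Prop
  | none => (barPoly P Q).IsRoot 0
  | some s => (hatPoly P Q).IsRoot s

/-- The multiplicity of a characteristic direction (`0` by convention if the directional polynomial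
vanishes identically). -/
noncomputable def charMultiplicity (P Q : MvPolynomial (Fin 2) ℝ) : OnePoint ℝ → ℕ
  | none => (barPoly P Q).rootMultiplicity 0
  | some s => (hatPoly P Q).rootMultiplicity s

/-- The class `V^hom`: `P` and `Q` are homogeneous of degree `n`, the origin is an isolated singular
point of `X = (P, Q)`, and every characteristic direction has multiplicity one. -/
structure IsVhom (n : ℕ) (P Q : MvPolynomial (Fin 2) ℝ) : Prop where
  homogeneous_P : P.IsHomogeneous n
  homogeneous_Q : Q.IsHomogeneous n
  isolated : IsIsolatedSingularPoint (field P Q) 0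
  simple : ∀ ω, IsCharDirection P Q ω → charMultiplicity P Q ω = 1

/-- The desingularised `x`-directional blow-up
`X̂ (x, y) = (x P(1,y), Q(1,y) - y P(1,y))`, with critical manifold `x = 0`.
It is the pull-back of `X` by `(x, y) ↦ (x, x y)`, divided by `x ^ (n - 1)`. -/
noncomputable def hatField (P Q : MvPolynomial (Fin 2) ℝ) (z : ℝ × ℝ) : ℝ × ℝ :=
  (z.1 * MvPolynomial.eval ![1, z.2] P,
    MvPolynomial.eval ![1, z.2] Q - z.2 * MvPolynomial.eval ![1, z.2] P)

/-- The desingularised `y`-directional blow-up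
`X̄ (x, y) = (P(x,1) - x Q(x,1), y Q(x,1))`, with critical manifold `y = 0`.
It is the pull-back of `X` by `(x, y) ↦ (x y, y)`, divided by `y ^ (n - 1)`. -/
noncomputable def barField (P Q : MvPolynomial (Fin 2) ℝ) (z : ℝ × ℝ) : ℝ × ℝ :=
  (MvPolynomial.eval ![z.1, 1] P - z.1 * MvPolynomial.eval ![z.1, 1] Q,
    z.2 * MvPolynomial.eval ![z.1, 1] Q)

/-- `r` is the ratio `l₁ / l₂` of the eigenvalues of the linear map `A`, where `l₁` is the eigenvalue
of the eigenvector `u` and `l₂` is the other eigenvalue. -/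
def IsEigenvalueRatio (A : (ℝ × ℝ) →ₗ[ℝ] (ℝ × ℝ)) (u : ℝ × ℝ) (r : ℝ) : Prop :=
  ∃ l₁ l₂ : ℝ, A u = l₁ • u ∧
    A.charpoly = (Polynomial.X - Polynomial.C l₁) * (Polynomial.X - Polynomial.C l₂) ∧
    l₂ ≠ 0 ∧ r = l₁ / l₂

/-- `r` is the critical value of `X` at the characteristic direction `ω`: the ratio of hyperbolicity
of the linearised desingularised field at the corresponding singular point on the critical manifold,
with the eigenvalue along the critical manifold in the numerator. -/
def IsCriticalValueAt (P Q : MvPolynomial (Fin 2) ℝ) (r : ℝ) : OnePoint ℝ → Prop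
  | none => IsEigenvalueRatio
      (fderiv ℝ (barField P Q) (0, 0) : (ℝ × ℝ) →ₗ[ℝ] (ℝ × ℝ)) (1, 0) r
  | some s => IsEigenvalueRatio
      (fderiv ℝ (hatField P Q) (0, s) : (ℝ × ℝ) →ₗ[ℝ] (ℝ × ℝ)) (0, 1) r

end PlanarReg

/-! In polar coordinates the field is r^(k+1) (R(θ) e_r + Θ(θ) e_θ) with k + 1 = n. Characteristic
directions are the zeros of Θ modulo π, and the critical value there is Θ'/R
(`IsVhom.isCriticalValueAt_iff`). Each zero of Θ is an invariant ray, incoming if R < 0 and outgoing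
if R > 0. Between neighbouring rays the angle is monotone along orbits and L = log r - ∫ (R/Θ) dθ is
a first integral. The signs of R at the two ends decide whether the sector is hyperbolic, parabolic
or elliptic.

Necessity. Suppose the block map extends uniquely to a homeomorphism e from n⁺ to n⁻. It sends
asymptotic entry points to asymptotic exit points (`map_stays`). Asymptotic entry points cannot fill
an arc of n⁺, since pushing along that arc would give a second extension
(`TrivialisedBlock.not_eventually_stays`). This excludes parabolic sectors. Elliptic sectors contain
small complete orbits inside the block, against the maximal invariant set being {0}. So every sector
is hyperbolic and runs from an incoming to an outgoing ray (`right_pos`, `left_neg`). Without any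
ray the origin is a centre or a focus, and both are impossible (`exists_ray`). On an incoming ray
take an asymptotic entry point a. Entry points near a in either adjacent sector are carried along
their level of L, so in the limit e a lies on the far ray of each of the two sectors
(`map_backward_end`). The two far rays therefore coincide; as no sector is wider than π, both
sectors are half-planes. Hence there is one characteristic direction, with R < 0 and Θ' > 0 on its
incoming ray (`exists_single_direction`).

Sufficiency. One direction with negative critical value forces k to be odd and gives two hyperbolic
half-planes separated by an invariant line with one incoming and one outgoing ray. In each
half-plane exp L vanishes towards the line; its extensions by zero, taken with opposite signs, form
a continuous first integral F on the plane. The block is r² (1 + cos²(θ - θ₀))^(M+2) ≤ 1; for large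
M its boundary has one entry arc and one exit arc, meeting in two antipodal outer tangencies
(`exists_sign_change`). F is strictly monotone on each arc and the arcs share their endpoints, so
matching values of F is a homeomorphism n⁺ → n⁻. It extends the block map, which preserves F. An
asymptotic entry point has F = 0, so there is at most one, and its image is forced
(`HasTangencyAngle.isC0Regularisable`). -/

namespace PlanarReg

/-! ### Complete flows of cut-off vector fields -/

section Flow

variable {E : Type*} [NormedAddCommGroup E] [NormedSpace ℝ E]

/-- A bounded Lipschitz vector field on a Banach space is complete. -/
theorem exists_integralCurve_of_bounded [CompleteSpace E] {f : E → E} {K L : NNReal}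
    (hf : LipschitzWith K f) (hL : ∀ x, ‖f x‖ ≤ L) (x : E) :
    ∃ γ : ℝ → E, γ 0 = x ∧ ∀ t, HasDerivAt γ (f (γ t)) t := by
  have hloc : ∀ n : ℕ, ∃ α : ℝ → E, α 0 = x ∧
      ∀ t ∈ Ioo (-(n + 1 : ℝ)) (n + 1), HasDerivAt α (f (α t)) t := by
    intro n
    have hn : (0 : ℝ) ≤ n + 1 := by positivity
    have h0 : (0 : ℝ) ∈ Icc (-(n + 1 : ℝ)) (n + 1) := ⟨by linarith, hn⟩
    -- The bound `L` is global, so a ball of radius `L * (n + 1)` suffices for the time `n + 1`.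
    have hpl : IsPicardLindelof (fun _ => f) (⟨0, h0⟩ : Icc (-(n + 1 : ℝ)) (n + 1)) x
        (L * (n + 1)) 0 L K :=
      { lipschitzOnWith := fun t _ => hf.lipschitzOnWith
        continuousOn := fun y _ => continuousOn_const
        norm_le := fun t _ y _ => hL y
        mul_max_le := by simp }
    obtain ⟨α, hα, hα'⟩ := hpl.exists_eq_forall_mem_Icc_hasDerivWithinAt₀
    exact ⟨α, hα, fun t ht => (hα' t (Ioo_subset_Icc_self ht)).hasDerivAt (Icc_mem_nhds ht.1 ht.2)⟩
  choose α hα hα' using hloc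
  have hagree : ∀ m n : ℕ, m ≤ n → EqOn (α m) (α n) (Ioo (-(m + 1 : ℝ)) (m + 1)) := by
    intro m n hmn
    have hmn' : (m : ℝ) ≤ n := by exact_mod_cast hmn
    have hm : (0 : ℝ) ≤ m := by positivity
    refine ODE_solution_unique_of_mem_Ioo (v := fun _ => f) (s := fun _ => univ) (K := K) (t₀ := 0)
      (fun t _ => hf.lipschitzOnWith) ⟨by linarith, by linarith⟩
      (fun t ht => ⟨hα' m t ht, trivial⟩)
      (fun t ht => ⟨hα' n t ⟨by linarith [ht.1], by linarith [ht.2]⟩, trivial⟩) ?_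
    rw [hα, hα]
  -- Gluing: at time t the solution number ⌈|t|⌉ is used. Near t all solutions involved agree with
  -- number ⌈|t|⌉ + 1, which is differentiable there.
  refine ⟨fun t => α ⌈|t|⌉₊ t, hα _, fun t => ?_⟩
  set n := ⌈|t|⌉₊ + 1 with hn
  have hceil : |t| ≤ ⌈|t|⌉₊ := Nat.le_ceil _
  have htn : t ∈ Ioo (-(n + 1 : ℝ)) (n + 1) := by
    have := abs_le.1 hceil
    push_cast [hn]
    constructor <;> linarith
  have hev : (fun s => α ⌈|s|⌉₊ s) =ᶠ[𝓝 t] α n := by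
    have hlt : ∀ᶠ s in 𝓝 t, |s| < (n : ℝ) :=
      continuous_abs.continuousAt.eventually_lt_const (by push_cast [hn]; linarith)
    filter_upwards [hlt] with s hs
    have hle : ⌈|s|⌉₊ ≤ n := Nat.ceil_le.2 hs.le
    have := abs_lt.1 (lt_of_le_of_lt (Nat.le_ceil |s|) (lt_add_one (⌈|s|⌉₊ : ℝ)))
    exact hagree _ _ hle ⟨by linarith, by linarith⟩
  have := (hα' n t htn).congr_of_eventuallyEq hev
  simpa only [hev.eq_of_nhds] using this

/-- `Γ` is the complete flow of the field `χ • v`, where `χ ≥ 0`. -/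
structure IsCutoffFlow (v : E → E) (χ : E → ℝ) (Γ : ℝ → E → E) : Prop where
  zero : ∀ x, Γ 0 x = x
  add : ∀ s t x, Γ (s + t) x = Γ s (Γ t x)
  hasDerivAt : ∀ x t, HasDerivAt (fun s => Γ s x) (χ (Γ t x) • v (Γ t x)) t
  nonneg : ∀ x, 0 ≤ χ x
  lipschitz : ∃ K, LipschitzWith K fun x => χ x • v x
  bounded : ∃ C : NNReal, ∀ x, ‖χ x • v x‖ ≤ C

namespace IsCutoffFlow

variable {v : E → E} {χ : E → ℝ} {Γ : ℝ → E → E}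

theorem continuous (h : IsCutoffFlow v χ Γ) (x : E) : Continuous fun t => Γ t x :=
  continuous_iff_continuousAt.2 fun t => (h.hasDerivAt x t).continuousAt

theorem reverse (h : IsCutoffFlow v χ Γ) : IsCutoffFlow (-v) χ fun t => Γ (-t) where
  zero x := by simp [h.zero]
  add s t x := by rw [neg_add, h.add]
  hasDerivAt x t := by
    have := (h.hasDerivAt x (-t)).scomp t (hasDerivAt_neg t)
    simpa [Function.comp_def] using this
  nonneg := h.nonneg
  lipschitz := by
    obtain ⟨K, hK⟩ := h.lipschitz
    exact ⟨K, by simp only [Pi.neg_apply, smul_neg]; exact hK.neg⟩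
  bounded := by simpa using h.bounded

theorem eq_of_hasDerivAt (h : IsCutoffFlow v χ Γ) {γ : ℝ → E}
    (hγ : ∀ t, HasDerivAt γ (χ (γ t) • v (γ t)) t) (t : ℝ) : γ t = Γ t (γ 0) := by
  obtain ⟨K, hK⟩ := h.lipschitz
  have := ODE_solution_unique_univ (v := fun _ x => χ x • v x) (s := fun _ => univ) (K := K)
    (f := γ) (g := fun t => Γ t (γ 0)) (t₀ := 0) (fun _ => hK.lipschitzOnWith)
    (fun t => ⟨hγ t, trivial⟩) (fun t => ⟨h.hasDerivAt _ t, trivial⟩) (h.zero _).symm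
  exact congrFun this t

/-- While `χ = 1` the curve also solves the equation of `χ • v`, which is globally Lipschitz
although `v` need not be; uniqueness of solutions applies to that equation. -/
theorem eqOn_Icc (h : IsCutoffFlow v χ Γ) {γ : ℝ → E} {T : ℝ}
    (hγ : IsIntegralCurveOn γ (fun _ => v) (Icc 0 T)) (hχ : ∀ t ∈ Icc 0 T, χ (γ t) = 1) :
    EqOn γ (fun t => Γ t (γ 0)) (Icc 0 T) := by
  obtain ⟨K, hK⟩ := h.lipschitz
  refine ODE_solution_unique (v := fun _ x => χ x • v x) (K := K) (fun _ => hK) hγ.continuousOn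
    (fun t ht => ?_) (h.continuous _).continuousOn
    (fun t _ => (h.hasDerivAt _ t).hasDerivWithinAt) (h.zero _).symm
  rw [hχ t (Ico_subset_Icc_self ht), one_smul]
  exact (hγ t (Ico_subset_Icc_self ht)).mono_of_mem_nhdsWithin
    (mem_of_superset (Icc_mem_nhdsGE ht.2) (Icc_subset_Icc_left ht.1))

theorem eqOn_Ioo (h : IsCutoffFlow v χ Γ) {γ : ℝ → E} {a b : ℝ} (h0 : (0 : ℝ) ∈ Ioo a b)
    (hγ : IsIntegralCurveOn γ (fun _ => v) (Ioo a b)) (hχ : ∀ t ∈ Ioo a b, χ (γ t) = 1) :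
    EqOn γ (fun t => Γ t (γ 0)) (Ioo a b) := by
  obtain ⟨K, hK⟩ := h.lipschitz
  refine ODE_solution_unique_of_mem_Ioo (v := fun _ x => χ x • v x) (s := fun _ => univ) (K := K)
    (t₀ := 0) (fun _ _ => hK.lipschitzOnWith) h0 (fun t ht => ⟨?_, trivial⟩)
    (fun t _ => ⟨h.hasDerivAt _ t, trivial⟩) (h.zero _).symm
  rw [hχ t ht, one_smul]
  exact (hγ t ht).hasDerivAt (Ioo_mem_nhds ht.1 ht.2)

theorem isIntegralCurveOn (h : IsCutoffFlow v χ Γ) {x : E} {s : Set ℝ}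
    (hχ : ∀ t ∈ s, χ (Γ t x) = 1) : IsIntegralCurveOn (fun t => Γ t x) (fun _ => v) s := by
  intro t ht
  simpa [hχ t ht] using (h.hasDerivAt x t).hasDerivWithinAt

theorem neg_apply (h : IsCutoffFlow v χ Γ) (t : ℝ) (x : E) : Γ (-t) (Γ t x) = x := by
  rw [← h.add, neg_add_cancel, h.zero]

theorem eq_of_zero (h : IsCutoffFlow v χ Γ) {z : E} (hz : v z = 0) (t : ℝ) : Γ t z = z :=
  (h.eq_of_hasDerivAt (γ := fun _ => z)
    (fun s => by simpa [hz] using hasDerivAt_const s z) t).symm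

theorem ne_of_zero (h : IsCutoffFlow v χ Γ) {z x : E} (hz : v z = 0) (hx : x ≠ z) (t : ℝ) :
    Γ t x ≠ z := fun ht => hx <| by
  rw [← h.neg_apply t x, ht, h.eq_of_zero hz]

end IsCutoffFlow

/-- Every compact set has a neighbourhood on which a given `C¹` field agrees with a complete one. -/
theorem exists_cutoffFlow [FiniteDimensional ℝ E] {v : E → E} (hv : ContDiff ℝ 1 v) {N : Set E}
    (hN : IsCompact N) :
    ∃ χ Γ, IsCutoffFlow v χ Γ ∧ ∃ U, IsOpen U ∧ N ⊆ U ∧ ∀ x ∈ U, χ x = 1 := by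
  obtain ⟨R, hR⟩ := hN.isBounded.subset_closedBall 0
  have : CompleteSpace E := FiniteDimensional.complete ℝ E
  -- The inner radius exceeds `R`, so `χ = 1` on an open ball around `N`; the absolute value covers
  -- a negative `R`.
  let χ : ContDiffBump (0 : E) := ⟨|R| + 1, |R| + 2, by positivity, by linarith⟩
  have hsupp : HasCompactSupport fun x => χ x • v x := χ.hasCompactSupport.smul_right
  have hsmooth : ContDiff ℝ 1 fun x => χ x • v x := χ.contDiff.smul hv
  obtain ⟨K, hK⟩ := ContDiff.lipschitzWith_of_hasCompactSupport hsupp hsmooth one_ne_zero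
  obtain ⟨C, hC⟩ := hsupp.exists_bound_of_continuous hsmooth.continuous
  have hC' : ∀ x, ‖χ x • v x‖ ≤ (Real.toNNReal C : NNReal) := fun x =>
    (hC x).trans (Real.le_coe_toNNReal C)
  choose γ hγ hγ' using exists_integralCurve_of_bounded hK hC'
  refine ⟨χ, fun t x => γ x t, ⟨hγ, fun s t x => ?_, hγ', fun x => χ.nonneg, ⟨K, hK⟩, ⟨_, hC'⟩⟩,
    Metric.ball 0 (|R| + 1), Metric.isOpen_ball, ?_, ?_⟩
  · have := ODE_solution_unique_univ (v := fun _ x => χ x • v x) (s := fun _ => univ) (K := K)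
      (f := fun s => γ x (s + t)) (g := γ (γ x t)) (t₀ := 0) (fun _ => hK.lipschitzOnWith)
      (fun s => ⟨(hγ' x (s + t)).comp_add_const s t, trivial⟩) (fun s => ⟨hγ' _ s, trivial⟩)
      (by simp [hγ])
    exact congrFun this s
  · refine hR.trans (Metric.closedBall_subset_ball ?_)
    linarith [le_abs_self R]
  · intro x hx
    exact χ.one_of_mem_closedBall (Metric.ball_subset_closedBall hx)

end Flow

end PlanarReg

namespace PlanarReg

/-! ### Isolating blocks read off an adapted flow -/

section Blocks

variable {v : ℝ × ℝ → ℝ × ℝ} {χ : ℝ × ℝ → ℝ} {Γ : ℝ → ℝ × ℝ → ℝ × ℝ} {N U : Set (ℝ × ℝ)}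

/-- The flow `Γ` of `χ • v` is adapted to the compact set `N`: `χ = 1` on the neighbourhood `U`. -/
structure IsAdaptedFlow (v : ℝ × ℝ → ℝ × ℝ) (χ : ℝ × ℝ → ℝ) (Γ : ℝ → ℝ × ℝ → ℝ × ℝ)
    (N U : Set (ℝ × ℝ)) : Prop extends IsCutoffFlow v χ Γ where
  isCompact : IsCompact N
  isOpen : IsOpen U
  subset : N ⊆ U
  eq_one : ∀ x ∈ U, χ x = 1

namespace IsAdaptedFlow

theorem reverse (h : IsAdaptedFlow v χ Γ N U) : IsAdaptedFlow (-v) χ (fun t => Γ (-t)) N U :=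
  { h.toIsCutoffFlow.reverse with
    isCompact := h.isCompact, isOpen := h.isOpen, subset := h.subset, eq_one := h.eq_one }

theorem frontier_subset (h : IsAdaptedFlow v χ Γ N U) : frontier N ⊆ N :=
  h.isCompact.isClosed.frontier_subset

theorem exists_Ioo (h : IsAdaptedFlow v χ Γ N U) {x : ℝ × ℝ} (hx : x ∈ N) :
    ∃ ε > 0, ∀ t ∈ Ioo (-ε) ε, χ (Γ t x) = 1 := by
  have h1 : ∀ᶠ t in 𝓝 (0 : ℝ), Γ t x ∈ U :=
    (h.continuous x).continuousAt.eventually_mem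
      (by simpa only [h.zero] using h.isOpen.mem_nhds (h.subset hx))
  obtain ⟨ε, hε, h2⟩ := Metric.eventually_nhds_iff_ball.1 h1
  rw [Real.ball_eq_Ioo, zero_sub, zero_add] at h2
  exact ⟨ε, hε, fun t ht => h.eq_one _ (h2 t ht)⟩

/-- Entry and exit sets are defined through arbitrary local integral curves. Their germs are those
of flow lines, so all later arguments can use `Γ` alone. -/
theorem eventuallyEq (h : IsAdaptedFlow v χ Γ N U) {x : ℝ × ℝ} (hx : x ∈ N) {γ : ℝ → ℝ × ℝ} {ε : ℝ}
    (hε : 0 < ε) (h0 : γ 0 = x) (hγ : IsIntegralCurveOn γ (fun _ => v) (Ioo (-ε) ε)) :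
    γ =ᶠ[𝓝 0] fun t => Γ t x := by
  have hc : ContinuousAt γ 0 :=
    (hγ.continuousOn 0 ⟨by linarith, hε⟩).continuousAt (Ioo_mem_nhds (by linarith) hε)
  have h1 : ∀ᶠ t in 𝓝 (0 : ℝ), γ t ∈ U :=
    hc.eventually_mem (by simpa only [h0] using h.isOpen.mem_nhds (h.subset hx))
  obtain ⟨δ, hδ, h2⟩ := Metric.eventually_nhds_iff_ball.1 h1
  rw [Real.ball_eq_Ioo, zero_sub, zero_add] at h2
  have hm : 0 < min ε δ := lt_min hε hδ
  have hsub : Ioo (-min ε δ) (min ε δ) ⊆ Ioo (-ε) ε :=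
    Ioo_subset_Ioo (neg_le_neg (min_le_left _ _)) (min_le_left _ _)
  have hsub' : Ioo (-min ε δ) (min ε δ) ⊆ Ioo (-δ) δ :=
    Ioo_subset_Ioo (neg_le_neg (min_le_right _ _)) (min_le_right _ _)
  have := h.eqOn_Ioo (a := -min ε δ) (b := min ε δ) ⟨by linarith, hm⟩ (hγ.mono hsub)
    fun t ht => h.eq_one _ (h2 t (hsub' ht))
  rw [h0] at this
  exact this.eventuallyEq_of_mem (Ioo_mem_nhds (by linarith) hm)

theorem mem_exitSet (h : IsAdaptedFlow v χ Γ N U) {x : ℝ × ℝ} :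
    x ∈ exitSet v N ↔ x ∈ frontier N ∧ ∀ᶠ t in 𝓝[>] 0, Γ t x ∉ N := by
  refine and_congr_right fun hx => ?_
  have hxN := h.frontier_subset hx
  constructor
  · rintro ⟨ε, hε, γ, h0, hγ, hout⟩
    filter_upwards [(h.eventuallyEq hxN hε h0 hγ).filter_mono nhdsWithin_le_nhds,
      Ioo_mem_nhdsGT hε] with t ht ht'
    simpa only [← ht] using hout t ht'
  · intro hout
    obtain ⟨δ, hδ, hδ'⟩ := mem_nhdsGT_iff_exists_Ioo_subset.1 hout
    obtain ⟨ε, hε, hε'⟩ := h.exists_Ioo hxN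
    have hm : 0 < min ε δ := lt_min hε hδ
    refine ⟨min ε δ, hm, fun t => Γ t x, h.zero x, h.isIntegralCurveOn fun t ht => hε' t ?_,
      fun t ht => hδ' ⟨ht.1, ht.2.trans_le (min_le_right _ _)⟩⟩
    exact Ioo_subset_Ioo (neg_le_neg (min_le_left _ _)) (min_le_left _ _) ht

end IsAdaptedFlow

theorem isIntegralCurveOn_neg_Ioo {γ : ℝ → ℝ × ℝ} {ε : ℝ}
    (hγ : IsIntegralCurveOn γ (fun _ => v) (Ioo (-ε) ε)) :
    IsIntegralCurveOn (fun t => γ (-t)) (fun _ => -v) (Ioo (-ε) ε) := by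
  intro t ht
  have ht' : -t ∈ Ioo (-ε) ε := ⟨by linarith [ht.2], by linarith [ht.1]⟩
  have := ((hγ _ ht').hasDerivAt (Ioo_mem_nhds ht'.1 ht'.2)).scomp t (hasDerivAt_neg t)
  simpa [Function.comp_def] using this.hasDerivWithinAt

theorem exitSet_subset_entrySet_neg (v : ℝ × ℝ → ℝ × ℝ) : exitSet v N ⊆ entrySet (-v) N := by
  rintro x ⟨hx, ε, hε, γ, h0, hγ, hout⟩
  exact ⟨hx, ε, hε, fun t => γ (-t), by simpa using h0, isIntegralCurveOn_neg_Ioo hγ,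
    fun t ht => hout _ ⟨by linarith [ht.2], by linarith [ht.1]⟩⟩

theorem entrySet_subset_exitSet_neg (v : ℝ × ℝ → ℝ × ℝ) : entrySet v N ⊆ exitSet (-v) N := by
  rintro x ⟨hx, ε, hε, γ, h0, hγ, hout⟩
  exact ⟨hx, ε, hε, fun t => γ (-t), by simpa using h0, isIntegralCurveOn_neg_Ioo hγ,
    fun t ht => hout _ ⟨by linarith [ht.2], by linarith [ht.1]⟩⟩

theorem entrySet_neg (v : ℝ × ℝ → ℝ × ℝ) : entrySet (-v) N = exitSet v N :=
  Subset.antisymm (by simpa using entrySet_subset_exitSet_neg (N := N) (-v))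
    (exitSet_subset_entrySet_neg v)

theorem exitSet_neg (v : ℝ × ℝ → ℝ × ℝ) : exitSet (-v) N = entrySet v N := by
  simpa using (entrySet_neg (N := N) (-v)).symm

theorem tangencySet_neg (v : ℝ × ℝ → ℝ × ℝ) : tangencySet (-v) N = tangencySet v N := by
  simp [tangencySet]

theorem IsIsolatingBlock.neg (h : IsIsolatingBlock v N) : IsIsolatingBlock (-v) N where
  isCompact := h.isCompact
  smooth_boundary := h.smooth_boundary
  union_eq := by rw [entrySet_neg, exitSet_neg, union_comm, h.union_eq]
  inter_eq := by rw [entrySet_neg, exitSet_neg, inter_comm, h.inter_eq, tangencySet_neg]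
  finite_tangency := by rw [tangencySet_neg]; exact h.finite_tangency

namespace IsAdaptedFlow

theorem mem_entrySet (h : IsAdaptedFlow v χ Γ N U) {x : ℝ × ℝ} :
    x ∈ entrySet v N ↔ x ∈ frontier N ∧ ∀ᶠ t in 𝓝[<] 0, Γ t x ∉ N := by
  rw [← exitSet_neg, h.reverse.mem_exitSet]
  refine and_congr_right fun _ => ?_
  have : map (fun t : ℝ => -t) (𝓝[>] 0) = 𝓝[<] 0 := by simp
  rw [← this, eventually_map]

theorem mem_asymptoticEntrySet (h : IsAdaptedFlow v χ Γ N U) {x : ℝ × ℝ} :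
    x ∈ asymptoticEntrySet v N ↔ x ∈ entrySet v N ∧ ∀ t, 0 ≤ t → Γ t x ∈ N := by
  refine and_congr_right fun hx => ?_
  constructor
  · rintro ⟨γ, h0, hγ, hN⟩ t ht
    have := h.eqOn_Icc (T := t) (hγ.mono Icc_subset_Ici_self)
      fun s hs => h.eq_one _ (h.subset (hN s hs.1))
    rw [← h0]
    exact (show γ t = Γ t (γ 0) from this ⟨ht, le_rfl⟩) ▸ hN t ht
  · intro hN
    exact ⟨fun t => Γ t x, h.zero x,
      h.isIntegralCurveOn fun t ht => h.eq_one _ (h.subset (hN t ht)), hN⟩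

theorem blockMapGraph_iff (h : IsAdaptedFlow v χ Γ N U) {x y : ℝ × ℝ} :
    BlockMapGraph v N x y ↔ x ∈ entrySet v N ∧ y ∈ exitSet v N ∧
      ∃ T, 0 ≤ T ∧ Γ T x = y ∧ ∀ t ∈ Icc 0 T, Γ t x ∈ N := by
  refine and_congr_right fun hx => and_congr_right fun hy => ?_
  constructor
  · rintro ⟨T, hT, γ, h0, hT', hγ, hN⟩
    have := h.eqOn_Icc hγ fun s hs => h.eq_one _ (h.subset (hN s hs))
    rw [h0] at this
    exact ⟨T, hT, by rw [← hT', this ⟨hT, le_rfl⟩], fun t ht => (show γ t = Γ t x from this ht) ▸ hN t ht⟩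
  · rintro ⟨T, hT, hT', hN⟩
    exact ⟨T, hT, fun t => Γ t x, h.zero x, hT',
      h.isIntegralCurveOn fun t ht => h.eq_one _ (h.subset (hN t ht)), hN⟩

theorem mem_maximalInvariantSet (h : IsAdaptedFlow v χ Γ N U) {x : ℝ × ℝ} :
    x ∈ maximalInvariantSet v N ↔ ∀ t, Γ t x ∈ N := by
  constructor
  · rintro ⟨γ, h0, hγ, hN⟩ t
    rw [← h0, ← h.eq_of_hasDerivAt fun s => ?_]
    · exact hN t
    · rw [h.eq_one _ (h.subset (hN s)), one_smul]
      exact hγ s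
  · intro hN
    refine ⟨fun t => Γ t x, h.zero x, fun t => ?_, hN⟩
    simpa [h.eq_one _ (h.subset (hN t))] using h.hasDerivAt x t

end IsAdaptedFlow

namespace IsDefiningFunctionAt

variable {x : ℝ × ℝ} {g : ℝ × ℝ → ℝ}

/-- A curve crossing the boundary inwards is inside right after and outside right before. -/
theorem eventually_of_neg (hg : IsDefiningFunctionAt N x g) {γ : ℝ → ℝ × ℝ} {w : ℝ × ℝ}
    (h0 : γ 0 = x) (hγ : HasDerivAt γ w 0) (hw : fderiv ℝ g x w < 0) :
    (∀ᶠ t in 𝓝[>] 0, γ t ∈ N) ∧ ∀ᶠ t in 𝓝[<] 0, γ t ∉ N := by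
  obtain ⟨hsm, hgx, -, hN⟩ := hg
  have hd : HasDerivAt (fun t => g (γ t)) (fderiv ℝ g x w) 0 := by
    have := (hsm.differentiable (by simp) (γ 0)).hasFDerivAt.comp_hasDerivAt 0 hγ
    rwa [h0] at this
  have hN' : ∀ᶠ t in 𝓝 (0 : ℝ), (γ t ∈ N ↔ g (γ t) ≤ 0) :=
    hγ.continuousAt.eventually (by rwa [h0])
  have hs := hasDerivAt_iff_tendsto_slope.1 hd
  have hs' : ∀ᶠ t in 𝓝[≠] (0 : ℝ), slope (fun t => g (γ t)) 0 t < 0 := hs.eventually_lt_const hw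
  constructor
  · filter_upwards [hs'.filter_mono (nhdsWithin_mono _ fun t ht => ne_of_gt ht),
      hN'.filter_mono nhdsWithin_le_nhds, self_mem_nhdsWithin] with t h1 h2 h3
    rw [h2]
    simp only [slope_def_field, h0, hgx, sub_zero] at h1
    by_contra hcon
    exact absurd h1 (not_lt.2 (div_nonneg (not_le.1 hcon).le (le_of_lt h3)))
  · filter_upwards [hs'.filter_mono (nhdsWithin_mono _ fun t ht => ne_of_lt ht),
      hN'.filter_mono nhdsWithin_le_nhds, self_mem_nhdsWithin] with t h1 h2 h3
    rw [h2]
    simp only [slope_def_field, h0, hgx, sub_zero] at h1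
    intro hcon
    exact absurd h1 (not_lt.2 (div_nonneg_of_nonpos hcon (le_of_lt h3)))

end IsDefiningFunctionAt

namespace IsAdaptedFlow

variable {x : ℝ × ℝ} {g : ℝ × ℝ → ℝ}

theorem hasDerivAt_zero (h : IsAdaptedFlow v χ Γ N U) (hx : x ∈ N) :
    HasDerivAt (fun t => Γ t x) (v x) 0 := by
  simpa [h.zero, h.eq_one _ (h.subset hx)] using h.hasDerivAt x 0

theorem inward (h : IsAdaptedFlow v χ Γ N U) (hx : x ∈ frontier N)
    (hg : IsDefiningFunctionAt N x g) (hv : fderiv ℝ g x (v x) < 0) :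
    x ∈ entrySet v N ∧ x ∉ exitSet v N ∧ ∀ᶠ t in 𝓝[>] 0, Γ t x ∈ N := by
  obtain ⟨h1, h2⟩ := hg.eventually_of_neg (h.zero x) (h.hasDerivAt_zero (h.frontier_subset hx)) hv
  refine ⟨h.mem_entrySet.2 ⟨hx, h2⟩, fun hex => ?_, h1⟩
  obtain ⟨t, ht, ht'⟩ := (h1.and (h.mem_exitSet.1 hex).2).exists
  exact ht' ht

theorem outward (h : IsAdaptedFlow v χ Γ N U) (hx : x ∈ frontier N)
    (hg : IsDefiningFunctionAt N x g) (hv : 0 < fderiv ℝ g x (v x)) :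
    x ∈ exitSet v N ∧ x ∉ entrySet v N := by
  have := h.reverse.inward hx hg (by simpa using hv)
  rw [entrySet_neg, exitSet_neg] at this
  exact ⟨this.1, this.2.1⟩

/-- A vanishing derivative would make x a tangency, hence an exit point by `inter_eq`; a positive
one would mean an outward crossing, which is no entry. -/
theorem exists_inward (h : IsAdaptedFlow v χ Γ N U) (hB : IsIsolatingBlock v N)
    (hx : x ∈ entrySet v N) (hx' : x ∉ exitSet v N) :
    ∃ g, IsDefiningFunctionAt N x g ∧ fderiv ℝ g x (v x) < 0 := by
  obtain ⟨g, hg⟩ := hB.smooth_boundary x hx.1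
  refine ⟨g, hg, ?_⟩
  rcases lt_trichotomy (fderiv ℝ g x (v x)) 0 with h0 | h0 | h0
  · exact h0
  · have : x ∈ tangencySet v N := ⟨hx.1, g, hg, h0⟩
    rw [← hB.inter_eq] at this
    exact absurd this.2 hx'
  · exact absurd hx (h.outward hx.1 hg h0).2

/-- An orbit starting in an isolating block either stays forever or leaves through the exit set. -/
theorem forward_exit (h : IsAdaptedFlow v χ Γ N U) (hB : IsIsolatingBlock v N) (hx : x ∈ N) :
    (∀ t, 0 ≤ t → Γ t x ∈ N) ∨
      ∃ T, 0 ≤ T ∧ Γ T x ∈ exitSet v N ∧ ∀ t ∈ Icc 0 T, Γ t x ∈ N := by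
  by_cases hstay : ∀ t, 0 ≤ t → Γ t x ∈ N
  · exact Or.inl hstay
  refine Or.inr ?_
  push Not at hstay
  set S := {t : ℝ | 0 ≤ t ∧ Γ t x ∉ N} with hS
  have hne : S.Nonempty := hstay
  have hbdd : BddBelow S := ⟨0, fun t ht => ht.1⟩
  set T := sInf S with hT
  have hT0 : 0 ≤ T := le_csInf hne fun t ht => ht.1
  have hlt : ∀ t ∈ Ico 0 T, Γ t x ∈ N := fun t ht => by
    by_contra hcon
    exact absurd (csInf_le hbdd (show t ∈ S from ⟨ht.1, hcon⟩)) (not_le.2 ht.2)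
  have hTN : Γ T x ∈ N := by
    rcases hT0.eq_or_lt with h0 | h0
    · rwa [← h0, h.zero]
    · refine h.isCompact.isClosed.mem_of_tendsto (b := 𝓝[<] T)
        ((h.continuous x).continuousAt.tendsto.mono_left nhdsWithin_le_nhds) ?_
      filter_upwards [Ico_mem_nhdsLT h0] with t ht using hlt t ht
  have hle : ∀ t ∈ Icc 0 T, Γ t x ∈ N := fun t ht => by
    rcases ht.2.eq_or_lt with h1 | h1
    · rwa [h1]
    · exact hlt t ⟨ht.1, h1⟩
  -- `T` is the infimum of the times spent outside but is not one of them, so such times accumulate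
  -- at `T` from the right.
  have hfreq : ∃ᶠ t in 𝓝[>] 0, Γ t (Γ T x) ∉ N := by
    rw [frequently_nhdsWithin_iff, Metric.nhds_basis_ball.frequently_iff]
    intro ε hε
    obtain ⟨s, hs, hs'⟩ := exists_lt_of_csInf_lt hne (show sInf S < T + ε by linarith)
    have hsT : T < s := by
      by_contra hcon
      exact hs.2 (hle s ⟨hs.1, not_lt.1 hcon⟩)
    refine ⟨s - T, ?_, ?_, sub_pos.2 hsT⟩
    · rw [Metric.mem_ball, Real.dist_eq, sub_zero, abs_of_pos (sub_pos.2 hsT)]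
      linarith
    · rw [← h.add, sub_add_cancel]
      exact hs.2
  have hfront : Γ T x ∈ frontier N := by
    rw [h.isCompact.isClosed.frontier_eq]
    refine ⟨hTN, fun hint => hfreq ?_⟩
    have := (h.continuous (Γ T x)).continuousAt (x := 0) |>.eventually_mem
      (s := interior N) (by simpa only [h.zero] using isOpen_interior.mem_nhds hint)
    filter_upwards [this.filter_mono nhdsWithin_le_nhds] with t ht
    exact not_not.2 (interior_subset ht)
  refine ⟨T, hT0, ?_, hle⟩
  -- A boundary point that is not an exit point is a transversal entry point. The orbit is then
  -- inside right after `T`, against `hfreq`.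
  by_contra hex
  have hen : Γ T x ∈ entrySet v N := by
    have := hB.union_eq ▸ hfront
    exact this.resolve_right hex
  obtain ⟨g, hg, hg'⟩ := h.exists_inward hB hen hex
  refine hfreq ?_
  filter_upwards [(h.inward hfront hg hg').2.2] with t ht using not_not.2 ht

/-- Right after an exit point the orbit is outside, so a stay in `N` cannot outlast the visit. Used
in both directions, this identifies two exit times of one orbit. -/
theorem exit_unique (h : IsAdaptedFlow v χ Γ N U) {y : ℝ × ℝ} {S T : ℝ} (hy : y ∈ exitSet v N)
    (hS0 : 0 ≤ S) (hS : Γ S x = y) (hST : ∀ t ∈ Icc 0 T, Γ t x ∈ N) : T ≤ S := by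
  by_contra hcon
  rw [not_le] at hcon
  obtain ⟨t, ht, ht'⟩ := ((h.mem_exitSet.1 hy).2.and (Ioo_mem_nhdsGT (sub_pos.2 hcon))).exists
  refine ht ?_
  rw [← hS, ← h.add]
  exact hST _ ⟨by linarith [ht'.1], by linarith [ht'.2]⟩

end IsAdaptedFlow

end Blocks

end PlanarReg

/-! ### Trivialised blocks and their symmetry under time reversal -/

namespace PlanarReg

/-- A trivialised isolating block with maximal invariant set in `{0}`, in terms of a complete flow
that is adapted to the block. The data are symmetric under time reversal. -/
structure TrivialisedBlock (v : ℝ × ℝ → ℝ × ℝ) where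
  N : Set (ℝ × ℝ)
  U : Set (ℝ × ℝ)
  χ : ℝ × ℝ → ℝ
  Γ : ℝ → ℝ × ℝ → ℝ × ℝ
  nP : Set (ℝ × ℝ)
  nM : Set (ℝ × ℝ)
  flow : IsAdaptedFlow v χ Γ N U
  frontier_eq : nP ∪ nM = frontier N
  zero_mem : (0 : ℝ × ℝ) ∈ N
  invariant : ∀ x, (∀ t, Γ t x ∈ N) → x = 0
  inward : ∀ x ∈ nP, x ∉ nM → ∃ g, IsDefiningFunctionAt N x g ∧ fderiv ℝ g x (v x) < 0
  outward : ∀ x ∈ nM, x ∉ nP → ∃ g, IsDefiningFunctionAt N x g ∧ fderiv ℝ g x ((-v) x) < 0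
  leave_exit : ∀ x ∈ nM, ∀ᶠ t in 𝓝[>] 0, Γ t x ∉ N
  leave_entry : ∀ x ∈ nP, ∀ᶠ t in 𝓝[>] 0, Γ (-t) x ∉ N
  forward_exit : ∀ x ∈ N, (∀ t, 0 ≤ t → Γ t x ∈ N) ∨
    ∃ T, 0 ≤ T ∧ Γ T x ∈ nM ∧ ∀ t ∈ Icc 0 T, Γ t x ∈ N
  backward_exit : ∀ x ∈ N, (∀ t, 0 ≤ t → Γ (-t) x ∈ N) ∨
    ∃ T, 0 ≤ T ∧ Γ (-T) x ∈ nP ∧ ∀ t ∈ Icc 0 T, Γ (-t) x ∈ N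
  e : nP ≃ₜ nM
  map_of_leave : ∀ x : nP, (∃ t, 0 ≤ t ∧ Γ t x ∉ N) → ∃ T, 0 ≤ T ∧ Γ T x = e x
  symm_of_leave : ∀ y : nM, (∃ t, 0 ≤ t ∧ Γ (-t) y ∉ N) → ∃ T, 0 ≤ T ∧ Γ (-T) y = e.symm y
  unique_entry : ∀ φ : nP ≃ₜ nP, (∀ x : nP, (∃ t, 0 ≤ t ∧ Γ t x ∉ N) → φ x = x) → ∀ x, φ x = x
  unique_exit : ∀ φ : nM ≃ₜ nM, (∀ y : nM, (∃ t, 0 ≤ t ∧ Γ (-t) y ∉ N) → φ y = y) → ∀ y, φ y = y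

namespace TrivialisedBlock

variable {v : ℝ × ℝ → ℝ × ℝ}

/-- Time reversal. -/
def reverse (B : TrivialisedBlock v) : TrivialisedBlock (-v) where
  N := B.N
  U := B.U
  χ := B.χ
  Γ := fun t => B.Γ (-t)
  nP := B.nM
  nM := B.nP
  flow := B.flow.reverse
  frontier_eq := by rw [union_comm, B.frontier_eq]
  zero_mem := B.zero_mem
  invariant x hx := B.invariant x fun t => by simpa using hx (-t)
  inward := B.outward
  outward := by simpa using B.inward
  leave_exit := B.leave_entry
  leave_entry := by simpa using B.leave_exit
  forward_exit := B.backward_exit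
  backward_exit := by simpa using B.forward_exit
  e := B.e.symm
  map_of_leave := B.symm_of_leave
  symm_of_leave := by simpa using B.map_of_leave
  unique_entry := B.unique_exit
  unique_exit := by simpa using B.unique_entry

variable (B : TrivialisedBlock v)

theorem stays_forward_not_mem_exit {x : ℝ × ℝ} (hx : ∀ t, 0 ≤ t → B.Γ t x ∈ B.N) : x ∉ B.nM := by
  intro h
  obtain ⟨t, ht, ht'⟩ := ((B.leave_exit x h).and self_mem_nhdsWithin).exists
  exact ht (hx t (le_of_lt ht'))

/-- The homeomorphism maps asymptotic entry points to asymptotic exit points. -/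
theorem map_stays (x : B.nP) (hx : ∀ t, 0 ≤ t → B.Γ t x ∈ B.N) {t : ℝ} (ht : 0 ≤ t) :
    B.Γ (-t) (B.e x) ∈ B.N := by
  by_contra hcon
  -- If the backward orbit of `e x` left `N`, then `x` would flow to `e x`, and it would leave the
  -- block right afterwards.
  obtain ⟨T, hT, hT'⟩ := B.symm_of_leave (B.e x) ⟨t, ht, hcon⟩
  rw [Homeomorph.symm_apply_apply] at hT'
  have h1 : B.Γ T x = B.e x := by
    rw [← hT', ← B.flow.add, add_neg_cancel, B.flow.zero]
  obtain ⟨s, hs, hs'⟩ := ((B.leave_exit _ (B.e x).2).and self_mem_nhdsWithin).exists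
  refine hs ?_
  rw [← h1, ← B.flow.add]
  exact hx _ (add_nonneg (le_of_lt hs') hT)

/-- An orbit that tends to stay in the block forwards has an asymptotic entry point. -/
theorem exists_entry {z : ℝ × ℝ} (hz : z ≠ 0) (hst : ∀ t, 0 ≤ t → B.Γ t z ∈ B.N) :
    ∃ T, 0 ≤ T ∧ B.Γ (-T) z ∈ B.nP ∧ ∀ t, 0 ≤ t → B.Γ t (B.Γ (-T) z) ∈ B.N := by
  have hzN : z ∈ B.N := by simpa [B.flow.zero] using hst 0 le_rfl
  rcases B.backward_exit z hzN with h | ⟨T, hT, hT', hN⟩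
  · refine absurd (B.invariant z fun t => ?_) hz
    rcases le_total 0 t with h0 | h0
    · exact hst t h0
    · simpa using h (-t) (by linarith)
  · refine ⟨T, hT, hT', fun t ht => ?_⟩
    rw [← B.flow.add]
    rcases le_total T t with h1 | h1
    · exact hst _ (by linarith)
    · have := hN (T - t) ⟨by linarith, by linarith⟩
      rwa [neg_sub, sub_eq_add_neg] at this

theorem exists_inward (x : ℝ × ℝ) (hx : x ∈ B.nP) (hst : ∀ t, 0 ≤ t → B.Γ t x ∈ B.N) :
    ∃ g, IsDefiningFunctionAt B.N x g ∧ fderiv ℝ g x (v x) < 0 :=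
  B.inward x hx (B.stays_forward_not_mem_exit hst)

/-- Near a transversal entry point, the zeros of the defining function are entry points. -/
theorem eventually_mem_entry (hv : Continuous v) {x : ℝ × ℝ} {g : ℝ × ℝ → ℝ}
    (hg : IsDefiningFunctionAt B.N x g) (hgv : fderiv ℝ g x (v x) < 0) :
    ∀ᶠ q in 𝓝 x, (g q = 0 ↔ q ∈ B.nP) := by
  obtain ⟨hsm, hgx, -, hN⟩ := hg
  have hc : Continuous fun q => fderiv ℝ g q (v q) :=
    (hsm.continuous_fderiv (by simp)).clm_apply hv
  filter_upwards [hN.eventually_nhds, hc.continuousAt.eventually_lt_const hgv] with q hq hq'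
  have hd : ∀ hgq : g q = 0, IsDefiningFunctionAt B.N q g := fun hgq =>
    ⟨hsm, hgq, fun h0 => by simp [h0] at hq', hq⟩
  constructor
  · intro hgq
    have hqN : q ∈ B.N := hq.self_of_nhds.2 hgq.le
    obtain ⟨h1, h2⟩ := (hd hgq).eventually_of_neg (B.flow.zero q)
      (B.flow.hasDerivAt_zero hqN) hq'
    have hfr : q ∈ frontier B.N := by
      rw [B.flow.isCompact.isClosed.frontier_eq]
      refine ⟨hqN, fun hint => ?_⟩
      have := (B.flow.continuous q).continuousAt (x := 0) |>.eventually_mem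
        (s := interior B.N) (by simpa only [B.flow.zero] using isOpen_interior.mem_nhds hint)
      obtain ⟨t, ht, ht'⟩ := (h2.and (this.filter_mono nhdsWithin_le_nhds)).exists
      exact ht (interior_subset ht')
    rw [← B.frontier_eq] at hfr
    refine hfr.resolve_right fun hM => ?_
    obtain ⟨t, ht, ht'⟩ := (h1.and (B.leave_exit q hM)).exists
    exact ht' ht
  · intro hqP
    have hfr : q ∈ frontier B.N := B.frontier_eq ▸ Or.inl hqP
    have hqN := B.flow.frontier_subset hfr
    refine le_antisymm (hq.self_of_nhds.1 hqN) (not_lt.1 fun hlt => ?_)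
    rw [B.flow.isCompact.isClosed.frontier_eq] at hfr
    refine hfr.2 (mem_interior_iff_mem_nhds.2 ?_)
    filter_upwards [hq, hsm.continuous.continuousAt.eventually_lt_const hlt] with p hp hp'
    exact hp.2 hp'.le

end TrivialisedBlock

/-- The definition speaks of n⁺ and forward orbits only. The work is to derive the statements about
`e.symm`, backward orbits and homeomorphisms of n⁻, so that the reversed data form a trivialised
block again. -/
theorem IsC0Regularisable.exists_trivialisedBlock {v : ℝ × ℝ → ℝ × ℝ} (hv : ContDiff ℝ 1 v)
    (h : IsC0Regularisable v 0) : Nonempty (TrivialisedBlock v) := by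
  obtain ⟨N, hB, hinv, e, he, hu⟩ := h
  obtain ⟨χ, Γ, hΓ, U, hU, hNU, hχ⟩ := exists_cutoffFlow hv hB.isCompact
  have hF : IsAdaptedFlow v χ Γ N U := { hΓ with
    isCompact := hB.isCompact, isOpen := hU, subset := hNU, eq_one := hχ }
  have hmap : ∀ x : entrySet v N, (∃ t, 0 ≤ t ∧ Γ t x ∉ N) →
      ∃ T, 0 ≤ T ∧ Γ T x = e x ∧ ∀ t ∈ Icc 0 T, Γ t x ∈ N := by
    rintro x ⟨t, ht, ht'⟩
    have := he x fun hx => ht' ((hF.mem_asymptoticEntrySet.1 hx).2 t ht)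
    exact (hF.blockMapGraph_iff.1 this).2.2
  have hbwd : ∀ x ∈ N, (∀ t, 0 ≤ t → Γ (-t) x ∈ N) ∨
      ∃ T, 0 ≤ T ∧ Γ (-T) x ∈ entrySet v N ∧ ∀ t ∈ Icc 0 T, Γ (-t) x ∈ N := fun x hx => by
    have := hF.reverse.forward_exit hB.neg hx
    rwa [exitSet_neg] at this
  have hsymm : ∀ y : exitSet v N, (∃ t, 0 ≤ t ∧ Γ (-t) y ∉ N) →
      ∃ T, 0 ≤ T ∧ Γ (-T) y = e.symm y := by
    rintro y ⟨t, ht, ht'⟩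
    rcases hbwd y (hF.frontier_subset y.2.1) with h1 | ⟨T, hT, hT', hN⟩
    · exact absurd (h1 t ht) ht'
    set x : entrySet v N := ⟨Γ (-T) y, hT'⟩ with hx
    have hxy : Γ T x = y := by rw [hx, ← hF.add, add_neg_cancel, hF.zero]
    have hxN : ∀ t ∈ Icc 0 T, Γ t x ∈ N := fun t ht => by
      have := hN (T - t) ⟨by linarith [ht.2], by linarith [ht.1]⟩
      rwa [neg_sub, sub_eq_add_neg, hF.add] at this
    obtain ⟨s, hs, hs'⟩ := ((hF.mem_exitSet.1 y.2).2.and self_mem_nhdsWithin).exists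
    obtain ⟨T', hT0', hxT', hxN'⟩ := hmap x ⟨s + T, add_nonneg (le_of_lt hs') hT, by
      rwa [hF.add, hxy]⟩
    -- Both times are visits to exit points before which the orbit is inside, so neither exceeds the
    -- other; hence `e x = y`.
    have h2 : T' = T := le_antisymm (hF.exit_unique y.2 hT hxy hxN')
      (hF.exit_unique (e x).2 hT0' hxT' hxN)
    have h3 : e x = y := Subtype.ext (by rw [← hxT', h2, hxy])
    exact ⟨T, hT, by rw [← h3, Homeomorph.symm_apply_apply, h3]⟩
  have hunique : ∀ φ : entrySet v N ≃ₜ entrySet v N,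
      (∀ x : entrySet v N, (∃ t, 0 ≤ t ∧ Γ t x ∉ N) → φ x = x) → ∀ x, φ x = x := by
    intro φ hφ x
    -- Precomposing `e` with `φ` changes nothing at leaving points, so it extends the block map as
    -- well and must equal `e`.
    have := hu (φ.trans e) fun x hx => by
      have hx' : ∃ t, 0 ≤ t ∧ Γ t x ∉ N := by
        by_contra hcon
        push Not at hcon
        exact hx (hF.mem_asymptoticEntrySet.2 ⟨x.2, hcon⟩)
      simpa [hφ x hx'] using he x hx
    have h2 := DFunLike.congr_fun this x
    exact e.injective h2
  have hout : ∀ x : entrySet v N, ∀ᶠ t in 𝓝[>] 0, Γ (-t) x ∉ N := fun x => by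
    have hx : (x : ℝ × ℝ) ∈ exitSet (-v) N := by
      rw [exitSet_neg]
      exact x.2
    exact (hF.reverse.mem_exitSet.1 hx).2
  refine ⟨⟨N, U, χ, Γ, entrySet v N, exitSet v N, hF, hB.union_eq, ?_, fun x hx => ?_,
    fun x hx hx' => hF.exists_inward hB hx hx', fun x hx hx' => ?_,
    fun x hx => (hF.mem_exitSet.1 hx).2, fun x hx => hout ⟨x, hx⟩,
    fun x hx => hF.forward_exit hB hx, hbwd, e, fun x hx => ?_, hsymm, hunique, ?_⟩⟩
  · have : (0 : ℝ × ℝ) ∈ maximalInvariantSet v N := hinv ▸ rfl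
    simpa [hF.zero] using hF.mem_maximalInvariantSet.1 this 0
  · have := hF.mem_maximalInvariantSet.2 hx
    rwa [hinv] at this
  · refine hF.reverse.exists_inward hB.neg ?_ ?_
    · rwa [entrySet_neg]
    · rwa [exitSet_neg]
  · obtain ⟨T, hT, hT', -⟩ := hmap x hx
    exact ⟨T, hT, hT'⟩
  · intro φ hφ y
    have := hunique ((e.trans φ).trans e.symm) (fun x hx => ?_) (e.symm y)
    · simpa [Homeomorph.symm_apply_eq] using this
    · obtain ⟨T, hT, hT', -⟩ := hmap x hx
      obtain ⟨s, hs, hs'⟩ := ((hout x).and self_mem_nhdsWithin).exists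
      have := hφ (e x) ⟨s + T, add_nonneg (le_of_lt hs') hT, by
        rw [← hT', ← hF.add]
        simpa using hs⟩
      simp [this]

end PlanarReg

/-! ### Pushing points along a boundary arc -/

namespace PlanarReg

/-- A homeomorphism of the line that moves `c` and is supported in `[c - ε, c + ε]`. -/
theorem exists_bump_homeomorph (c : ℝ) {ε : ℝ} (hε : 0 < ε) :
    ∃ η : ℝ ≃ₜ ℝ, η c ≠ c ∧ ∀ t, ε < |t - c| → η t = t := by
  -- The tent function is 1-Lipschitz; half of it leaves the sum with the identity strictly
  -- increasing.
  set f : ℝ → ℝ := fun t => t + max 0 (ε - |t - c|) / 2 with hf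
  have hcont : Continuous f := by fun_prop
  have hmono : StrictMono f := by
    intro s t hst
    have h1 : |t - c| ≤ |s - c| + (t - s) := by
      calc |t - c| = |(s - c) + (t - s)| := by ring_nf
        _ ≤ |s - c| + |t - s| := abs_add_le _ _
        _ = _ := by rw [abs_of_pos (sub_pos.2 hst)]
    have h2 : max 0 (ε - |s - c|) ≤ max 0 (ε - |t - c|) + (t - s) :=
      max_le (by linarith [le_max_left 0 (ε - |t - c|)]) (by linarith [le_max_right 0 (ε - |t - c|)])
    simp only [hf]
    linarith
  have hge : ∀ t, t ≤ f t := fun t => by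
    have := le_max_left 0 (ε - |t - c|)
    simp only [hf]
    linarith
  have hle : ∀ t, f t ≤ t + ε / 2 := fun t => by
    have : max 0 (ε - |t - c|) ≤ ε := max_le hε.le (by linarith [abs_nonneg (t - c)])
    simp only [hf]
    linarith
  have hsurj : Function.Surjective f := hcont.surjective
    (tendsto_atTop_mono hge tendsto_id)
    (tendsto_atBot_mono hle (tendsto_atBot_add_const_right _ _ tendsto_id))
  refine ⟨(StrictMono.orderIsoOfSurjective f hmono hsurj).toHomeomorph, ?_, fun t ht => ?_⟩
  · simp [hf, hε.le, hε.ne']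
  · have : ε - |t - c| ≤ 0 := by linarith
    simp [hf, this]

/-- A plane set that is locally a regular level set of a smooth function has nontrivial
homeomorphisms supported near a given point. -/
theorem exists_push {A V : Set (ℝ × ℝ)} {x : ℝ × ℝ} (hx : x ∈ A) {g : ℝ × ℝ → ℝ}
    (hg : ContDiff ℝ 1 g) (hdg : fderiv ℝ g x ≠ 0) (hA : ∀ᶠ q in 𝓝 x, (g q = 0 ↔ q ∈ A))
    (hV : V ∈ 𝓝 x) :
    ∃ φ : A ≃ₜ A, (∀ q : A, (q : ℝ × ℝ) ∉ V → φ q = q) ∧ ∃ q, φ q ≠ q := by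
  set a := fderiv ℝ g x (1, 0) with ha
  set b := fderiv ℝ g x (0, 1) with hb
  have hlin : ∀ w : ℝ × ℝ, fderiv ℝ g x w = a * w.1 + b * w.2 := by
    intro w
    have : w = w.1 • (1, 0) + w.2 • (0, 1) := by ext <;> simp
    conv_lhs => rw [this, map_add, map_smul, map_smul]
    simp [ha, hb, mul_comm]
  have hab : a ^ 2 + b ^ 2 ≠ 0 := by
    intro h0
    have h1 : a = 0 := by nlinarith [sq_nonneg a, sq_nonneg b]
    have h2 : b = 0 := by nlinarith [sq_nonneg a, sq_nonneg b]
    exact hdg (by ext <;> simp [hlin, h1, h2])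
  -- `lam` is dual to the gradient turned by a right angle. The pair `(g, lam)` has Jacobian
  -- determinant a² + b² at x, so it is a local chart in which `A` becomes a piece of {0} × ℝ.
  set lam : ℝ × ℝ →L[ℝ] ℝ :=
    (-b) • ContinuousLinearMap.fst ℝ ℝ ℝ + a • ContinuousLinearMap.snd ℝ ℝ ℝ with hlam
  have hlam' : ∀ w : ℝ × ℝ, lam w = -b * w.1 + a * w.2 := fun w => by simp [hlam]
  set f' : ℝ × ℝ →L[ℝ] ℝ × ℝ := (fderiv ℝ g x).prod lam with hf'
  have hinj : Function.Injective f' := by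
    rw [injective_iff_map_eq_zero]
    intro w hw
    have h1 : a * w.1 + b * w.2 = 0 := by
      simpa [hf', hlin] using congrArg Prod.fst hw
    have h2 : -b * w.1 + a * w.2 = 0 := by
      simpa [hf', hlam'] using congrArg Prod.snd hw
    have h3 : (a ^ 2 + b ^ 2) * w.1 = 0 := by linear_combination a * h1 - b * h2
    have h4 : (a ^ 2 + b ^ 2) * w.2 = 0 := by linear_combination b * h1 + a * h2
    ext
    · simpa [hab] using h3
    · simpa [hab] using h4
  set L : (ℝ × ℝ) ≃L[ℝ] ℝ × ℝ :=
    (LinearEquiv.ofInjectiveEndo (f' : ℝ × ℝ →ₗ[ℝ] ℝ × ℝ) hinj).toContinuousLinearEquiv with hL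
  have hLf : (L : ℝ × ℝ →L[ℝ] ℝ × ℝ) = f' := by
    refine ContinuousLinearMap.ext fun w => rfl
  have hstrict : HasStrictFDerivAt (fun q => (g q, lam q)) (L : ℝ × ℝ →L[ℝ] ℝ × ℝ) x := by
    rw [hLf]
    exact (hg.contDiffAt.hasStrictFDerivAt (by simp)).prodMk lam.hasStrictFDerivAt
  obtain ⟨W, hWsub, hWo, hxW⟩ := mem_nhds_iff.1 (inter_mem hV hA)
  set Φ := (hstrict.toOpenPartialHomeomorph _).restrOpen W hWo with hΦ
  have hΦx : x ∈ Φ.source := ⟨hstrict.mem_toOpenPartialHomeomorph_source, hxW⟩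
  have hΦc : ∀ q, Φ q = (g q, lam q) := fun q => rfl
  have hΦA : ∀ q ∈ Φ.source, (g q = 0 ↔ q ∈ A) := fun q hq => (hWsub hq.2).2
  have hΦV : Φ.source ⊆ V := fun q hq => (hWsub hq.2).1
  set c := lam x with hc
  have hgx : g x = 0 := (hΦA x hΦx).2 hx
  have htgt : (fun t : ℝ => ((0 : ℝ), t)) ⁻¹' Φ.target ∈ 𝓝 c := by
    refine (by fun_prop : Continuous fun t : ℝ => ((0 : ℝ), t)).continuousAt.preimage_mem_nhds ?_
    refine Φ.open_target.mem_nhds ?_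
    rw [← hgx, hc, ← hΦc]
    exact Φ.map_source hΦx
  obtain ⟨ε, hε, hεt⟩ := Metric.nhds_basis_closedBall.mem_iff.1 htgt
  have hεt' : ∀ t, |t - c| ≤ ε → ((0 : ℝ), t) ∈ Φ.target := fun t ht =>
    hεt (by rwa [Metric.mem_closedBall, Real.dist_eq])
  classical
  -- A homeomorphism of the line acts on the second chart coordinate; outside the chart nothing
  -- moves.
  let F : (ℝ ≃ₜ ℝ) → ℝ × ℝ → ℝ × ℝ := fun η q =>
    if q ∈ Φ.source then Φ.symm (0, η (lam q)) else q
  have hΦq : ∀ q ∈ A, q ∈ Φ.source → Φ q = (0, lam q) := fun q hq hs => by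
    rw [hΦc, (hΦA q hs).2 hq]
  have hmem : ∀ η : ℝ ≃ₜ ℝ, (∀ t, ε < |t - c| → η t = t) → ∀ q ∈ A, q ∈ Φ.source →
      ((0 : ℝ), η (lam q)) ∈ Φ.target := by
    intro η hη q hq hs
    by_cases h : |η (lam q) - c| ≤ ε
    · exact hεt' _ h
    · have h1 : η (η (lam q)) = η (lam q) := hη _ (not_le.1 h)
      rw [η.injective h1, ← hΦq q hq hs]
      exact Φ.map_source hs
  have hsrc : ∀ η : ℝ ≃ₜ ℝ, (∀ t, ε < |t - c| → η t = t) → ∀ q ∈ A, q ∈ Φ.source →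
      F η q ∈ Φ.source ∧ Φ (F η q) = (0, η (lam q)) := by
    intro η hη q hq hs
    simp only [F, if_pos hs]
    exact ⟨Φ.map_target (hmem η hη q hq hs), Φ.right_inv (hmem η hη q hq hs)⟩
  have hmaps : ∀ η : ℝ ≃ₜ ℝ, (∀ t, ε < |t - c| → η t = t) → ∀ q ∈ A, F η q ∈ A := by
    intro η hη q hq
    by_cases hs : q ∈ Φ.source
    · obtain ⟨h1, h2⟩ := hsrc η hη q hq hs
      refine (hΦA _ h1).1 ?_
      rw [hΦc] at h2
      exact congrArg Prod.fst h2
    · simpa only [F, if_neg hs] using hq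
  have hinv : ∀ η η' : ℝ ≃ₜ ℝ, (∀ t, ε < |t - c| → η t = t) → (∀ t, η' (η t) = t) → ∀ q ∈ A,
      F η' (F η q) = q := by
    intro η η' hη hη' q hq
    by_cases hs : q ∈ Φ.source
    · obtain ⟨h1, h2⟩ := hsrc η hη q hq hs
      have h3 : lam (F η q) = η (lam q) := by
        rw [hΦc] at h2
        exact congrArg Prod.snd h2
      have h4 : F η' (F η q) = Φ.symm (0, η' (lam (F η q))) := if_pos h1
      rw [h4, h3, hη', ← hΦq q hq hs, Φ.left_inv hs]
    · simp only [F, if_neg hs]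
  have hcont : ∀ η : ℝ ≃ₜ ℝ, (∀ t, ε < |t - c| → η t = t) → ContinuousOn (F η) A := by
    intro η hη q hq
    by_cases hs : q ∈ Φ.source
    · have h1 : F η =ᶠ[𝓝 q] fun q => Φ.symm (0, η (lam q)) := by
        filter_upwards [Φ.open_source.mem_nhds hs] with p hp using if_pos hp
      refine ContinuousAt.continuousWithinAt (ContinuousAt.congr ?_ h1.symm)
      refine ContinuousAt.comp (f := fun q => ((0 : ℝ), η (lam q)))
        (Φ.continuousAt_symm (hmem η hη q hq hs)) ?_
      fun_prop
    -- Every point of `A` that `F η` moves lies on the compact arc `K` inside the chart domain. A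
    -- point outside the domain has a neighbourhood that misses `K`, and there `F η` is the identity
    -- on `A`.
    · set K := (fun t : ℝ => Φ.symm (0, t)) '' Icc (c - ε) (c + ε) with hK
      have hIcc : ∀ t ∈ Icc (c - ε) (c + ε), |t - c| ≤ ε := fun t ht =>
        abs_le.2 ⟨by linarith [ht.1], by linarith [ht.2]⟩
      have hKc : IsCompact K := isCompact_Icc.image_of_continuousOn fun t ht =>
        ((Φ.continuousAt_symm (hεt' t (hIcc t ht))).comp (f := fun t : ℝ => ((0 : ℝ), t))
          (by fun_prop)).continuousWithinAt
      have hqK : q ∉ K := by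
        rintro ⟨t, ht, rfl⟩
        exact hs (Φ.map_target (hεt' t (hIcc t ht)))
      have h1 : F η =ᶠ[𝓝[A] q] id := by
        filter_upwards [self_mem_nhdsWithin,
          nhdsWithin_le_nhds (hKc.isClosed.isOpen_compl.mem_nhds hqK)] with p hpA hpK
        by_cases hps : p ∈ Φ.source
        · have h2 : Φ.symm (0, lam p) = p := by rw [← hΦq p hpA hps, Φ.left_inv hps]
          have h3 : ε < |lam p - c| := by
            by_contra hcon
            have := abs_le.1 (not_lt.1 hcon)
            exact hpK ⟨lam p, ⟨by linarith, by linarith⟩, h2⟩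
          simp only [F, if_pos hps, hη _ h3, h2, id]
        · simp only [F, if_neg hps, id]
      exact (continuousWithinAt_id.congr_of_eventuallyEq h1 (if_neg hs))
  obtain ⟨η, hη, hηs⟩ := exists_bump_homeomorph c hε
  have hηs' : ∀ t, ε < |t - c| → η.symm t = t := fun t ht => by
    rw [Homeomorph.symm_apply_eq, hηs t ht]
  refine ⟨⟨⟨fun q => ⟨F η q, hmaps η hηs q q.2⟩, fun q => ⟨F η.symm q, hmaps _ hηs' q q.2⟩,
    fun q => Subtype.ext (hinv η η.symm hηs (fun t => by simp) q q.2),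
    fun q => Subtype.ext (hinv η.symm η hηs' (fun t => by simp) q q.2)⟩, ?_, ?_⟩,
    fun q hq => Subtype.ext ?_, ⟨x, hx⟩, fun hcon => hη ?_⟩
  · exact (continuousOn_iff_continuous_domRestrict.1 (hcont η hηs)).subtype_mk _
  · exact (continuousOn_iff_continuous_domRestrict.1 (hcont _ hηs')).subtype_mk _
  · exact if_neg fun hs => hq (hΦV hs)
  · have h1 : F η x = x := congrArg Subtype.val hcon
    have h2 := (hsrc η hηs x hx hΦx).2
    rw [h1, hΦc] at h2
    exact (congrArg Prod.snd h2).symm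

/-- A trivialised block has no entry point all of whose neighbours in the entry set are
asymptotic. -/
theorem TrivialisedBlock.not_eventually_stays {v : ℝ × ℝ → ℝ × ℝ} (B : TrivialisedBlock v)
    (hv : Continuous v) {x : ℝ × ℝ} (hx : x ∈ B.nP)
    (hst : ∀ᶠ q in 𝓝 x, q ∈ B.nP → ∀ t, 0 ≤ t → B.Γ t q ∈ B.N) : False := by
  obtain ⟨g, hg, hgv⟩ := B.exists_inward x hx (hst.self_of_nhds hx)
  -- The push is supported where all entry points are asymptotic, so it fixes every leaving point
  -- and should be trivial by uniqueness.
  obtain ⟨φ, hφ, q, hq⟩ := exists_push hx (hg.1.of_le (by simp)) hg.2.2.1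
    (B.eventually_mem_entry hv hg hgv) hst
  refine hq (B.unique_entry φ (fun y hy => hφ y fun hyV => ?_) q)
  obtain ⟨t, ht, ht'⟩ := hy
  exact ht' (hyV y.2 t ht)

end PlanarReg

namespace PlanarReg

/-! ### Polar coordinates -/

/-- The point with polar coordinates `r`, `θ`. -/
noncomputable def pt (r θ : ℝ) : ℝ × ℝ := (r * Real.cos θ, r * Real.sin θ)

/-- The plane as the complex numbers. -/
noncomputable def toC : (ℝ × ℝ) ≃L[ℝ] ℂ := Complex.equivRealProdCLM.symm

/-- The Euclidean norm. -/
noncomputable def rad (z : ℝ × ℝ) : ℝ := ‖toC z‖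

/-- The angle with respect to the direction `m`, in `(-π, π]`. -/
noncomputable def ang (m : ℝ) (z : ℝ × ℝ) : ℝ := (toC z * Complex.exp (-(m * Complex.I))).arg

theorem toC_apply (z : ℝ × ℝ) : toC z = ⟨z.1, z.2⟩ := by
  apply Complex.ext <;> simp [toC]

theorem toC_pt (r θ : ℝ) : toC (pt r θ) = r * Complex.exp (θ * Complex.I) := by
  rw [Complex.exp_mul_I, toC_apply, pt]
  apply Complex.ext <;>
    simp [Complex.cos_ofReal_re, Complex.sin_ofReal_re, Complex.cos_ofReal_im,
      Complex.sin_ofReal_im]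

theorem rad_pt {r : ℝ} (hr : 0 ≤ r) (θ : ℝ) : rad (pt r θ) = r := by
  rw [rad, toC_pt, norm_mul, Complex.norm_exp_ofReal_mul_I, mul_one, Complex.norm_of_nonneg hr]

theorem rad_nonneg (z : ℝ × ℝ) : 0 ≤ rad z := norm_nonneg _

theorem rad_pos {z : ℝ × ℝ} : 0 < rad z ↔ z ≠ 0 := by
  rw [rad, norm_pos_iff, Ne, map_eq_zero_iff _ toC.injective]

@[fun_prop]
theorem continuous_rad : Continuous rad := toC.continuous.norm

theorem rad_zero : rad 0 = 0 := by simp [rad]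

theorem pt_zero (θ : ℝ) : pt 0 θ = 0 := by simp [pt]

theorem pt_ne_zero {r : ℝ} (hr : 0 < r) (θ : ℝ) : pt r θ ≠ 0 :=
  rad_pos.1 (by rwa [rad_pt hr.le])

@[fun_prop]
theorem continuous_pt : Continuous fun p : ℝ × ℝ => pt p.1 p.2 := by unfold pt; fun_prop

theorem toC_mul_exp (m : ℝ) (z : ℝ × ℝ) :
    toC z * Complex.exp (-(m * Complex.I)) = rad z * Complex.exp (ang m z * Complex.I) := by
  have := Complex.norm_mul_exp_arg_mul_I (toC z * Complex.exp (-(m * Complex.I)))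
  rw [norm_mul, ← neg_mul, ← Complex.ofReal_neg, Complex.norm_exp_ofReal_mul_I, mul_one] at this
  rw [← neg_mul, ← Complex.ofReal_neg, ← this, ang, rad, ← neg_mul, ← Complex.ofReal_neg]

theorem pt_rad_ang (m : ℝ) (z : ℝ × ℝ) : pt (rad z) (m + ang m z) = z := by
  apply toC.injective
  rw [toC_pt, Complex.ofReal_add, add_mul, Complex.exp_add, mul_left_comm, ← toC_mul_exp,
    mul_left_comm, ← Complex.exp_add, add_neg_cancel, Complex.exp_zero, mul_one]

theorem ang_pt {r : ℝ} (hr : 0 < r) {m a : ℝ} (ha : a ∈ Ioc (-Real.pi) Real.pi) :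
    ang m (pt r (m + a)) = a := by
  rw [ang, toC_pt, mul_assoc, ← Complex.exp_add]
  have : (((m + a : ℝ) : ℂ) * Complex.I + -(m * Complex.I)) = a * Complex.I := by
    push_cast
    ring
  rw [this, Complex.exp_mul_I, Complex.arg_mul_cos_add_sin_mul_I hr ha]

theorem ang_mem (m : ℝ) (z : ℝ × ℝ) : ang m z ∈ Ioc (-Real.pi) Real.pi := Complex.arg_mem_Ioc _

theorem pt_eq_pt_iff {r s : ℝ} (hr : 0 < r) (hs : 0 < s) {θ ψ : ℝ} :
    pt r θ = pt s ψ ↔ r = s ∧ ∃ n : ℤ, θ = ψ + n * (2 * Real.pi) := by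
  have key : ∀ n : ℤ, Complex.exp (((ψ + n * (2 * Real.pi) : ℝ) : ℂ) * Complex.I) =
      Complex.exp (ψ * Complex.I) := fun n => by
    rw [Complex.exp_eq_exp_iff_exists_int]
    exact ⟨n, by push_cast; ring⟩
  constructor
  · intro h
    have hrs : r = s := by rw [← rad_pt hr.le θ, h, rad_pt hs.le]
    refine ⟨hrs, ?_⟩
    have h1 := congrArg toC h
    rw [toC_pt, toC_pt, ← hrs] at h1
    have h2 := mul_left_cancel₀ (Complex.ofReal_ne_zero.2 hr.ne') h1
    obtain ⟨n, hn⟩ := Complex.exp_eq_exp_iff_exists_int.1 h2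
    refine ⟨n, ?_⟩
    have h3 := congrArg Complex.im hn
    simpa using h3
  · rintro ⟨rfl, n, rfl⟩
    apply toC.injective
    rw [toC_pt, toC_pt, key]

theorem pt_add_two_pi (r θ : ℝ) : pt r (θ + 2 * Real.pi) = pt r θ := by simp [pt]

theorem pt_add_pi (r θ : ℝ) : pt r (θ + Real.pi) = -pt r θ := by simp [pt]

theorem neg_pt (r θ : ℝ) : -pt r θ = pt (-r) θ := by simp [pt]

theorem continuousAt_ang {m : ℝ} {z : ℝ × ℝ} (hz : z ≠ 0) (ha : ang m z ≠ Real.pi) :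
    ContinuousAt (ang m) z := by
  refine ContinuousAt.comp (f := fun z => toC z * Complex.exp (-(m * Complex.I)))
    (Complex.continuousAt_arg (Complex.mem_slitPlane_iff_arg.2 ⟨ha, ?_⟩)) (by fun_prop)
  simpa using hz

theorem exists_closedBall_rad {N : Set (ℝ × ℝ)} (hN : N ∈ 𝓝 0) :
    ∃ δ > 0, ∀ z, rad z ≤ δ → z ∈ N := by
  have h : toC.symm ⁻¹' N ∈ 𝓝 (0 : ℂ) :=
    toC.symm.continuous.continuousAt.preimage_mem_nhds (by simpa using hN)
  obtain ⟨δ, hδ, hδ'⟩ := Metric.nhds_basis_closedBall.mem_iff.1 h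
  refine ⟨δ, hδ, fun z hz => ?_⟩
  have : toC z ∈ Metric.closedBall 0 δ := by simpa [rad] using hz
  simpa using hδ' this

/-- `v` is homogeneous of degree `k + 1`, with radial and angular components `R`, `Θ`. -/
structure IsPolarField (v : ℝ × ℝ → ℝ × ℝ) (k : ℕ) (R Θ : ℝ → ℝ) : Prop where
  contDiff : ContDiff ℝ 1 v
  contDiff_R : ContDiff ℝ 2 R
  contDiff_Θ : ContDiff ℝ 2 Θ
  apply_pt : ∀ r θ, v (pt r θ) = pt (r ^ (k + 1) * R θ) θ + pt (r ^ (k + 1) * Θ θ) (θ + Real.pi / 2)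

namespace IsPolarField

variable {v : ℝ × ℝ → ℝ × ℝ} {k : ℕ} {R Θ : ℝ → ℝ}

theorem neg (h : IsPolarField v k R Θ) : IsPolarField (-v) k (-R) (-Θ) where
  contDiff := h.contDiff.neg
  contDiff_R := h.contDiff_R.neg
  contDiff_Θ := h.contDiff_Θ.neg
  apply_pt r θ := by
    simp only [Pi.neg_apply, h.apply_pt, mul_neg, neg_add, neg_pt]

theorem apply_zero (h : IsPolarField v k R Θ) : v 0 = 0 := by
  have := h.apply_pt 0 0
  simpa [pt_zero] using this

theorem toC_apply (h : IsPolarField v k R Θ) (r θ : ℝ) :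
    toC (v (pt r θ)) = (r ^ k * (R θ + Θ θ * Complex.I) : ℂ) * toC (pt r θ) := by
  rw [h.apply_pt, map_add, toC_pt, toC_pt, toC_pt, Complex.ofReal_add, add_mul, Complex.exp_add]
  have : Complex.exp (((Real.pi / 2 : ℝ) : ℂ) * Complex.I) = Complex.I := by
    push_cast
    exact Complex.exp_pi_div_two_mul_I
  rw [this]
  push_cast
  ring

/-- The coordinates (-1, θ) and (1, θ + π) name the same point; comparing the two expressions of the
field there gives the sign. -/
theorem add_pi (h : IsPolarField v k R Θ) (θ : ℝ) :
    R (θ + Real.pi) = (-1) ^ k * R θ ∧ Θ (θ + Real.pi) = (-1) ^ k * Θ θ := by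
  have h1 := h.toC_apply (-1) θ
  have h2 := h.toC_apply 1 (θ + Real.pi)
  rw [pt_add_pi, neg_pt, h1] at h2
  have hne : toC (pt (-1) θ) ≠ 0 := by
    rw [← neg_pt]
    simpa using pt_ne_zero one_pos θ
  have h3 := mul_right_cancel₀ hne h2
  have h4 : (((-1 : ℝ) : ℂ)) ^ k = (((-1) ^ k : ℝ) : ℂ) := by push_cast; ring
  rw [h4, Complex.ofReal_one, one_pow, one_mul] at h3
  generalize (-1 : ℝ) ^ k = e at h3 ⊢
  constructor
  · simpa using (congrArg Complex.re h3).symm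
  · simpa using (congrArg Complex.im h3).symm

theorem add_two_pi (h : IsPolarField v k R Θ) (θ : ℝ) :
    R (θ + 2 * Real.pi) = R θ ∧ Θ (θ + 2 * Real.pi) = Θ θ := by
  have h1 := h.add_pi θ
  have h2 := h.add_pi (θ + Real.pi)
  have h3 : θ + 2 * Real.pi = θ + Real.pi + Real.pi := by ring
  have h4 : ((-1 : ℝ) ^ k) * (-1) ^ k = 1 := by rw [← mul_pow]; simp
  rw [h3, h2.1, h2.2, h1.1, h1.2, ← mul_assoc, ← mul_assoc, h4]
  simp

variable {γ : ℝ → ℝ × ℝ} {c t r θ : ℝ}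

/-- In complex notation v(z) = r^k (R + iΘ) z, so an orbit has logarithmic derivative r^k (R + iΘ)
up to the cut-off factor `c`. Real and imaginary parts are the equations for log r and for the
angle. The rotation by `-m` moves the branch cut away from the point. -/
theorem hasDerivAt_log (h : IsPolarField v k R Θ) (hγ : HasDerivAt γ (c • v (γ t)) t)
    (hr : 0 < r) (hp : γ t = pt r θ) {m : ℝ} (hm : ang m (γ t) ≠ Real.pi) :
    HasDerivAt (fun s => Complex.log (toC (γ s) * Complex.exp (-(m * Complex.I))))
      (c * (r ^ k * (R θ + Θ θ * Complex.I))) t := by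
  have hne : toC (γ t) ≠ 0 := by
    rw [hp]
    simpa using pt_ne_zero hr θ
  have h1 : HasDerivAt (fun s => toC (γ s)) (toC (c • v (γ t))) t :=
    toC.hasFDerivAt.comp_hasDerivAt t hγ
  have h2 := (h1.mul_const (Complex.exp (-(m * Complex.I)))).clog_real
    (Complex.mem_slitPlane_iff_arg.2 ⟨hm, mul_ne_zero hne (Complex.exp_ne_zero _)⟩)
  convert h2 using 1
  rw [mul_div_mul_right _ _ (Complex.exp_ne_zero _), map_smul, Complex.real_smul, hp, h.toC_apply,
    ← hp, mul_div_assoc, mul_div_assoc, div_self hne, mul_one]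

theorem hasDerivAt_ang (h : IsPolarField v k R Θ) (hγ : HasDerivAt γ (c • v (γ t)) t)
    (hr : 0 < r) (hp : γ t = pt r θ) {m : ℝ} (hm : ang m (γ t) ≠ Real.pi) :
    HasDerivAt (fun s => ang m (γ s)) (c * (r ^ k * Θ θ)) t := by
  have h1 := Complex.imCLM.hasFDerivAt.comp_hasDerivAt t (h.hasDerivAt_log hγ hr hp hm)
  have h2 : Complex.imCLM (c * (r ^ k * (R θ + Θ θ * Complex.I))) = c * (r ^ k * Θ θ) := by
    rw [← Complex.ofReal_pow]
    generalize r ^ k = e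
    simp
  rw [h2] at h1
  refine h1.congr_of_eventuallyEq (Eventually.of_forall fun s => ?_)
  simp [ang, Complex.log_im]

theorem hasDerivAt_log_rad (h : IsPolarField v k R Θ) (hγ : HasDerivAt γ (c • v (γ t)) t)
    (hr : 0 < r) (hp : γ t = pt r θ) :
    HasDerivAt (fun s => Real.log (rad (γ s))) (c * (r ^ k * R θ)) t := by
  have hm : ang θ (γ t) ≠ Real.pi := by
    have := ang_pt hr (m := θ) (a := 0) ⟨by linarith [Real.pi_pos], Real.pi_pos.le⟩
    rw [add_zero, ← hp] at this
    rw [this]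
    exact Real.pi_pos.ne
  have h1 := Complex.reCLM.hasFDerivAt.comp_hasDerivAt t (h.hasDerivAt_log hγ hr hp hm)
  have h2 : Complex.reCLM (c * (r ^ k * (R θ + Θ θ * Complex.I))) = c * (r ^ k * R θ) := by
    rw [← Complex.ofReal_pow]
    generalize r ^ k = e
    simp
  rw [h2] at h1
  refine h1.congr_of_eventuallyEq (Eventually.of_forall fun s => ?_)
  simp only [Function.comp_apply, Complex.reCLM_apply, Complex.log_re, norm_mul, rad]
  rw [← neg_mul, ← Complex.ofReal_neg, Complex.norm_exp_ofReal_mul_I, mul_one]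

end IsPolarField

/-- A function with derivative bounded below by a positive constant is unbounded above. -/
theorem false_of_deriv_ge {f f' : ℝ → ℝ} {c C : ℝ} (hc : 0 < c)
    (hf : ∀ t, 0 ≤ t → HasDerivAt f (f' t) t) (hf' : ∀ t, 0 ≤ t → c ≤ f' t)
    (hC : ∀ t, 0 ≤ t → f t ≤ C) : False := by
  have hmono : MonotoneOn (fun t => f t - c * t) (Ici 0) := by
    refine monotoneOn_of_hasDerivWithinAt_nonneg (f' := fun t => f' t - c) (convex_Ici 0)
      (fun t ht => ?_) (fun t ht => ?_) (fun t ht => ?_)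
    · exact ((hf t ht).sub ((hasDerivAt_id t).const_mul c)).continuousAt.continuousWithinAt
    · rw [interior_Ici] at ht ⊢
      have := (hf t (le_of_lt ht)).sub ((hasDerivAt_id t).const_mul c)
      rw [mul_one] at this
      exact this.hasDerivWithinAt
    · rw [interior_Ici] at ht
      exact sub_nonneg.2 (hf' t (le_of_lt ht))
  set T := (|C - f 0| + 1) / c with hT
  have hT0 : 0 ≤ T := by positivity
  have h1 := hmono (mem_Ici.2 le_rfl) (mem_Ici.2 hT0) hT0
  have h2 : c * T = |C - f 0| + 1 := by rw [hT]; field_simp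
  have h3 := hC T hT0
  simp only [mul_zero, sub_zero] at h1
  linarith [le_abs_self (C - f 0)]

end PlanarReg

/-! ### Sectors between invariant rays and their first integral -/

namespace PlanarReg

/-- If `W' = ρ / T` to the left of `l`, where `T > 0` vanishes at `l` and `ρ l > 0`, then `W → ∞`. -/
theorem tendsto_atTop_of_hasDerivAt_div {W ρ T : ℝ → ℝ} {a l T' : ℝ} (hal : a < l)
    (hW : ∀ x ∈ Ioo a l, HasDerivAt W (ρ x / T x) x) (hρ : ContinuousAt ρ l) (hρl : 0 < ρ l)
    (hT : ∀ x ∈ Ioo a l, 0 < T x) (hTl : T l = 0) (hT' : HasDerivAt T T' l) :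
    Tendsto W (𝓝[<] l) atTop := by
  obtain ⟨C, hC, hbig⟩ := hT'.isBigO_sub.exists_pos
  have h1 : ∀ᶠ x in 𝓝[<] l, |T x| ≤ C * |x - l| := by
    filter_upwards [hbig.bound.filter_mono nhdsWithin_le_nhds] with x hx
    simpa [hTl] using hx
  have h2 : ∀ᶠ x in 𝓝[<] l, ρ l / 2 < ρ x :=
    (hρ.eventually_const_lt (by linarith)).filter_mono nhdsWithin_le_nhds
  obtain ⟨b, hb, hb'⟩ := mem_nhdsLT_iff_exists_Ioo_subset.1
    ((h1.and h2).and (Ioo_mem_nhdsLT hal))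
  have hbl : b < l := hb
  set b' := (b + l) / 2 with hbdef
  -- Near `l` one has ρ ≥ ρ(l)/2 and 0 < T ≤ C (l - x), so W' ≥ D / (l - x), and W grows at least
  -- like -D log (l - x).
  set D := ρ l / 2 / C with hD
  have hD0 : 0 < D := by positivity
  have hsub : ∀ x ∈ Ico b' l, x ∈ Ioo b l := fun x hx => ⟨by linarith [hx.1], hx.2⟩
  have hderiv : ∀ x ∈ Ico b' l,
      HasDerivAt (fun x => W x + D * Real.log (l - x)) (ρ x / T x - D / (l - x)) x := by
    intro x hx
    have hx' := (hb' (hsub x hx)).2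
    have hlx : l - x ≠ 0 := by linarith [hx.2]
    have h3 := (((hasDerivAt_id x).const_sub l).log hlx).const_mul D
    convert! (hW x hx').add h3 using 1
    simp only [id]
    ring
  have hmono : MonotoneOn (fun x => W x + D * Real.log (l - x)) (Ico b' l) := by
    refine monotoneOn_of_hasDerivWithinAt_nonneg (convex_Ico b' l)
      (fun x hx => (hderiv x hx).continuousAt.continuousWithinAt)
      (fun x hx => (hderiv x (interior_subset hx)).hasDerivWithinAt) fun x hx => ?_
    have hx := interior_subset hx
    obtain ⟨⟨h3, h4⟩, h5⟩ := hb' (hsub x hx)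
    have hlx : 0 < l - x := by linarith [hx.2]
    have hTx := hT x h5
    rw [abs_of_pos hTx, abs_of_neg (by linarith), neg_sub] at h3
    have h6 : D / (l - x) = ρ l / 2 / (C * (l - x)) := by rw [hD]; field_simp
    have h7 : 0 ≤ ρ x := by linarith
    rw [sub_nonneg, h6]
    gcongr
  have hb'l : b' < l := by linarith
  have hlim : Tendsto (fun x => W b' + D * Real.log (l - b') - D * Real.log (l - x)) (𝓝[<] l)
      atTop := by
    have h3 : Tendsto (fun x => l - x) (𝓝[<] l) (𝓝[>] 0) := by
      refine tendsto_nhdsWithin_iff.2 ⟨?_, ?_⟩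
      · have : Tendsto (fun x => l - x) (𝓝 l) (𝓝 (l - l)) := by
          exact (continuous_const.sub continuous_id).tendsto l
        rw [sub_self] at this
        exact this.mono_left nhdsWithin_le_nhds
      · filter_upwards [self_mem_nhdsWithin] with x hx using sub_pos.2 (mem_Iio.1 hx)
    have h4 := (Real.tendsto_log_nhdsGT_zero.comp h3).const_mul_atBot hD0
    simp only [sub_eq_add_neg]
    exact tendsto_atTop_add_const_left _ _ (tendsto_neg_atBot_atTop.comp h4)
  refine tendsto_atTop_mono' _ ?_ hlim
  filter_upwards [Ico_mem_nhdsLT hb'l] with x hx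
  have := hmono ⟨le_rfl, hb'l⟩ hx hx.1
  simp only at this
  linarith

/-- A sector between two neighbouring invariant rays, with an angular coordinate `a ∈ (-l, l)` that
increases along the orbits; the angle is `m + τ a`. -/
structure FlowSector (R Θ : ℝ → ℝ) where
  m : ℝ
  τ : ℝ
  l : ℝ
  τ_eq : τ = 1 ∨ τ = -1
  l_pos : 0 < l
  l_le : l ≤ Real.pi / 2
  pos : ∀ a ∈ Ioo (-l) l, 0 < τ * Θ (m + τ * a)
  zero_right : Θ (m + τ * l) = 0
  zero_left : Θ (m + τ * -l) = 0
  ne_right : R (m + τ * l) ≠ 0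
  ne_left : R (m + τ * -l) ≠ 0

namespace FlowSector

variable {v : ℝ × ℝ → ℝ × ℝ} {k : ℕ} {R Θ : ℝ → ℝ} (S : FlowSector R Θ)

/-- The radial component in the angular coordinate. -/
def radial (a : ℝ) : ℝ := R (S.m + S.τ * a)

/-- The angular speed in the angular coordinate. -/
def speed (a : ℝ) : ℝ := S.τ * Θ (S.m + S.τ * a)

/-- The angular coordinate. -/
noncomputable def coord (z : ℝ × ℝ) : ℝ := S.τ * ang S.m z

/-- The open sector. -/
def region : Set (ℝ × ℝ) := {z | z ≠ 0 ∧ |ang S.m z| < S.l}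

/-- A primitive of `radial / speed`. -/
noncomputable def W (a : ℝ) : ℝ := ∫ x in (0 : ℝ)..a, S.radial x / S.speed x

/-- The logarithm of the homogeneous first integral of degree one. -/
noncomputable def L (z : ℝ × ℝ) : ℝ := Real.log (rad z) - S.W (S.coord z)

/-- The same sector for the time-reversed field. -/
def reverse : FlowSector (-R) (-Θ) where
  m := S.m
  τ := -S.τ
  l := S.l
  τ_eq := by rcases S.τ_eq with h | h <;> simp [h]
  l_pos := S.l_pos
  l_le := S.l_le
  pos a ha := by
    have := S.pos (-a) ⟨by linarith [ha.2], by linarith [ha.1]⟩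
    simpa using this
  zero_right := by simpa using S.zero_left
  zero_left := by simpa using S.zero_right
  ne_right := by simpa using S.ne_left
  ne_left := by simpa using S.ne_right

theorem τ_mul_self : S.τ * S.τ = 1 := by rcases S.τ_eq with h | h <;> simp [h]

theorem abs_τ : |S.τ| = 1 := by rcases S.τ_eq with h | h <;> simp [h]

theorem abs_coord (z : ℝ × ℝ) : |S.coord z| = |ang S.m z| := by
  rw [coord, abs_mul, S.abs_τ, one_mul]

theorem l_lt_pi : S.l < Real.pi := by linarith [S.l_le, Real.pi_pos]

theorem τ_mul_coord (z : ℝ × ℝ) : S.τ * S.coord z = ang S.m z := by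
  rw [coord, ← mul_assoc, S.τ_mul_self, one_mul]

theorem coord_mem {z : ℝ × ℝ} (hz : z ∈ S.region) : S.coord z ∈ Ioo (-S.l) S.l :=
  abs_lt.1 (by rw [S.abs_coord]; exact hz.2)

theorem pt_coord (z : ℝ × ℝ) : pt (rad z) (S.m + S.τ * S.coord z) = z := by
  rw [S.τ_mul_coord, pt_rad_ang]

theorem coord_pt {r : ℝ} (hr : 0 < r) {a : ℝ} (ha : |a| ≤ S.l) :
    S.coord (pt r (S.m + S.τ * a)) = a := by
  have h1 : |S.τ * a| < Real.pi := by
    rw [abs_mul, S.abs_τ, one_mul]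
    exact ha.trans_lt S.l_lt_pi
  have h2 := abs_lt.1 h1
  rw [coord, ang_pt hr ⟨h2.1, h2.2.le⟩, ← mul_assoc, S.τ_mul_self, one_mul]

theorem pt_mem_region {r : ℝ} (hr : 0 < r) {a : ℝ} (ha : |a| < S.l) :
    pt r (S.m + S.τ * a) ∈ S.region :=
  ⟨pt_ne_zero hr _, by rw [← S.abs_coord, S.coord_pt hr ha.le]; exact ha⟩

theorem reverse_coord (z : ℝ × ℝ) : S.reverse.coord z = -S.coord z := by
  simp [coord, reverse]

theorem reverse_W (a : ℝ) : S.reverse.W a = S.W (-a) := by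
  have : ∀ x, S.reverse.radial x / S.reverse.speed x = -(S.radial (-x) / S.speed (-x)) := fun x => by
    simp [radial, speed, reverse, neg_div]
  simp only [W, this]
  rw [intervalIntegral.integral_neg,
    intervalIntegral.integral_comp_neg (fun x => S.radial x / S.speed x), neg_zero,
    ← intervalIntegral.integral_symm]

theorem reverse_L (z : ℝ × ℝ) : S.reverse.L z = S.L z := by
  rw [L, L, reverse_W, reverse_coord, neg_neg]

theorem reverse_region : S.reverse.region = S.region := rfl

variable {S}

theorem region_open : IsOpen S.region := by
  rw [isOpen_iff_mem_nhds]
  intro z hz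
  have hc : ContinuousAt (ang S.m) z := continuousAt_ang hz.1 fun h => by
    have := hz.2
    rw [h, abs_of_pos Real.pi_pos] at this
    linarith [S.l_lt_pi]
  filter_upwards [isOpen_ne.mem_nhds hz.1, hc.abs.eventually_lt_const hz.2] with y h1 h2
  exact ⟨h1, h2⟩

section

variable (hv : IsPolarField v k R Θ)
include hv

theorem contDiff_radial : ContDiff ℝ 1 S.radial :=
  (hv.contDiff_R.of_le one_le_two).comp (by fun_prop : ContDiff ℝ 1 fun a => S.m + S.τ * a)

theorem contDiff_speed : ContDiff ℝ 1 S.speed :=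
  contDiff_const.mul
    ((hv.contDiff_Θ.of_le one_le_two).comp (by fun_prop : ContDiff ℝ 1 fun a => S.m + S.τ * a))

theorem hasDerivAt_W {a : ℝ} (ha : a ∈ Ioo (-S.l) S.l) :
    HasDerivAt S.W (S.radial a / S.speed a) a := by
  have hc : ContinuousOn (fun x => S.radial x / S.speed x) (Ioo (-S.l) S.l) :=
    (contDiff_radial hv).continuous.continuousOn.div (contDiff_speed hv).continuous.continuousOn
      fun x hx => (S.pos x hx).ne'
  have h0 : (0 : ℝ) ∈ Ioo (-S.l) S.l := ⟨by linarith [S.l_pos], S.l_pos⟩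
  refine intervalIntegral.integral_hasDerivAt_right
    (hc.mono (ordConnected_Ioo.uIcc_subset h0 ha)).intervalIntegrable ?_
    (hc.continuousAt (Ioo_mem_nhds ha.1 ha.2))
  exact hc.stronglyMeasurableAtFilter isOpen_Ioo a ha

/-- On a level of `L` the radius is exp(L + W(a)). It therefore blows up towards an outgoing end
ray, and by `W_right_neg` it tends to 0 towards an incoming one. -/
theorem W_right_pos (hR : 0 < R (S.m + S.τ * S.l)) : Tendsto S.W (𝓝[<] S.l) atTop := by
  refine tendsto_atTop_of_hasDerivAt_div (ρ := S.radial) (T := S.speed) (a := -S.l)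
    (by linarith [S.l_pos]) (fun x hx => hasDerivAt_W hv hx)
    (contDiff_radial hv).continuous.continuousAt hR S.pos ?_
    (((contDiff_speed hv).differentiable one_ne_zero).differentiableAt.hasDerivAt)
  simp [speed, S.zero_right]

theorem W_right_neg (hR : R (S.m + S.τ * S.l) < 0) : Tendsto S.W (𝓝[<] S.l) atBot := by
  rw [← tendsto_neg_atTop_iff]
  refine tendsto_atTop_of_hasDerivAt_div (ρ := -S.radial) (T := S.speed) (a := -S.l)
    (by linarith [S.l_pos]) (fun x hx => ?_)
    (contDiff_radial hv).continuous.neg.continuousAt (by simpa [radial] using hR) S.pos ?_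
    (((contDiff_speed hv).differentiable one_ne_zero).differentiableAt.hasDerivAt)
  · have := (hasDerivAt_W hv hx).neg
    rwa [Pi.neg_apply, neg_div]
  · simp [speed, S.zero_right]

theorem hasDerivAt_coord {γ : ℝ → ℝ × ℝ} {c t : ℝ} (hγ : HasDerivAt γ (c • v (γ t)) t)
    (ht : γ t ∈ S.region) :
    HasDerivAt (fun s => S.coord (γ s)) (c * (rad (γ t) ^ k * S.speed (S.coord (γ t)))) t := by
  have h1 := hv.hasDerivAt_ang hγ (rad_pos.2 ht.1) (S.pt_coord (γ t)).symm (m := S.m) fun h => by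
    have := ht.2
    rw [h, abs_of_pos Real.pi_pos] at this
    linarith [S.l_lt_pi]
  convert! h1.const_mul S.τ using 1
  rw [speed]
  ring

theorem hasDerivAt_L {γ : ℝ → ℝ × ℝ} {c t : ℝ} (hγ : HasDerivAt γ (c • v (γ t)) t)
    (ht : γ t ∈ S.region) : HasDerivAt (fun s => S.L (γ s)) 0 t := by
  have h1 := hv.hasDerivAt_log_rad hγ (rad_pos.2 ht.1) (S.pt_coord (γ t)).symm
  have h2 := (hasDerivAt_W hv (S.coord_mem ht)).comp t (hasDerivAt_coord hv hγ ht)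
  convert! h1.sub h2 using 1
  have h3 := (S.pos _ (S.coord_mem ht)).ne'
  change S.speed _ ≠ 0 at h3
  rw [radial]
  field_simp
  ring

end

/-- Since `l ≤ π/2`, points of the sector satisfy rad * cos(ang) ≥ 0. This is a closed condition, so
a nonzero limit point avoids the branch cut of the angle. -/
theorem continuousAt_coord_of_tendsto {ι : Type*} {F : Filter ι} [F.NeBot] {u : ι → ℝ × ℝ}
    {y : ℝ × ℝ} (hy : y ≠ 0) (hu : Tendsto u F (𝓝 y)) (hS : ∀ᶠ i in F, u i ∈ S.region) :
    ContinuousAt (ang S.m) y ∧ |ang S.m y| ≤ S.l := by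
  have hre : ∀ z, (toC z * Complex.exp (-(S.m * Complex.I))).re = rad z * Real.cos (ang S.m z) := by
    intro z
    rw [toC_mul_exp, Complex.exp_mul_I, Complex.re_ofReal_mul, Complex.add_re,
      Complex.cos_ofReal_re, Complex.mul_I_re, Complex.sin_ofReal_im, neg_zero, add_zero]
  have hc : Continuous fun z => rad z * Real.cos (ang S.m z) := by
    simp only [← hre]
    fun_prop
  have h1 : 0 ≤ rad y * Real.cos (ang S.m y) := by
    refine ge_of_tendsto ((hc.tendsto y).comp hu) (hS.mono fun i hi => ?_)
    have := abs_lt.1 hi.2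
    exact mul_nonneg (rad_nonneg _) (Real.cos_nonneg_of_mem_Icc
      ⟨by linarith [S.l_le], by linarith [S.l_le]⟩)
  have h2 : ang S.m y ≠ Real.pi := fun h => by
    rw [h, Real.cos_pi] at h1
    linarith [rad_pos.2 hy]
  have h3 := continuousAt_ang hy h2
  exact ⟨h3, le_of_tendsto (h3.abs.tendsto.comp hu) (hS.mono fun i hi => hi.2.le)⟩

/-- The value of `W` at the coordinate tends to infinity at the right end of the sector. -/
theorem tendsto_nhdsLT {ι : Type*} {F : Filter ι} [F.NeBot] {u : ι → ℝ × ℝ}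
    {y : ℝ × ℝ} (hy : y ≠ 0) (hu : Tendsto u F (𝓝 y)) (hS : ∀ᶠ i in F, u i ∈ S.region)
    (hl : S.coord y = S.l) : Tendsto (fun i => S.coord (u i)) F (𝓝[<] S.l) := by
  refine tendsto_nhdsWithin_iff.2 ⟨?_, hS.mono fun i hi => (S.coord_mem hi).2⟩
  rw [← hl]
  exact (((continuousAt_coord_of_tendsto hy hu hS).1.const_mul S.τ).tendsto.comp hu :)

section

variable (hv : IsPolarField v k R Θ)
include hv

/-- Towards the end ray W tends to +∞ or -∞ while log rad stays bounded, so `L` could not converge.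
-/
theorem coord_ne_l {ι : Type*} {F : Filter ι} [F.NeBot] {u : ι → ℝ × ℝ}
    {y : ℝ × ℝ} (hy : y ≠ 0) (hu : Tendsto u F (𝓝 y)) (hS : ∀ᶠ i in F, u i ∈ S.region) {κ : ℝ}
    (hL : Tendsto (fun i => S.L (u i)) F (𝓝 κ)) : S.coord y ≠ S.l := by
  intro hl
  have h1 := tendsto_nhdsLT hy hu hS hl
  have h2 : Tendsto (fun i => S.W (S.coord (u i))) F (𝓝 (Real.log (rad y) - κ)) := by
    have h3 : Tendsto (fun i => Real.log (rad (u i))) F (𝓝 (Real.log (rad y))) :=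
      ((continuous_rad.tendsto y).comp hu).log (rad_pos.2 hy).ne'
    refine (h3.sub hL).congr fun i => ?_
    simp [L]
  rcases lt_or_gt_of_ne S.ne_right with h | h
  · exact not_tendsto_nhds_of_tendsto_atBot ((W_right_neg hv h).comp h1) _ h2
  · exact not_tendsto_nhds_of_tendsto_atTop ((W_right_pos hv h).comp h1) _ h2

/-- A nonzero limit of points of the sector along which `L` converges lies in the sector. -/
theorem mem_region_of_tendsto {ι : Type*} {F : Filter ι} [F.NeBot] {u : ι → ℝ × ℝ}
    {y : ℝ × ℝ} (hy : y ≠ 0) (hu : Tendsto u F (𝓝 y)) (hS : ∀ᶠ i in F, u i ∈ S.region) {κ : ℝ}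
    (hL : Tendsto (fun i => S.L (u i)) F (𝓝 κ)) : y ∈ S.region := by
  have h1 := coord_ne_l hv hy hu hS hL
  have h2 := coord_ne_l (S := S.reverse) hv.neg hy hu hS (κ := κ) (by simpa [reverse_L] using hL)
  rw [reverse_coord] at h2
  refine ⟨hy, lt_of_le_of_ne (continuousAt_coord_of_tendsto hy hu hS).2 fun h3 => ?_⟩
  rw [← S.abs_coord] at h3
  rcases eq_or_eq_neg_of_abs_eq h3 with h4 | h4
  · exact h1 h4
  · exact h2 (by rw [h4, neg_neg]; rfl)

variable {χ : ℝ × ℝ → ℝ} {Γ : ℝ → ℝ × ℝ → ℝ × ℝ} (hΓ : IsCutoffFlow v χ Γ)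
include hΓ

/-- The times at which the orbit is in the sector on its initial level form a clopen set: open
because `L` has derivative zero along orbits, closed because orbits avoid 0 and
`mem_region_of_tendsto` keeps limits inside. -/
theorem flow_invariant {x : ℝ × ℝ} (hx : x ∈ S.region) (t : ℝ) :
    Γ t x ∈ S.region ∧ S.L (Γ t x) = S.L x := by
  set A := {t : ℝ | Γ t x ∈ S.region ∧ S.L (Γ t x) = S.L x} with hA
  have hne : ∀ t, Γ t x ≠ 0 := hΓ.ne_of_zero hv.apply_zero hx.1
  have hclosed : IsClosed A := by
    refine isClosed_iff_clusterPt.2 fun s hs => ?_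
    have hs' : (𝓝[A] s).NeBot := hs
    have hlim : Tendsto (fun t => Γ t x) (𝓝[A] s) (𝓝 (Γ s x)) :=
      (hΓ.continuous x).continuousAt.tendsto.mono_left nhdsWithin_le_nhds
    have hmem : ∀ᶠ t in 𝓝[A] s, t ∈ A := self_mem_nhdsWithin
    have hLlim : Tendsto (fun t => S.L (Γ t x)) (𝓝[A] s) (𝓝 (S.L x)) :=
      tendsto_const_nhds.congr' (hmem.mono fun t ht => ht.2.symm)
    have h1 := mem_region_of_tendsto hv (hne s) hlim (hmem.mono fun t ht => ht.1) hLlim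
    refine ⟨h1, tendsto_nhds_unique ?_ hLlim⟩
    exact (hasDerivAt_L hv (hΓ.hasDerivAt x s) h1).continuousAt.tendsto.mono_left
      nhdsWithin_le_nhds
  have hopen : IsOpen A := by
    refine isOpen_iff_mem_nhds.2 fun s hs => ?_
    have h1 : ∀ᶠ t in 𝓝 s, Γ t x ∈ S.region :=
      (hΓ.continuous x).continuousAt.eventually_mem (region_open.mem_nhds hs.1)
    obtain ⟨ε, hε, h2⟩ := Metric.eventually_nhds_iff_ball.1 h1
    filter_upwards [Metric.ball_mem_nhds s hε] with t ht
    refine ⟨h2 t ht, ?_⟩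
    have h3 : ∀ t ∈ Metric.ball s ε, HasDerivAt (fun t => S.L (Γ t x)) 0 t := fun t ht =>
      hasDerivAt_L hv (hΓ.hasDerivAt x t) (h2 t ht)
    rw [← hs.2]
    refine Metric.isOpen_ball.is_const_of_deriv_eq_zero (convex_ball s ε).isPreconnected
      (fun t ht => (h3 t ht).differentiableAt.differentiableWithinAt)
      (fun t ht => (h3 t ht).deriv) ht (Metric.mem_ball_self hε)
  have huniv : A = univ := IsClopen.eq_univ ⟨hclosed, hopen⟩ ⟨0, by simp [hA, hΓ.zero, hx]⟩
  exact (huniv ▸ mem_univ t : t ∈ A)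

theorem monotone_coord {x : ℝ × ℝ} (hx : x ∈ S.region) : Monotone fun t => S.coord (Γ t x) := by
  refine monotone_of_hasDerivAt_nonneg (fun t => hasDerivAt_coord hv (hΓ.hasDerivAt x t)
    (flow_invariant hv hΓ hx t).1) fun t => ?_
  exact mul_nonneg (hΓ.nonneg _) (mul_nonneg (pow_nonneg (rad_nonneg _) _)
    (S.pos _ (S.coord_mem (flow_invariant hv hΓ hx t).1)).le)

theorem log_rad_eq {x : ℝ × ℝ} (hx : x ∈ S.region) (t : ℝ) :
    Real.log (rad (Γ t x)) = S.L x + S.W (S.coord (Γ t x)) := by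
  rw [← (flow_invariant hv hΓ hx t).2, L]
  ring

/-- If the forward end of the sector is a saddle direction, then no orbit in the sector stays in a
bounded region forwards. -/
theorem not_forward_bounded (hR : 0 < R (S.m + S.τ * S.l)) {x : ℝ × ℝ} (hx : x ∈ S.region) {ρ : ℝ}
    (hχ : ∀ t, 0 ≤ t → χ (Γ t x) = 1) (hρ : ∀ t, 0 ≤ t → rad (Γ t x) ≤ ρ) : False := by
  have hinv := flow_invariant hv hΓ hx
  have hx0 := S.coord_mem hx
  have hpos : ∀ t, 0 < rad (Γ t x) := fun t => rad_pos.2 (hinv t).1.1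
  -- As log r = L + W(a) on the orbit, a bound on the radius keeps the angular coordinate below some
  -- `b' < l`.
  have h1 : ∀ᶠ a in 𝓝[<] S.l, Real.log ρ - S.L x < S.W a :=
    (W_right_pos hv hR).eventually_gt_atTop _
  obtain ⟨b, hb, hb'⟩ := mem_nhdsLT_iff_exists_Ioo_subset.1 h1
  set b' := max b (S.coord x) with hbdef
  have hb'l : b' < S.l := max_lt hb hx0.2
  have hmem : ∀ t, 0 ≤ t → S.coord (Γ t x) ∈ Icc (S.coord x) b' := by
    intro t ht
    have h2 := monotone_coord hv hΓ hx ht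
    simp only [hΓ.zero] at h2
    refine ⟨h2, ?_⟩
    by_contra hcon
    have h3 : S.coord (Γ t x) ∈ Ioo b S.l :=
      ⟨(le_max_left _ _).trans_lt (not_le.1 hcon), (S.coord_mem (hinv t).1).2⟩
    have h4 := hb' h3
    have h5 := Real.log_le_log (hpos t) (hρ t ht)
    rw [log_rad_eq hv hΓ hx] at h5
    change Real.log ρ - S.L x < S.W _ at h4
    linarith
  have hsub : Icc (S.coord x) b' ⊆ Ioo (-S.l) S.l := fun a ha =>
    ⟨hx0.1.trans_le ha.1, ha.2.trans_lt hb'l⟩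
  have hneI : (Icc (S.coord x) b').Nonempty := ⟨S.coord x, le_rfl, le_max_right _ _⟩
  obtain ⟨a₁, ha₁, hW⟩ := isCompact_Icc.exists_isMinOn hneI
    (fun a ha => (hasDerivAt_W hv (hsub ha)).continuousAt.continuousWithinAt :
      ContinuousOn S.W (Icc (S.coord x) b'))
  obtain ⟨a₂, ha₂, hs⟩ := isCompact_Icc.exists_isMinOn hneI
    (contDiff_speed (S := S) hv).continuous.continuousOn
  have hs0 : 0 < S.speed a₂ := S.pos a₂ (hsub ha₂)
  -- On the compact angular range W has a minimum, so the radius stays above `ρ₀`, and the speed has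
  -- a positive minimum. The angle then grows at a fixed rate, yet it is bounded by `b'`.
  set ρ₀ := Real.exp (S.L x + S.W a₁) with hρ₀
  have hρ₀t : ∀ t, 0 ≤ t → ρ₀ ≤ rad (Γ t x) := fun t ht => by
    rw [← Real.le_log_iff_exp_le (hpos t), log_rad_eq hv hΓ hx]
    have h6 : S.W a₁ ≤ S.W (S.coord (Γ t x)) := hW (hmem t ht)
    linarith
  refine false_of_deriv_ge (f := fun t => S.coord (Γ t x)) (c := ρ₀ ^ k * S.speed a₂) (C := b')
    (by positivity) (fun t _ => hasDerivAt_coord hv (hΓ.hasDerivAt x t) (hinv t).1)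
    (fun t ht => ?_) fun t ht => (hmem t ht).2
  rw [hχ t ht, one_mul]
  exact mul_le_mul (pow_le_pow_left₀ (Real.exp_pos _).le (hρ₀t t ht) k) (hs (hmem t ht)) hs0.le
    (pow_nonneg (rad_nonneg _) _)

omit hΓ in
theorem W_bddAbove (hR : R (S.m + S.τ * S.l) < 0) : ∃ B, ∀ a ∈ Ico 0 S.l, S.W a ≤ B := by
  have h1 : ∀ᶠ a in 𝓝[<] S.l, S.W a < 0 := (W_right_neg hv hR).eventually_lt_atBot 0
  obtain ⟨b, hb, hb'⟩ := mem_nhdsLT_iff_exists_Ioo_subset.1 h1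
  have hsub : Icc 0 b ⊆ Ioo (-S.l) S.l := fun a ha =>
    ⟨by linarith [ha.1, S.l_pos], ha.2.trans_lt hb⟩
  obtain ⟨B, hB⟩ := isCompact_Icc.bddAbove_image
    (fun a ha => (hasDerivAt_W hv (hsub ha)).continuousAt.continuousWithinAt :
      ContinuousOn S.W (Icc 0 b))
  refine ⟨max B 0, fun a ha => ?_⟩
  rcases le_or_gt a b with h | h
  · exact (hB (mem_image_of_mem _ ⟨ha.1, h⟩)).trans (le_max_left _ _)
  · exact (le_of_lt (hb' ⟨h, ha.2⟩)).trans (le_max_right _ _)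

omit hΓ in
/-- If the forward end of the sector is a node direction, then orbits that start close to the origin
on the middle ray stay close to the origin forwards. -/
theorem exists_forward_bounded (hR : R (S.m + S.τ * S.l) < 0) {δ : ℝ} (hδ : 0 < δ) :
    ∃ r₀ > 0, ∀ r, 0 < r → r ≤ r₀ → ∀ (χ : ℝ × ℝ → ℝ) (Γ : ℝ → ℝ × ℝ → ℝ × ℝ),
      IsCutoffFlow v χ Γ → ∀ t, 0 ≤ t → rad (Γ t (pt r S.m)) ≤ δ := by
  obtain ⟨B, hB⟩ := W_bddAbove hv hR
  -- W vanishes on the middle ray, so an orbit starting there at radius r has radius r exp(W(a)) ≤ r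
  -- exp(B) afterwards.
  refine ⟨δ * Real.exp (-B), by positivity, fun r hr hr₀ χ Γ hΓ t ht => ?_⟩
  have hl0 : |(0 : ℝ)| < S.l := by simpa using S.l_pos
  have hx : pt r S.m ∈ S.region := by simpa using S.pt_mem_region hr hl0
  have hc : S.coord (pt r S.m) = 0 := by simpa using S.coord_pt hr hl0.le
  have h1 := monotone_coord hv hΓ hx ht
  simp only [hΓ.zero, hc] at h1
  have hinv := (flow_invariant hv hΓ hx t).1
  have h2 := log_rad_eq hv hΓ hx t
  have h3 : S.L (pt r S.m) = Real.log r := by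
    rw [L, hc, rad_pt hr.le]
    simp [W]
  have h4 := hB _ ⟨h1, (S.coord_mem hinv).2⟩
  have h5 : Real.log r ≤ Real.log δ - B := by
    have := Real.log_le_log hr hr₀
    rw [Real.log_mul hδ.ne' (Real.exp_pos _).ne', Real.log_exp] at this
    linarith
  rw [← Real.log_le_log_iff (rad_pos.2 hinv.1) hδ]
  linarith

end

end FlowSector

end PlanarReg

namespace PlanarReg

variable {v : ℝ × ℝ → ℝ × ℝ} {k : ℕ} {R Θ : ℝ → ℝ}

/-! ### Invariant rays -/

section Rays

variable {χ : ℝ × ℝ → ℝ} {Γ : ℝ → ℝ × ℝ → ℝ × ℝ}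

theorem pt_eq_smul (r θ : ℝ) : pt r θ = r • pt 1 θ := by simp [pt]

theorem IsPolarField.apply_ray (hv : IsPolarField v k R Θ) {θ : ℝ} (hθ : Θ θ = 0) (r : ℝ) :
    v (pt r θ) = (r ^ (k + 1) * R θ) • pt 1 θ := by
  rw [hv.apply_pt, hθ, mul_zero, pt_zero, add_zero, ← pt_eq_smul]

/-- The zeros of the angular component are invariant rays. -/
theorem IsPolarField.ray_invariant (hv : IsPolarField v k R Θ) (hΓ : IsCutoffFlow v χ Γ) {r θ : ℝ}
    (hr : 0 < r) (hθ : Θ θ = 0) (t : ℝ) :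
    0 < rad (Γ t (pt r θ)) ∧ Γ t (pt r θ) = pt (rad (Γ t (pt r θ))) θ := by
  obtain ⟨K, hK⟩ := hΓ.lipschitz
  obtain ⟨C, hC⟩ := hΓ.bounded
  set j : ℝ →L[ℝ] ℝ × ℝ := ContinuousLinearMap.toSpanSingleton ℝ (pt 1 θ) with hj
  have hj' : ∀ s, j s = pt s θ := fun s => by
    rw [hj, ContinuousLinearMap.toSpanSingleton_apply, ← pt_eq_smul]
  set ℓ : ℝ × ℝ →L[ℝ] ℝ := Real.cos θ • ContinuousLinearMap.fst ℝ ℝ ℝ +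
    Real.sin θ • ContinuousLinearMap.snd ℝ ℝ ℝ with hℓ
  have hℓ1 : ℓ (pt 1 θ) = 1 := by
    simp only [hℓ, pt, one_mul, add_apply, smul_apply,
      ContinuousLinearMap.coe_fst', ContinuousLinearMap.coe_snd', smul_eq_mul]
    linarith [Real.cos_sq_add_sin_sq θ]
  have hlip := ℓ.lipschitz.comp (hK.comp j.lipschitz)
  have hbd : ∀ s, ‖ℓ (χ (j s) • v (j s))‖ ≤ (‖ℓ‖₊ * C : NNReal) := fun s => by
    refine (ℓ.le_opNorm _).trans ?_
    push_cast
    exact mul_le_mul_of_nonneg_left (hC _) (norm_nonneg _)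
  obtain ⟨ρ, hρ0, hρ⟩ := exists_integralCurve_of_bounded hlip hbd r
  have hray : ∀ s, χ (j s) • v (j s) = ℓ (χ (j s) • v (j s)) • pt 1 θ := fun s => by
    have h1 : v (j s) = (s ^ (k + 1) * R θ) • pt 1 θ := by rw [hj', hv.apply_ray hθ]
    rw [h1]
    simp only [map_smul, hℓ1, smul_eq_mul, mul_one, smul_smul]
  have hflow : ∀ t, pt (ρ t) θ = Γ t (pt r θ) := fun t => by
    have := hΓ.eq_of_hasDerivAt (γ := fun t => j (ρ t)) (fun t => ?_) t
    · simpa only [hj', hρ0] using this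
    · have h1 := j.hasFDerivAt.comp_hasDerivAt t (hρ t)
      rw [hray]
      exact h1
  have hne : ∀ t, ρ t ≠ 0 := fun t h0 => by
    refine hΓ.ne_of_zero hv.apply_zero (pt_ne_zero hr θ) t ?_
    rw [← hflow, h0, pt_zero]
  have hcont : Continuous ρ := continuous_iff_continuousAt.2 fun t => (hρ t).continuousAt
  have hpos : 0 < ρ t := by
    by_contra hcon
    have : (0 : ℝ) ∈ uIcc (ρ 0) (ρ t) := by
      rw [hρ0]
      exact ⟨inf_le_right.trans (not_lt.1 hcon), hr.le.trans le_sup_left⟩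
    obtain ⟨s, -, hs⟩ := intermediate_value_uIcc hcont.continuousOn this
    exact hne s hs
  rw [← hflow, rad_pt hpos.le]
  exact ⟨hpos, rfl⟩

theorem IsPolarField.hasDerivAt_log_rad_ray (hv : IsPolarField v k R Θ)
    (hΓ : IsCutoffFlow v χ Γ) {r θ : ℝ} (hr : 0 < r) (hθ : Θ θ = 0) (t : ℝ) :
    HasDerivAt (fun t => Real.log (rad (Γ t (pt r θ))))
      (χ (Γ t (pt r θ)) * (rad (Γ t (pt r θ)) ^ k * R θ)) t := by
  obtain ⟨h1, h2⟩ := hv.ray_invariant hΓ hr hθ t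
  exact hv.hasDerivAt_log_rad (hΓ.hasDerivAt _ t) h1 h2

theorem IsPolarField.ray_le_of_neg (hv : IsPolarField v k R Θ) (hΓ : IsCutoffFlow v χ Γ) {r θ : ℝ}
    (hr : 0 < r) (hθ : Θ θ = 0) (hR : R θ ≤ 0) {t : ℝ} (ht : 0 ≤ t) :
    rad (Γ t (pt r θ)) ≤ r := by
  have h1 := antitone_of_hasDerivAt_nonpos (hv.hasDerivAt_log_rad_ray hΓ hr hθ) (fun t =>
    mul_nonpos_of_nonneg_of_nonpos (hΓ.nonneg _)
      (mul_nonpos_of_nonneg_of_nonpos (pow_nonneg (rad_nonneg _) _) hR)) ht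
  simp only [hΓ.zero, rad_pt hr.le] at h1
  exact (Real.log_le_log_iff (hv.ray_invariant hΓ hr hθ t).1 hr).1 h1

/-- On an outgoing ray the radius never decreases, so log rad grows at least at the rate r^k R(θ).
-/
theorem IsPolarField.ray_not_forward_bounded (hv : IsPolarField v k R Θ)
    (hΓ : IsCutoffFlow v χ Γ) {r θ ρ : ℝ} (hr : 0 < r) (hθ : Θ θ = 0) (hR : 0 < R θ)
    (hχ : ∀ t, 0 ≤ t → χ (Γ t (pt r θ)) = 1) (hρ : ∀ t, 0 ≤ t → rad (Γ t (pt r θ)) ≤ ρ) :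
    False := by
  have hd := hv.hasDerivAt_log_rad_ray hΓ hr hθ
  have hpos := fun t => (hv.ray_invariant hΓ hr hθ t).1
  have hge : ∀ t, 0 ≤ t → r ≤ rad (Γ t (pt r θ)) := fun t ht => by
    have h1 := monotone_of_hasDerivAt_nonneg hd (fun t => mul_nonneg (hΓ.nonneg _)
      (mul_nonneg (pow_nonneg (rad_nonneg _) _) hR.le)) ht
    simp only [hΓ.zero, rad_pt hr.le] at h1
    exact (Real.log_le_log_iff hr (hpos t)).1 h1
  refine false_of_deriv_ge (c := r ^ k * R θ) (C := Real.log ρ) (by positivity)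
    (fun t _ => hd t) (fun t ht => ?_) fun t ht => Real.log_le_log (hpos t) (hρ t ht)
  rw [hχ t ht, one_mul]
  exact mul_le_mul_of_nonneg_right (pow_le_pow_left₀ hr.le (hge t ht) k) hR.le

end Rays

theorem FlowSector.continuousAt_L {S : FlowSector R Θ} (hv : IsPolarField v k R Θ) {z : ℝ × ℝ}
    (hz : z ∈ S.region) : ContinuousAt S.L z := by
  have h1 : ContinuousAt S.coord z := by
    refine (FlowSector.continuousAt_coord_of_tendsto (S := S) (F := 𝓝 z) (u := id) hz.1 tendsto_id
      ?_).1.const_mul S.τ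
    exact FlowSector.region_open.mem_nhds hz
  exact (continuous_rad.continuousAt.log (rad_pos.2 hz.1).ne').sub
    (ContinuousAt.comp (f := S.coord)
      (FlowSector.hasDerivAt_W hv (S.coord_mem hz)).continuousAt h1)

/-! ### Trivialised blocks have only hyperbolic sectors -/

namespace TrivialisedBlock

variable (B : TrivialisedBlock v)

theorem stays_χ {x : ℝ × ℝ} {f : ℝ → ℝ} (h : ∀ t, 0 ≤ t → B.Γ (f t) x ∈ B.N) (t : ℝ) (ht : 0 ≤ t) :
    B.χ (B.Γ (f t) x) = 1 := B.flow.eq_one _ (B.flow.subset (h t ht))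

theorem exists_rad_le : ∃ ρ, ∀ z ∈ B.N, rad z ≤ ρ := by
  obtain ⟨ρ, hρ⟩ := B.flow.isCompact.bddAbove_image continuous_rad.continuousOn
  exact ⟨ρ, fun z hz => hρ (mem_image_of_mem _ hz)⟩

/-- Boundary points leave the block immediately, forwards or backwards, whereas an equilibrium in
the block does not. -/
theorem zero_not_mem_frontier (h0 : v 0 = 0) : (0 : ℝ × ℝ) ∉ frontier B.N := by
  rw [← B.frontier_eq]
  rintro (h | h)
  · obtain ⟨t, ht⟩ := (B.leave_entry 0 h).exists
    rw [B.flow.eq_of_zero h0] at ht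
    exact ht B.zero_mem
  · obtain ⟨t, ht⟩ := (B.leave_exit 0 h).exists
    rw [B.flow.eq_of_zero h0] at ht
    exact ht B.zero_mem

theorem mem_nhds_zero (h0 : v 0 = 0) : B.N ∈ 𝓝 (0 : ℝ × ℝ) := by
  have h1 := B.zero_not_mem_frontier h0
  rw [B.flow.isCompact.isClosed.frontier_eq] at h1
  by_contra hcon
  exact h1 ⟨B.zero_mem, fun h => hcon (mem_interior_iff_mem_nhds.1 h)⟩

theorem ne_zero_of_exit (h0 : v 0 = 0) (y : B.nM) : (y : ℝ × ℝ) ≠ 0 := fun h =>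
  B.zero_not_mem_frontier h0 (B.frontier_eq ▸ Or.inr (h ▸ y.2))

open Classical in
/-- The homeomorphism between entry and exit set as a map of the plane. -/
noncomputable def map (q : ℝ × ℝ) : ℝ × ℝ := if h : q ∈ B.nP then B.e ⟨q, h⟩ else q

theorem map_eq {q : ℝ × ℝ} (h : q ∈ B.nP) : B.map q = B.e ⟨q, h⟩ := dif_pos h

theorem continuousOn_map : ContinuousOn B.map B.nP := by
  rw [continuousOn_iff_continuous_domRestrict]
  have : B.nP.domRestrict B.map = fun q => (B.e q : ℝ × ℝ) := funext fun q => B.map_eq q.2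
  rw [this]
  exact continuous_subtype_val.comp B.e.continuous

theorem not_stays_of_saddle (hv : IsPolarField v k R Θ) (S : FlowSector R Θ)
    (hR : 0 < R (S.m + S.τ * S.l)) {x : ℝ × ℝ} (hx : x ∈ S.region)
    (hst : ∀ t, 0 ≤ t → B.Γ t x ∈ B.N) : False := by
  obtain ⟨ρ, hρ⟩ := B.exists_rad_le
  exact FlowSector.not_forward_bounded hv B.flow.toIsCutoffFlow hR hx (B.stays_χ hst)
    fun t ht => hρ _ (hst t ht)

theorem map_of_leave_region (hv : IsPolarField v k R Θ) (S : FlowSector R Θ) {q : ℝ × ℝ}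
    (hq : q ∈ B.nP) (hqS : q ∈ S.region) (hl : ∃ t, 0 ≤ t ∧ B.Γ t q ∉ B.N) :
    B.map q ∈ S.region ∧ S.L (B.map q) = S.L q := by
  obtain ⟨T, -, hT⟩ := B.map_of_leave ⟨q, hq⟩ hl
  rw [B.map_eq hq, ← hT]
  exact FlowSector.flow_invariant hv B.flow.toIsCutoffFlow hqS T

/-- The forward end of a sector is a saddle direction. -/
theorem right_pos (B : TrivialisedBlock v) (hv : IsPolarField v k R Θ) (S : FlowSector R Θ) :
    0 < R (S.m + S.τ * S.l) := by
  by_contra hcon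
  have hR : R (S.m + S.τ * S.l) < 0 := lt_of_le_of_ne (not_lt.1 hcon) S.ne_right
  have hΓ := B.flow.toIsCutoffFlow
  obtain ⟨δ, hδ, hδN⟩ := exists_closedBall_rad (B.mem_nhds_zero hv.apply_zero)
  obtain ⟨r₀, hr₀, hfwd⟩ := FlowSector.exists_forward_bounded hv hR hδ
  -- The forward end attracts orbits to the origin. An incoming ray at the backward end makes the
  -- sector parabolic, an outgoing one makes it elliptic.
  rcases lt_or_gt_of_ne S.ne_left with hL | hL
  · have hst : ∀ t, 0 ≤ t → B.Γ t (pt r₀ S.m) ∈ B.N := fun t ht =>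
      hδN _ (hfwd r₀ hr₀ le_rfl _ _ hΓ t ht)
    have hzS : pt r₀ S.m ∈ S.region := by
      simpa using S.pt_mem_region hr₀ (a := 0) (by simpa using S.l_pos)
    obtain ⟨T, -, hxP, hxst⟩ := B.exists_entry hzS.1 hst
    set x := B.Γ (-T) (pt r₀ S.m) with hx
    have hxS : x ∈ S.region := (FlowSector.flow_invariant hv hΓ hzS (-T)).1
    -- All entry points near x must be asymptotic. Otherwise x is a limit of leaving entry points;
    -- their images lie in the sector with convergent `L`, so `B.map x` lies in the sector too. Its
    -- backward orbit stays in the block, which the saddle at the backward end forbids.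
    refine B.not_eventually_stays hv.contDiff.continuous hxP ?_
    by_contra hev
    set A := {q | q ∈ B.nP ∧ ∃ t, 0 ≤ t ∧ B.Γ t q ∉ B.N} with hA
    have hfreq : ∃ᶠ q in 𝓝 x, q ∈ A := by
      rw [not_eventually] at hev
      refine hev.mono fun q hq => ?_
      push Not at hq
      exact hq
    have hne : (𝓝[A] x).NeBot := mem_closure_iff_nhdsWithin_neBot.1
      (mem_closure_iff_frequently.2 hfreq)
    have hmem : ∀ᶠ q in 𝓝[A] x, q ∈ A ∧ q ∈ S.region :=
      (eventually_mem_nhdsWithin).and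
        (nhdsWithin_le_nhds (FlowSector.region_open.mem_nhds hxS))
    have hmap : ∀ᶠ q in 𝓝[A] x, B.map q ∈ S.region ∧ S.L (B.map q) = S.L q :=
      hmem.mono fun q hq => B.map_of_leave_region hv S hq.1.1 hq.2 hq.1.2
    have hlim : Tendsto B.map (𝓝[A] x) (𝓝 (B.map x)) :=
      (B.continuousOn_map x hxP).mono_left (nhdsWithin_mono x fun q hq => hq.1)
    have hlimL : Tendsto (fun q => S.L (B.map q)) (𝓝[A] x) (𝓝 (S.L x)) :=
      ((FlowSector.continuousAt_L hv hxS).tendsto.mono_left nhdsWithin_le_nhds).congr'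
        (hmap.mono fun q hq => hq.2.symm)
    have hy0 : B.map x ≠ 0 := by
      rw [B.map_eq hxP]
      exact B.ne_zero_of_exit hv.apply_zero _
    have hyS := FlowSector.mem_region_of_tendsto hv hy0 hlim (hmap.mono fun q hq => hq.1) hlimL
    refine B.reverse.not_stays_of_saddle hv.neg S.reverse ?_ hyS fun t ht => ?_
    · simpa [FlowSector.reverse] using hL
    · rw [B.map_eq hxP]
      exact B.map_stays ⟨x, hxP⟩ hxst ht
  · obtain ⟨r₁, hr₁, hbwd⟩ := FlowSector.exists_forward_bounded (S := S.reverse) hv.neg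
      (by simpa [FlowSector.reverse] using hL) hδ
    have hr : 0 < min r₀ r₁ := lt_min hr₀ hr₁
    -- Elliptic sector: the orbit through a small point of the middle ray stays close to 0 in both
    -- time directions, so the maximal invariant set is too large.
    refine pt_ne_zero hr S.m (B.invariant _ fun t => ?_)
    rcases le_total 0 t with ht | ht
    · exact hδN _ (hfwd _ hr (min_le_left _ _) _ _ hΓ t ht)
    · have := hbwd _ hr (min_le_right _ _) _ _ hΓ.reverse (-t) (by linarith)
      simp only [neg_neg] at this
      exact hδN _ this

/-- The backward end of a sector is a saddle direction. -/
theorem left_neg (B : TrivialisedBlock v) (hv : IsPolarField v k R Θ) (S : FlowSector R Θ) :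
    R (S.m + S.τ * -S.l) < 0 := by
  simpa [FlowSector.reverse] using B.reverse.right_pos hv.neg S.reverse

/-- Entry points accumulate from within the sector at an asymptotic entry point on its backward
end. -/
theorem mem_closure_entry (hv : IsPolarField v k R Θ) (S : FlowSector R Θ) {ρ : ℝ} (hρ : 0 < ρ)
    (ha : pt ρ (S.m + S.τ * -S.l) ∈ B.nP)
    (hst : ∀ t, 0 ≤ t → B.Γ t (pt ρ (S.m + S.τ * -S.l)) ∈ B.N) :
    pt ρ (S.m + S.τ * -S.l) ∈ closure (B.nP ∩ S.region) := by
  set θ := S.m + S.τ * -S.l with hθ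
  set a := pt ρ θ with haθ
  obtain ⟨g, hg, hgv⟩ := B.exists_inward a ha hst
  have hR := B.left_neg hv S
  -- On the backward ray the field points to the origin, and `g` decreases along the field; hence
  -- `g` increases radially.
  have hdg : 0 < fderiv ℝ g a (pt 1 θ) := by
    rw [haθ, hv.apply_ray S.zero_left, ← haθ, map_smul, smul_eq_mul] at hgv
    have : 0 < ρ ^ (k + 1) := by positivity
    by_contra hcon
    exact absurd hgv (not_lt.2 (mul_nonneg_of_nonpos_of_nonpos
      (mul_nonpos_of_nonneg_of_nonpos this.le hR.le) (not_lt.1 hcon)))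
  have hcg := hg.1.continuous
  have hd : HasDerivAt (fun s => g (pt s θ)) (fderiv ℝ g a (pt 1 θ)) ρ := by
    have h1 : HasDerivAt (fun s => pt s θ) (pt 1 θ) ρ := by
      have := (hasDerivAt_id ρ).smul_const (pt 1 θ)
      simp only [id, one_smul, ← pt_eq_smul] at this
      exact this
    exact (hg.1.differentiable (by simp) a).hasFDerivAt.comp_hasDerivAt ρ h1
  rw [mem_closure_iff_nhds]
  intro V hV
  obtain ⟨ε, hε, hball⟩ := Metric.mem_nhds_iff.1
    (inter_mem hV (B.eventually_mem_entry hv.contDiff.continuous hg hgv))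
  have hev : ∀ᶠ s in 𝓝 ρ, pt s θ ∈ Metric.ball a ε ∧ 0 < s :=
    ((by fun_prop : Continuous fun s : ℝ => pt s θ).continuousAt.eventually_mem
      (Metric.ball_mem_nhds a hε)).and (lt_mem_nhds hρ)
  have hslope : ∀ᶠ s in 𝓝[≠] ρ, 0 < slope (fun s => g (pt s θ)) ρ s :=
    (hasDerivAt_iff_tendsto_slope.1 hd).eventually_const_lt hdg
  -- Radii `s₁ < ρ < s₂` with `g < 0` at the first and `g > 0` at the second. The signs persist on
  -- nearby rays inside the sector, and a zero of `g` between the two radii is an entry point there.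
  obtain ⟨s₁, ⟨h₁, hs₁, hs₁0⟩, hs₁ρ⟩ :=
    (((hslope.filter_mono (nhdsWithin_mono ρ (s := Iio ρ) fun t ht => ne_of_lt ht)).and
      (hev.filter_mono nhdsWithin_le_nhds)).and
      (self_mem_nhdsWithin : Iio ρ ∈ 𝓝[<] ρ)).exists
  obtain ⟨s₂, ⟨h₂, hs₂, hs₂0⟩, hs₂ρ⟩ :=
    (((hslope.filter_mono (nhdsWithin_mono ρ (s := Ioi ρ) fun t ht => ne_of_gt ht)).and
      (hev.filter_mono nhdsWithin_le_nhds)).and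
      (self_mem_nhdsWithin : Ioi ρ ∈ 𝓝[>] ρ)).exists
  have hga : g (pt ρ θ) = 0 := hg.2.1
  simp only [slope_def_field, hga, sub_zero] at h₁ h₂
  have h₁' : g (pt s₁ θ) < 0 := by
    by_contra hcon
    exact absurd h₁ (not_lt.2 (div_nonpos_of_nonneg_of_nonpos (not_lt.1 hcon) (by linarith)))
  have h₂' : 0 < g (pt s₂ θ) := by
    by_contra hcon
    exact absurd h₂ (not_lt.2 (div_nonpos_of_nonpos_of_nonneg (not_lt.1 hcon) (by linarith)))
  have hc : ∀ s, Continuous fun x => pt s (S.m + S.τ * x) := fun s => by fun_prop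
  have hnear : ∀ᶠ x in 𝓝 (-S.l), (pt s₁ (S.m + S.τ * x) ∈ Metric.ball a ε ∧
      pt s₂ (S.m + S.τ * x) ∈ Metric.ball a ε) ∧ g (pt s₁ (S.m + S.τ * x)) < 0 ∧
      0 < g (pt s₂ (S.m + S.τ * x)) :=
    (((hc s₁).continuousAt.eventually_mem (Metric.isOpen_ball.mem_nhds hs₁)).and
      ((hc s₂).continuousAt.eventually_mem (Metric.isOpen_ball.mem_nhds hs₂))).and
      (((hcg.comp (hc s₁)).continuousAt.eventually_lt_const h₁').and
        ((hcg.comp (hc s₂)).continuousAt.eventually_const_lt h₂'))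
  obtain ⟨x, ⟨⟨hx₁, hx₂⟩, hgx₁, hgx₂⟩, hx⟩ := ((hnear.filter_mono nhdsWithin_le_nhds).and
    (Ioo_mem_nhdsGT (show -S.l < S.l by linarith [S.l_pos]))).exists
  have hs₁₂ : s₁ ≤ s₂ := by linarith
  have hcs : Continuous fun s => g (pt s (S.m + S.τ * x)) := by fun_prop
  obtain ⟨s, hs, hgs⟩ := intermediate_value_Icc hs₁₂ hcs.continuousOn
    (show (0 : ℝ) ∈ Icc _ _ from ⟨hgx₁.le, hgx₂.le⟩)
  have hsb : pt s (S.m + S.τ * x) ∈ Metric.ball a ε := by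
    have hseg : s ∈ segment ℝ s₁ s₂ := by rwa [segment_eq_Icc hs₁₂]
    obtain ⟨c, d, hc0, hd0, hcd, rfl⟩ := hseg
    have := convex_ball a ε hx₁ hx₂ hc0 hd0 hcd
    convert this using 1
    simp only [pt, Prod.smul_mk, Prod.mk_add_mk, smul_eq_mul]
    ext <;> ring
  obtain ⟨hV', hiff⟩ := hball hsb
  exact ⟨_, hV', hiff.1 hgs, S.pt_mem_region (by linarith [hs.1]) (abs_lt.2 hx)⟩

/-- The asymptotic entry point on the backward end of a sector is mapped to its forward end. -/
theorem map_backward_end (hv : IsPolarField v k R Θ) (S : FlowSector R Θ) {ρ : ℝ} (hρ : 0 < ρ)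
    (ha : pt ρ (S.m + S.τ * -S.l) ∈ B.nP)
    (hst : ∀ t, 0 ≤ t → B.Γ t (pt ρ (S.m + S.τ * -S.l)) ∈ B.N) :
    ∃ ρ' > 0, B.map (pt ρ (S.m + S.τ * -S.l)) = pt ρ' (S.m + S.τ * S.l) := by
  have hcl := B.mem_closure_entry hv S hρ ha hst
  set θ := S.m + S.τ * -S.l with hθ
  set a := pt ρ θ with haθ
  have ha0 : a ≠ 0 := pt_ne_zero hρ θ
  have hne : (𝓝[B.nP ∩ S.region] a).NeBot := mem_closure_iff_nhdsWithin_neBot.1 hcl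
  have hmem : ∀ᶠ q in 𝓝[B.nP ∩ S.region] a, q ∈ B.nP ∩ S.region := eventually_mem_nhdsWithin
  have hmap : ∀ᶠ q in 𝓝[B.nP ∩ S.region] a, B.map q ∈ S.region ∧ S.L (B.map q) = S.L q :=
    hmem.mono fun q hq => B.map_of_leave_region hv S hq.1 hq.2 <| by
      by_contra hcon
      push Not at hcon
      exact B.not_stays_of_saddle hv S (B.right_pos hv S) hq.2 hcon
  have hlim : Tendsto B.map (𝓝[B.nP ∩ S.region] a) (𝓝 (B.map a)) :=
    (B.continuousOn_map a ha).mono_left (nhdsWithin_mono a inter_subset_left)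
  have hid : Tendsto id (𝓝[B.nP ∩ S.region] a) (𝓝 a) := tendsto_id.mono_left nhdsWithin_le_nhds
  -- For the reversed sector this end is a saddle end, so W tends to +∞ and `L` to -∞. The images
  -- have the same values of `L`, so their limit `b` cannot lie in the open sector.
  have hLbot : Tendsto S.L (𝓝[B.nP ∩ S.region] a) atBot := by
    have h1 := FlowSector.tendsto_nhdsLT (S := S.reverse) ha0 hid (hmem.mono fun q hq => hq.2) (by
      rw [FlowSector.reverse_coord, haθ, hθ, S.coord_pt hρ (by rw [abs_neg, abs_of_pos S.l_pos]),
        neg_neg]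
      rfl)
    have h2 := (FlowSector.W_right_pos (S := S.reverse) hv.neg
      (by simpa [FlowSector.reverse] using B.left_neg hv S)).comp h1
    have h3 : Tendsto (fun q => Real.log (rad q)) (𝓝[B.nP ∩ S.region] a) (𝓝 (Real.log (rad a))) :=
      ((continuous_rad.tendsto a).comp hid).log (rad_pos.2 ha0).ne'
    have h4 := h3.add_atBot (tendsto_neg_atTop_atBot.comp h2)
    refine h4.congr fun q => ?_
    simp [FlowSector.L, FlowSector.reverse_W, FlowSector.reverse_coord, sub_eq_add_neg]
  have hLmap : Tendsto (fun q => S.L (B.map q)) (𝓝[B.nP ∩ S.region] a) atBot :=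
    hLbot.congr' (hmap.mono fun q hq => hq.2.symm)
  set b := B.map a with hb
  have hb0 : b ≠ 0 := by
    rw [hb, B.map_eq ha]
    exact B.ne_zero_of_exit hv.apply_zero _
  have hle := (FlowSector.continuousAt_coord_of_tendsto (S := S) hb0 hlim
    (hmap.mono fun q hq => hq.1)).2
  have hbS : b ∉ S.region := fun hbS => not_tendsto_nhds_of_tendsto_atBot hLmap _
    ((FlowSector.continuousAt_L hv hbS).tendsto.comp hlim)
  have habs : |S.coord b| = S.l := by
    rw [S.abs_coord]
    exact le_antisymm hle (not_lt.1 fun h => hbS ⟨hb0, h⟩)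
  have hbpt := S.pt_coord b
  rcases eq_or_eq_neg_of_abs_eq habs with h | h
  · exact ⟨rad b, rad_pos.2 hb0, by rw [← h, hbpt]⟩
  -- On the backward ray itself the backward orbit of `b` would run outwards and leave the block,
  -- although `b` is an asymptotic exit point.
  · exfalso
    rw [h, ← hθ] at hbpt
    obtain ⟨ρ', hρ'⟩ := B.exists_rad_le
    have hbst : ∀ t, 0 ≤ t → B.Γ (-t) (pt (rad b) θ) ∈ B.N := fun t ht => by
      rw [hbpt, hb, B.map_eq ha]
      exact B.map_stays ⟨a, ha⟩ hst ht
    exact hv.neg.ray_not_forward_bounded B.flow.toIsCutoffFlow.reverse (rad_pos.2 hb0)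
      (by rw [Pi.neg_apply, hθ, S.zero_left, neg_zero])
      (by rw [Pi.neg_apply, hθ]; exact neg_pos.2 (B.left_neg hv S)) (B.stays_χ hbst)
      fun t ht => hρ' _ (hbst t ht)

end TrivialisedBlock

end PlanarReg

/-! ### Excluding centres and foci; exactly one characteristic direction -/

namespace PlanarReg

variable {v : ℝ × ℝ → ℝ × ℝ} {k : ℕ} {R Θ : ℝ → ℝ}

namespace TrivialisedBlock

/-- A trivialised block admits no strict Lyapunov function that is logarithmic at the origin. -/
theorem not_lyapunov (B : TrivialisedBlock v) (h0 : v 0 = 0) {V q : ℝ × ℝ → ℝ} {C c : ℝ}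
    (hV : ∀ z, z ≠ 0 → |V z - Real.log (rad z)| ≤ C) (hc : 0 < c) (hq : ∀ z, z ≠ 0 → q z ≤ -c)
    (hd : ∀ x, x ≠ 0 → ∀ t, HasDerivAt (fun t => V (B.Γ t x))
      (B.χ (B.Γ t x) * (rad (B.Γ t x) ^ k * q (B.Γ t x))) t) : False := by
  have hΓ := B.flow.toIsCutoffFlow
  have hne : ∀ x, x ≠ 0 → ∀ t, B.Γ t x ≠ 0 := fun x hx t => hΓ.ne_of_zero h0 hx t
  have hanti : ∀ x, x ≠ 0 → Antitone fun t => V (B.Γ t x) := fun x hx =>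
    antitone_of_hasDerivAt_nonpos (hd x hx) fun t => mul_nonpos_of_nonneg_of_nonpos
      (hΓ.nonneg _) (mul_nonpos_of_nonneg_of_nonpos (pow_nonneg (rad_nonneg _) _)
        (by linarith [hq _ (hne x hx t)]))
  obtain ⟨δ, hδ, hδN⟩ := exists_closedBall_rad (B.mem_nhds_zero h0)
  -- V differs from log rad by at most `C` at the start and at any later time, so while V decreases
  -- the radius grows at most by the factor exp(2C).
  have hr : 0 < δ * Real.exp (-(2 * C)) := by positivity
  set z := pt (δ * Real.exp (-(2 * C))) 0 with hz
  have hz0 : z ≠ 0 := pt_ne_zero hr 0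
  have hst : ∀ t, 0 ≤ t → B.Γ t z ∈ B.N := fun t ht => by
    refine hδN _ ?_
    rw [← Real.log_le_log_iff (rad_pos.2 (hne z hz0 t)) hδ]
    have h1 := hanti z hz0 ht
    simp only [hΓ.zero] at h1
    have h2 := abs_le.1 (hV _ (hne z hz0 t))
    have h3 := abs_le.1 (hV z hz0)
    have h4 : Real.log (rad z) = Real.log δ - 2 * C := by
      rw [hz, rad_pt hr.le, Real.log_mul hδ.ne' (Real.exp_pos _).ne', Real.log_exp]
      ring
    linarith [h2.1, h3.2]
  obtain ⟨T, -, hxP, hxst⟩ := B.exists_entry hz0 hst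
  set y : ℝ × ℝ := (B.e ⟨_, hxP⟩).1 with hy
  have hy0 : y ≠ 0 := B.ne_zero_of_exit h0 _
  have hyst : ∀ t, 0 ≤ t → B.Γ (-t) y ∈ B.N := fun t ht => B.map_stays ⟨_, hxP⟩ hxst ht
  obtain ⟨ρ, hρ⟩ := B.exists_rad_le
  -- Backwards from the asymptotic exit point `y`, V does not decrease, so the radius stays above
  -- exp(V y - C) and V grows at a fixed positive rate. In the block V is at most log ρ + C.
  refine false_of_deriv_ge (f := fun t => V (B.Γ (-t) y))
    (f' := fun t => (-1 : ℝ) • (B.χ (B.Γ (-t) y) * (rad (B.Γ (-t) y) ^ k * q (B.Γ (-t) y))))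
    (c := Real.exp (V y - C) ^ k * c)
    (C := Real.log ρ + C) (by positivity) (fun t _ => ?_) (fun t ht => ?_) fun t ht => ?_
  · exact (hd y hy0 (-t)).scomp t (hasDerivAt_neg t)
  · rw [B.stays_χ hyst t ht, one_mul, smul_eq_mul, neg_one_mul, ← mul_neg]
    have h1 := hanti y hy0 (show -t ≤ 0 by linarith)
    simp only [hΓ.zero] at h1
    have h2 := abs_le.1 (hV _ (hne y hy0 (-t)))
    have h3 : Real.exp (V y - C) ≤ rad (B.Γ (-t) y) := by
      rw [← Real.le_log_iff_exp_le (rad_pos.2 (hne y hy0 (-t)))]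
      linarith [h2.2]
    have h4 := hq _ (hne y hy0 (-t))
    exact mul_le_mul (pow_le_pow_left₀ (Real.exp_pos _).le h3 k) (by linarith) hc.le
      (pow_nonneg (rad_nonneg _) _)
  · have h2 := abs_le.1 (hV _ (hne y hy0 (-t)))
    have h3 := Real.log_le_log (rad_pos.2 (hne y hy0 (-t))) (hρ _ (hyst t ht))
    linarith [h2.2]

/-- A trivialised block admits no first integral that is logarithmic at the origin. -/
theorem not_first_integral (B : TrivialisedBlock v) (h0 : v 0 = 0) {V : ℝ × ℝ → ℝ} {C : ℝ}
    (hV : ∀ z, z ≠ 0 → |V z - Real.log (rad z)| ≤ C)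
    (hd : ∀ x, x ≠ 0 → ∀ t, HasDerivAt (fun t => V (B.Γ t x)) 0 t) : False := by
  have hΓ := B.flow.toIsCutoffFlow
  obtain ⟨δ, hδ, hδN⟩ := exists_closedBall_rad (B.mem_nhds_zero h0)
  have hr : 0 < δ * Real.exp (-(2 * C)) := by positivity
  set z := pt (δ * Real.exp (-(2 * C))) 0 with hz
  have hz0 : z ≠ 0 := pt_ne_zero hr 0
  refine hz0 (B.invariant z fun t => hδN _ ?_)
  have hzt := hΓ.ne_of_zero h0 hz0 t
  rw [← Real.log_le_log_iff (rad_pos.2 hzt) hδ]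
  have h1 : V (B.Γ t z) = V (B.Γ 0 z) :=
    is_const_of_deriv_eq_zero (fun t => (hd z hz0 t).differentiableAt)
      (fun t => (hd z hz0 t).deriv) t 0
  rw [hΓ.zero] at h1
  have h2 := abs_le.1 (hV _ hzt)
  have h3 := abs_le.1 (hV z hz0)
  have h4 : Real.log (rad z) = Real.log δ - 2 * C := by
    rw [hz, rad_pt hr.le, Real.log_mul hδ.ne' (Real.exp_pos _).ne', Real.log_exp]
    ring
  linarith [h2.1, h3.2]

/-- There is at least one invariant ray. -/
theorem exists_ray (B : TrivialisedBlock v) (hv : IsPolarField v k R Θ) : ∃ θ, Θ θ = 0 := by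
  by_contra hcon
  push Not at hcon
  have hRc := hv.contDiff_R.continuous
  have hΘc := hv.contDiff_Θ.continuous
  set f : ℝ → ℝ := fun θ => R θ / Θ θ with hf
  have hfc : Continuous f := hRc.div hΘc hcon
  have hfp : Function.Periodic f Real.pi := fun θ => by
    have hk : ((-1 : ℝ) ^ k) ≠ 0 := by positivity
    simp only [hf, (hv.add_pi θ).1, (hv.add_pi θ).2, mul_div_mul_left _ _ hk]
  -- With the mean of R/Θ subtracted, the primitive W is periodic, and V = log r - W(angle) is
  -- single-valued. Along orbits V has derivative r^k μ Θ, up to the cut-off.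
  set μ := (∫ x in (0 : ℝ)..Real.pi, f x) / Real.pi with hμ
  set g : ℝ → ℝ := fun θ => f θ - μ with hg
  have hgc : Continuous g := hfc.sub continuous_const
  have hgp : Function.Periodic g Real.pi := fun θ => by simp only [hg, hfp θ]
  set W : ℝ → ℝ := fun θ => ∫ x in (0 : ℝ)..θ, g x with hW
  have hWd : ∀ θ, HasDerivAt W (g θ) θ := fun θ =>
    intervalIntegral.integral_hasDerivAt_right (hgc.intervalIntegrable _ _)
      hgc.stronglyMeasurable.stronglyMeasurableAtFilter hgc.continuousAt
  have hWp : Function.Periodic W Real.pi := fun θ => by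
    have h1 : ∫ x in θ..θ + Real.pi, g x = 0 := by
      have h2 := hgp.intervalIntegral_add_eq θ 0
      rw [zero_add] at h2
      rw [h2]
      have h3 : ∫ x in (0 : ℝ)..Real.pi, g x = (∫ x in (0 : ℝ)..Real.pi, f x) -
          ∫ _ in (0 : ℝ)..Real.pi, μ :=
        intervalIntegral.integral_sub (hfc.intervalIntegrable _ _) (by simp)
      rw [h3, intervalIntegral.integral_const, hμ]
      simp only [sub_zero, smul_eq_mul]
      field_simp
      ring
    have h4 := intervalIntegral.integral_add_adjacent_intervals
      (hgc.intervalIntegrable (μ := MeasureTheory.volume) 0 θ) (hgc.intervalIntegrable θ (θ + Real.pi))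
    simp only [hW]
    rw [← h4, h1, add_zero]
  have hWp' : ∀ (θ : ℝ) (n : ℤ), W (θ + n * (2 * Real.pi)) = W θ := fun θ n => by
    have := hWp.int_mul (2 * n) θ
    push_cast at this
    rw [← this]
    ring_nf
  have hWc : Continuous W := continuous_iff_continuousAt.2 fun θ => (hWd θ).continuousAt
  obtain ⟨C, hC⟩ := (isCompact_Icc (a := -Real.pi) (b := Real.pi)).exists_bound_of_continuousOn
    hWc.continuousOn
  set V : ℝ × ℝ → ℝ := fun z => Real.log (rad z) - W (ang 0 z) with hV
  have hang : ∀ z, ang 0 z ∈ Icc (-Real.pi) Real.pi := fun z => Ioc_subset_Icc_self (ang_mem 0 z)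
  have hVC : ∀ z, z ≠ 0 → |V z - Real.log (rad z)| ≤ C := fun z _ => by
    have := hC _ (hang z)
    simpa [hV] using this
  have hpt : ∀ z, pt (rad z) (ang 0 z) = z := fun z => by simpa using pt_rad_ang 0 z
  -- The angle `ang 0` jumps on its branch cut. By periodicity W may be evaluated with an angle
  -- measured from any `m`, which makes V differentiable everywhere off the origin.
  have hVm : ∀ (m : ℝ) (z : ℝ × ℝ), z ≠ 0 → W (m + ang m z) = W (ang 0 z) := fun m z hz => by
    obtain ⟨-, n, hn⟩ := (pt_eq_pt_iff (rad_pos.2 hz) (rad_pos.2 hz)).1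
      ((pt_rad_ang m z).trans (hpt z).symm)
    rw [hn, hWp']
  have hd : ∀ x, x ≠ 0 → ∀ t, HasDerivAt (fun t => V (B.Γ t x))
      (B.χ (B.Γ t x) * (rad (B.Γ t x) ^ k * (μ * Θ (ang 0 (B.Γ t x))))) t := by
    intro x hx t
    have hne := B.flow.ne_of_zero hv.apply_zero hx
    set θ := ang 0 (B.Γ t x) with hθ
    have hr := rad_pos.2 (hne t)
    have hang0 : ang θ (B.Γ t x) = 0 := by
      have := ang_pt hr (m := θ) (a := 0) ⟨by linarith [Real.pi_pos], Real.pi_pos.le⟩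
      rwa [add_zero, hpt] at this
    have hd := B.flow.hasDerivAt x t
    have h1 := hv.hasDerivAt_log_rad hd hr (hpt _).symm
    have h2 := hv.hasDerivAt_ang hd hr (hpt _).symm (m := θ) (by rw [hang0]; exact Real.pi_pos.ne)
    have h3 := (hWd _).comp t (h2.const_add θ)
    have h4 := h1.sub h3
    refine (h4.congr_of_eventuallyEq (Eventually.of_forall fun s => ?_)).congr_deriv ?_
    · simp only [hV, Pi.sub_apply, Function.comp_apply, hVm θ _ (hne s)]
    · have h5 := hcon θ
      rw [hang0, add_zero]
      simp only [hg, hf, ← hθ]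
      field_simp
      ring
  obtain ⟨a, ha, hmin⟩ := (isCompact_Icc (a := -Real.pi) (b := Real.pi)).exists_isMinOn
    ⟨0, by constructor <;> linarith [Real.pi_pos]⟩ hΘc.abs.continuousOn
  have hΘa : 0 < |Θ a| := abs_pos.2 (hcon a)
  have hmin' : ∀ z, |Θ a| ≤ |Θ (ang 0 z)| := fun z => hmin (hang z)
  have hsign : (∀ θ, 0 < Θ θ) ∨ ∀ θ, Θ θ < 0 := by
    by_contra hcon2
    push Not at hcon2
    obtain ⟨⟨θ₁, h1⟩, θ₂, h2⟩ := hcon2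
    obtain ⟨θ, hθ⟩ := mem_range_of_exists_le_of_exists_ge hΘc ⟨θ₁, h1⟩ ⟨θ₂, h2⟩
    exact hcon θ hθ
  -- μ = 0 is the centre, where V is a first integral. For μ ≠ 0 there is a focus, and V or its time
  -- reversal is a strict Lyapunov function.
  rcases eq_or_ne μ 0 with hμ0 | hμ0
  · refine B.not_first_integral hv.apply_zero hVC fun x hx t => ?_
    simpa [hμ0] using hd x hx t
  have hcpos : 0 < |μ| * |Θ a| := mul_pos (abs_pos.2 hμ0) hΘa
  have hge : ∀ z, |μ| * |Θ a| ≤ |μ * Θ (ang 0 z)| := fun z => by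
    rw [abs_mul]
    exact mul_le_mul_of_nonneg_left (hmin' z) (abs_nonneg _)
  have hcases : (∀ z, μ * Θ (ang 0 z) < 0) ∨ ∀ z, 0 < μ * Θ (ang 0 z) := by
    rcases lt_or_gt_of_ne hμ0 with h1 | h1 <;> rcases hsign with h2 | h2
    · exact Or.inl fun z => mul_neg_of_neg_of_pos h1 (h2 _)
    · exact Or.inr fun z => mul_pos_of_neg_of_neg h1 (h2 _)
    · exact Or.inr fun z => mul_pos h1 (h2 _)
    · exact Or.inl fun z => mul_neg_of_pos_of_neg h1 (h2 _)
  rcases hcases with h | h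
  · refine B.not_lyapunov (k := k) (q := fun z => μ * Θ (ang 0 z)) hv.apply_zero hVC hcpos
      (fun z _ => ?_) hd
    have := hge z
    rw [abs_of_neg (h z)] at this
    linarith
  · refine B.reverse.not_lyapunov (k := k) (q := fun z => -(μ * Θ (ang 0 z))) hv.neg.apply_zero hVC
      hcpos (fun z _ => ?_) fun x hx t => ?_
    · have := hge z
      rw [abs_of_pos (h z)] at this
      linarith
    · refine ((hd x hx (-t)).scomp t (hasDerivAt_neg t)).congr_deriv ?_
      simp [reverse]

end TrivialisedBlock

/-- The next zero after a simple zero. -/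
theorem exists_next_zero {f : ℝ → ℝ} {f' a b : ℝ} (hf : Continuous f) (ha : HasDerivAt f f' a)
    (hf' : f' ≠ 0) (hab : a < b) (hb : f b = 0) :
    ∃ c ∈ Ioc a b, f c = 0 ∧ ∀ x ∈ Ioo a c, f x ≠ 0 := by
  have h1 : ∀ᶠ x in 𝓝[>] a, f x ≠ 0 :=
    (ha.eventually_ne hf').filter_mono (nhdsWithin_mono a fun x (hx : x ∈ Ioi a) => ne_of_gt hx)
  obtain ⟨d, hd, hd'⟩ := mem_nhdsGT_iff_exists_Ioo_subset.1 h1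
  rw [mem_Ioi] at hd
  set Z := Icc d b ∩ f ⁻¹' {0} with hZ
  have hdb : d ≤ b := not_lt.1 fun h => hd' ⟨hab, h⟩ hb
  have hZc : IsCompact Z := isCompact_Icc.inter_right (isClosed_singleton.preimage hf)
  obtain ⟨c, ⟨hc, hc0⟩, hmin⟩ := hZc.exists_isLeast ⟨b, ⟨hdb, le_rfl⟩, hb⟩
  refine ⟨c, ⟨hd.trans_le hc.1, hc.2⟩, hc0, fun x hx h0 => ?_⟩
  rcases lt_or_ge x d with h | h
  · exact hd' ⟨hx.1, h⟩ h0
  · exact absurd (hmin ⟨⟨h, hx.2.le.trans hc.2⟩, h0⟩) (not_le.2 hx.2)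

/-- Neighbouring zeros of `Θ` bound a flow sector. -/
theorem exists_flowSector (hΘ : Continuous Θ) (hnd : ∀ θ, Θ θ = 0 → R θ ≠ 0) {α β : ℝ} (hαβ : α < β)
    (hle : β ≤ α + Real.pi) (hα : Θ α = 0) (hβ : Θ β = 0) (hne : ∀ θ ∈ Ioo α β, Θ θ ≠ 0) :
    ∃ S : FlowSector R Θ, (S.m + S.τ * S.l = β ∧ S.m + S.τ * -S.l = α ∧ ∀ θ ∈ Ioo α β, 0 < Θ θ) ∨
      (S.m + S.τ * S.l = α ∧ S.m + S.τ * -S.l = β) := by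
  have hsign : (∀ θ ∈ Ioo α β, 0 < Θ θ) ∨ ∀ θ ∈ Ioo α β, Θ θ < 0 := by
    by_contra hcon
    push Not at hcon
    obtain ⟨⟨θ₁, h1, h1'⟩, θ₂, h2, h2'⟩ := hcon
    obtain ⟨θ, hθ, hθ'⟩ := isPreconnected_Ioo.intermediate_value h1 h2 hΘ.continuousOn ⟨h1', h2'⟩
    exact hne θ hθ hθ'
  have e1 : (α + β) / 2 + 1 * ((β - α) / 2) = β := by ring
  have e2 : (α + β) / 2 + 1 * -((β - α) / 2) = α := by ring
  have e3 : (α + β) / 2 + -1 * ((β - α) / 2) = α := by ring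
  have e4 : (α + β) / 2 + -1 * -((β - α) / 2) = β := by ring
  rcases hsign with h | h
  · refine ⟨⟨(α + β) / 2, 1, (β - α) / 2, Or.inl rfl, by linarith, by linarith, fun a ha => ?_,
      ?_, ?_, ?_, ?_⟩, Or.inl ⟨e1, e2, h⟩⟩
    · rw [one_mul]
      exact h _ ⟨by linarith [ha.1], by linarith [ha.2]⟩
    · rw [e1, hβ]
    · rw [e2, hα]
    · rw [e1]
      exact hnd β hβ
    · rw [e2]
      exact hnd α hα
  · refine ⟨⟨(α + β) / 2, -1, (β - α) / 2, Or.inr rfl, by linarith, by linarith, fun a ha => ?_,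
      ?_, ?_, ?_, ?_⟩, Or.inr ⟨e3, e4⟩⟩
    · have := h ((α + β) / 2 + -1 * a) ⟨by linarith [ha.2], by linarith [ha.1]⟩
      linarith
    · rw [e3, hα]
    · rw [e4, hβ]
    · rw [e3]
      exact hnd α hα
    · rw [e4]
      exact hnd β hβ

/-- Regularisability forces a single characteristic direction, of saddle type. -/
theorem IsPolarField.exists_single_direction (hv : IsPolarField v k R Θ)
    (hnd : ∀ θ, Θ θ = 0 → R θ ≠ 0) (hsimple : ∀ θ, Θ θ = 0 → deriv Θ θ ≠ 0)
    (hreg : IsC0Regularisable v 0) :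
    ∃ θ₀, Θ θ₀ = 0 ∧ R θ₀ < 0 ∧ ∀ θ ∈ Ioo θ₀ (θ₀ + Real.pi), 0 < Θ θ := by
  obtain ⟨B⟩ := hreg.exists_trivialisedBlock hv.contDiff
  have hΘc := hv.contDiff_Θ.continuous
  have hder : ∀ θ, HasDerivAt Θ (deriv Θ θ) θ := fun θ =>
    (hv.contDiff_Θ.differentiable (by simp) θ).hasDerivAt
  have hpi : ∀ θ, Θ θ = 0 → Θ (θ + Real.pi) = 0 := fun θ h => by rw [(hv.add_pi θ).2, h, mul_zero]
  have hpi' : ∀ θ, Θ θ = 0 → Θ (θ - Real.pi) = 0 := fun θ h => by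
    have h1 := (hv.add_pi (θ - Real.pi)).2
    rw [sub_add_cancel, h] at h1
    have hk : ((-1 : ℝ) ^ k) ≠ 0 := by positivity
    simpa [hk] using h1.symm
  have hnext : ∀ θ, Θ θ = 0 → ∃ c ∈ Ioc θ (θ + Real.pi), Θ c = 0 ∧ ∀ x ∈ Ioo θ c, Θ x ≠ 0 :=
    fun θ h => exists_next_zero hΘc (hder θ) (hsimple θ h) (by linarith [Real.pi_pos]) (hpi θ h)
  obtain ⟨θ₁, hθ₁⟩ := B.exists_ray hv
  obtain ⟨β₁, hβ₁, hβ₁0, hβ₁ne⟩ := hnext θ₁ hθ₁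
  obtain ⟨S₁, -⟩ := exists_flowSector hΘc hnd hβ₁.1 hβ₁.2 hθ₁ hβ₁0 hβ₁ne
  obtain ⟨θ₀, hθ₀, hR₀⟩ : ∃ θ₀, Θ θ₀ = 0 ∧ R θ₀ < 0 := ⟨_, S₁.zero_left, B.left_neg hv S₁⟩
  obtain ⟨β, hβ, hβ0, hβne⟩ := hnext θ₀ hθ₀
  -- The neighbouring zero on the clockwise side is `-c`, found as the next zero of x ↦ Θ(-x).
  obtain ⟨c, hc, hc0, hcne⟩ := exists_next_zero (f := fun x => Θ (-x)) (a := -θ₀)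
    (b := -θ₀ + Real.pi) (f' := -deriv Θ θ₀) (hΘc.comp continuous_neg) (by
      have h1 := hder θ₀
      rw [← neg_neg θ₀] at h1
      have h2 := h1.scomp (-θ₀) (hasDerivAt_neg (-θ₀))
      simpa [Function.comp_def] using h2) (neg_ne_zero.2 (hsimple θ₀ hθ₀))
    (by linarith [Real.pi_pos]) (by
      have : -(-θ₀ + Real.pi) = θ₀ - Real.pi := by ring
      rw [this]
      exact hpi' θ₀ hθ₀)
  -- Forward ends have R > 0 by `right_pos`, so the incoming ray `θ₀` is the backward end of both
  -- adjacent sectors.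
  obtain ⟨S, hS | hS⟩ := exists_flowSector hΘc hnd hβ.1 hβ.2 hθ₀ hβ0 hβne
  swap
  · have := B.right_pos hv S
    rw [hS.1] at this
    linarith
  obtain ⟨S', hS' | hS'⟩ := exists_flowSector (R := R) hΘc hnd (α := -c) (β := θ₀)
    (by linarith [hc.1]) (by linarith [hc.2]) hc0 hθ₀ fun x hx => by
      have := hcne (-x) ⟨by linarith [hx.2], by linarith [hx.1]⟩
      simpa using this
  · have := B.right_pos hv S'
    rw [hS'.1] at this
    linarith
  have hΓ := B.flow.toIsCutoffFlow
  obtain ⟨δ, hδ, hδN⟩ := exists_closedBall_rad (B.mem_nhds_zero hv.apply_zero)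
  have hst : ∀ t, 0 ≤ t → B.Γ t (pt δ θ₀) ∈ B.N := fun t ht =>
    hδN _ (hv.ray_le_of_neg hΓ hδ hθ₀ hR₀.le ht)
  obtain ⟨T, -, hxP, hxst⟩ := B.exists_entry (pt_ne_zero hδ θ₀) hst
  obtain ⟨hρ, hx⟩ := hv.ray_invariant hΓ hδ hθ₀ (-T)
  rw [hx] at hxP hxst
  -- The asymptotic entry point on the ray `θ₀` has a single image, which lies on the forward end of
  -- each adjacent sector.
  have key : ∀ S : FlowSector R Θ, S.m + S.τ * -S.l = θ₀ →
      ∃ ρ' > 0, B.map (pt (rad (B.Γ (-T) (pt δ θ₀))) θ₀) = pt ρ' (S.m + S.τ * S.l) := by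
    intro S hS
    have := B.map_backward_end hv S hρ (by rwa [hS]) (by rwa [hS])
    rwa [hS] at this
  obtain ⟨ρ₁, hρ₁, h₁⟩ := key S hS.2.1
  obtain ⟨ρ₂, hρ₂, h₂⟩ := key S' hS'.2
  rw [h₁, hS.1, hS'.1, pt_eq_pt_iff hρ₁ hρ₂] at h₂
  obtain ⟨-, n, hn⟩ := h₂
  -- The angles `β` and `-c` of these ends differ by a positive multiple of 2π, while `β ≤ θ₀ + π`
  -- and `-c ≥ θ₀ - π`. Both inequalities are therefore equalities.
  have hn1 : (1 : ℝ) ≤ n := by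
    have h3 : (0 : ℝ) < n * (2 * Real.pi) := by linarith [hβ.1, hc.1]
    have h4 : (0 : ℝ) < n := by
      by_contra hcon
      exact absurd h3 (not_lt.2 (mul_nonpos_of_nonpos_of_nonneg (not_lt.1 hcon)
        (by linarith [Real.pi_pos])))
    exact_mod_cast h4
  have h5 : 1 * (2 * Real.pi) ≤ n * (2 * Real.pi) :=
    mul_le_mul_of_nonneg_right hn1 (by linarith [Real.pi_pos])
  have h6 : β = θ₀ + Real.pi := by linarith [hβ.2, hc.2]
  refine ⟨θ₀, hθ₀, hR₀, ?_⟩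
  rw [← h6]
  exact hS.2.2

end PlanarReg

/-! ### Continuous first integral of a saddle sector; tools for the block -/

namespace PlanarReg

variable {v : ℝ × ℝ → ℝ × ℝ} {k : ℕ} {R Θ : ℝ → ℝ}

namespace FlowSector

variable {S : FlowSector R Θ}

open Classical in
/-- The homogeneous first integral of degree one, extended by zero outside the sector. -/
noncomputable def H (S : FlowSector R Θ) (z : ℝ × ℝ) : ℝ :=
  if z ∈ S.region then Real.exp (S.L z) else 0

theorem H_of_mem {z : ℝ × ℝ} (hz : z ∈ S.region) : S.H z = Real.exp (S.L z) := if_pos hz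

theorem H_of_notMem {z : ℝ × ℝ} (hz : z ∉ S.region) : S.H z = 0 := if_neg hz

theorem H_pos {z : ℝ × ℝ} : 0 < S.H z ↔ z ∈ S.region := by
  by_cases hz : z ∈ S.region
  · simp [H_of_mem hz, hz, Real.exp_pos]
  · simp [H_of_notMem hz, hz]

theorem reverse_H (z : ℝ × ℝ) : S.reverse.H z = S.H z := by
  rw [H, H, reverse_L, reverse_region]

theorem H_flow (hv : IsPolarField v k R Θ) {χ : ℝ × ℝ → ℝ} {Γ : ℝ → ℝ × ℝ → ℝ × ℝ}
    (hΓ : IsCutoffFlow v χ Γ) (x : ℝ × ℝ) (t : ℝ) : S.H (Γ t x) = S.H x := by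
  by_cases hx : x ∈ S.region
  · obtain ⟨h1, h2⟩ := flow_invariant hv hΓ hx t
    rw [H_of_mem h1, H_of_mem hx, h2]
  · rw [H_of_notMem hx, H_of_notMem fun h => hx ?_]
    have := (flow_invariant hv hΓ h (-t)).1
    rwa [← hΓ.add, neg_add_cancel, hΓ.zero] at this

theorem W_bddBelow_right (hv : IsPolarField v k R Θ) (hR : 0 < R (S.m + S.τ * S.l)) :
    ∃ B, ∀ a ∈ Ico 0 S.l, B ≤ S.W a := by
  have h1 : ∀ᶠ a in 𝓝[<] S.l, 0 < S.W a := (W_right_pos hv hR).eventually_gt_atTop 0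
  obtain ⟨b, hb, hb'⟩ := mem_nhdsLT_iff_exists_Ioo_subset.1 h1
  have hsub : Icc 0 b ⊆ Ioo (-S.l) S.l := fun a ha =>
    ⟨by linarith [ha.1, S.l_pos], ha.2.trans_lt hb⟩
  obtain ⟨B, hB⟩ := isCompact_Icc.bddBelow_image
    (fun a ha => (hasDerivAt_W hv (hsub ha)).continuousAt.continuousWithinAt :
      ContinuousOn S.W (Icc 0 b))
  refine ⟨min B 0, fun a ha => ?_⟩
  rcases le_or_gt a b with h | h
  · exact (min_le_left _ _).trans (hB (mem_image_of_mem _ ⟨ha.1, h⟩))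
  · exact (min_le_right _ _).trans (le_of_lt (hb' ⟨h, ha.2⟩))

/-- W tends to +∞ at both ends, so it is bounded below, and H = r exp(-W). The estimate yields
continuity at the origin. -/
theorem exists_H_le (hv : IsPolarField v k R Θ) (hR : 0 < R (S.m + S.τ * S.l))
    (hR' : R (S.m + S.τ * -S.l) < 0) : ∃ C, ∀ z, S.H z ≤ C * rad z := by
  obtain ⟨B₁, hB₁⟩ := W_bddBelow_right hv hR
  obtain ⟨B₂, hB₂⟩ := W_bddBelow_right (S := S.reverse) hv.neg (by simpa [reverse] using hR')
  refine ⟨Real.exp (-min B₁ B₂), fun z => ?_⟩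
  by_cases hz : z ∈ S.region
  · have hc := S.coord_mem hz
    have h1 : min B₁ B₂ ≤ S.W (S.coord z) := by
      rcases le_total 0 (S.coord z) with h | h
      · exact (min_le_left _ _).trans (hB₁ _ ⟨h, hc.2⟩)
      · have := hB₂ (-S.coord z) ⟨by linarith, by change _ < S.l; linarith [hc.1]⟩
        rw [reverse_W, neg_neg] at this
        exact (min_le_right _ _).trans this
    have h2 := rad_pos.2 hz.1
    rw [H_of_mem hz, L, sub_eq_add_neg, Real.exp_add, Real.exp_log h2, mul_comm]
    gcongr
  · rw [H_of_notMem hz]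
    exact mul_nonneg (Real.exp_pos _).le (rad_nonneg z)

/-- At a saddle end W → +∞ sends `L` to -∞ and exp L to 0, so the extension by zero is continuous
across the bounding ray. -/
theorem tendsto_H_of_coord (hv : IsPolarField v k R Θ) (hR : 0 < R (S.m + S.τ * S.l))
    {y : ℝ × ℝ} (hy : y ≠ 0) [(𝓝[S.region] y).NeBot] (hl : S.coord y = S.l) :
    Tendsto S.H (𝓝[S.region] y) (𝓝 0) := by
  have hu : Tendsto id (𝓝[S.region] y) (𝓝 y) := nhdsWithin_le_nhds
  have h1 := (W_right_pos hv hR).comp (tendsto_nhdsLT hy hu self_mem_nhdsWithin hl)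
  have h2 : Tendsto (fun z => Real.log (rad z)) (𝓝[S.region] y) (𝓝 (Real.log (rad y))) :=
    ((continuous_rad.tendsto y).log (rad_pos.2 hy).ne').mono_left nhdsWithin_le_nhds
  have h3 : Tendsto S.L (𝓝[S.region] y) atBot := by
    refine (h2.add_atBot (tendsto_neg_atTop_atBot.comp h1)).congr fun z => ?_
    rw [L, sub_eq_add_neg]
    rfl
  refine (Real.tendsto_exp_atBot.comp h3).congr' ?_
  filter_upwards [self_mem_nhdsWithin] with z hz using (H_of_mem hz).symm

/-- Between two saddle directions, the first integral is continuous on the plane. -/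
theorem continuous_H (hv : IsPolarField v k R Θ) (hR : 0 < R (S.m + S.τ * S.l))
    (hR' : R (S.m + S.τ * -S.l) < 0) : Continuous S.H := by
  refine continuous_iff_continuousAt.2 fun z => ?_
  by_cases hz : z ∈ S.region
  · refine (continuousAt_L hv hz).rexp.congr ?_
    filter_upwards [region_open.mem_nhds hz] with y hy using (H_of_mem hy).symm
  have hz' := H_of_notMem hz
  rw [ContinuousAt, hz']
  rcases eq_or_ne z 0 with rfl | h0
  · obtain ⟨C, hC⟩ := exists_H_le hv hR hR'
    refine squeeze_zero (fun z => ?_) hC ?_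
    · by_cases hz : z ∈ S.region
      · exact (H_pos.2 hz).le
      · exact (H_of_notMem hz).ge
    · have : Continuous fun z => C * rad z := by fun_prop
      simpa [rad_zero] using this.tendsto 0
  rw [← nhdsWithin_univ, ← union_compl_self S.region, nhdsWithin_union]
  refine Tendsto.sup ?_ (tendsto_const_nhds.congr' ?_)
  · rcases (𝓝[S.region] z).eq_or_neBot with hb | hb
    · rw [hb]
      exact tendsto_bot
    have h1 := (continuousAt_coord_of_tendsto h0
      (tendsto_id.mono_left nhdsWithin_le_nhds : Tendsto id (𝓝[S.region] z) (𝓝 z))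
      self_mem_nhdsWithin).2
    have h2 : |S.coord z| = S.l := by
      rw [S.abs_coord]
      exact h1.antisymm (not_lt.1 fun h => hz ⟨h0, h⟩)
    rcases eq_or_eq_neg_of_abs_eq h2 with h | h
    · exact tendsto_H_of_coord hv hR h0 h
    · have : (𝓝[S.reverse.region] z).NeBot := hb
      have := tendsto_H_of_coord (S := S.reverse) (y := z) hv.neg (by simpa [reverse] using hR') h0
        (by rw [reverse_coord, h, neg_neg]; rfl)
      simp only [reverse_region] at this
      exact this.congr reverse_H
  · filter_upwards [self_mem_nhdsWithin] with y hy using (H_of_notMem hy).symm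

end FlowSector

/-- A combination `A - (M + 2) cos B` with `A` negative at `0` and positive at `π` and `B > 0`
changes sign exactly once on `[0, π]` when `M` is large. -/
theorem exists_sign_change {A B : ℝ → ℝ} (hA : ContDiff ℝ 1 A) (hB : ContDiff ℝ 1 B)
    (hpos : ∀ φ ∈ Ioo 0 Real.pi, 0 < B φ) (hB0 : B 0 = 0) (hBπ : B Real.pi = 0) (hA0 : A 0 < 0)
    (hAπ : 0 < A Real.pi) : ∃ M : ℕ, ∃ φs ∈ Ioo 0 Real.pi,
      (∀ φ ∈ Ico 0 φs, A φ - (M + 2) * (Real.cos φ * B φ) < 0) ∧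
      (∀ φ ∈ Ioc φs Real.pi, 0 < A φ - (M + 2) * (Real.cos φ * B φ)) ∧
      A φs - (M + 2) * (Real.cos φs * B φs) = 0 := by
  have hπ := Real.pi_pos
  have hB' : ∀ φ ∈ Icc 0 Real.pi, 0 ≤ B φ := fun φ hφ => by
    rcases hφ.1.eq_or_lt with h | h
    · rw [← h, hB0]
    rcases hφ.2.eq_or_lt with h' | h'
    · rw [h', hBπ]
    exact (hpos φ ⟨h, h'⟩).le
  obtain ⟨d₁, hd₁, h1⟩ := Metric.eventually_nhds_iff_ball.1
    (hA.continuous.continuousAt.eventually_lt_const hA0)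
  obtain ⟨d₂, hd₂, h2⟩ := Metric.eventually_nhds_iff_ball.1
    (hA.continuous.continuousAt.eventually_const_lt hAπ)
  -- Within `δ` of 0 or π, the sign of A is known and -cos has the same sign or vanishes; as B ≥ 0,
  -- the combination has the sign of A there for every M.
  set δ := min (min d₁ d₂) (Real.pi / 2) / 2 with hδ
  have hδ0 : 0 < δ := by positivity
  have hδ1 : δ < d₁ := by
    have : min (min d₁ d₂) (Real.pi / 2) ≤ d₁ := (min_le_left _ _).trans (min_le_left _ _)
    linarith
  have hδ2 : δ < d₂ := by
    have : min (min d₁ d₂) (Real.pi / 2) ≤ d₂ := (min_le_left _ _).trans (min_le_right _ _)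
    linarith
  have hδ3 : δ < Real.pi / 2 := by
    have : min (min d₁ d₂) (Real.pi / 2) ≤ Real.pi / 2 := min_le_right _ _
    linarith
  have hsub : Icc δ (Real.pi - δ) ⊆ Ioo 0 Real.pi := fun x hx =>
    ⟨hδ0.trans_le hx.1, by linarith [hx.2]⟩
  have hdA := fun x => (hA.differentiable one_ne_zero x).hasDerivAt
  have hdB := fun x => (hB.differentiable one_ne_zero x).hasDerivAt
  have hcA : Continuous (deriv A) := hA.continuous_deriv le_rfl
  have hcB : Continuous (deriv B) := hB.continuous_deriv le_rfl
  have hcont : ContinuousOn (fun x => (deriv A x * B x - A x * deriv B x) / B x ^ 2)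
      (Icc δ (Real.pi - δ)) :=
    ((hcA.mul hB.continuous).sub (hA.continuous.mul hcB)).continuousOn.div
      (hB.continuous.pow 2).continuousOn fun x hx => (pow_pos (hpos x (hsub hx)) 2).ne'
  obtain ⟨D, hD⟩ := isCompact_Icc.bddBelow_image hcont
  have hsδ : 0 < Real.sin δ := Real.sin_pos_of_pos_of_lt_pi hδ0 (by linarith)
  -- On [δ, π - δ] division by B leaves A/B - (M + 2) cos. Its derivative is at least D + (M + 2)
  -- sin δ, which is positive for this M, so there is only one zero.
  obtain ⟨M, hM⟩ := exists_nat_gt (-D / Real.sin δ)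
  rw [div_lt_iff₀ hsδ] at hM
  set K : ℝ → ℝ := fun x => A x / B x - (M + 2) * Real.cos x with hK
  have hKd : ∀ x ∈ Icc δ (Real.pi - δ), HasDerivAt K
      ((deriv A x * B x - A x * deriv B x) / B x ^ 2 + (M + 2) * Real.sin x) x := fun x hx => by
    have := ((hdA x).div (hdB x) (hpos x (hsub hx)).ne').sub
      ((Real.hasDerivAt_cos x).const_mul ((M : ℝ) + 2))
    exact this.congr_deriv (by ring)
  have hsin : ∀ x ∈ Icc δ (Real.pi - δ), Real.sin δ ≤ Real.sin x := fun x hx => by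
    rcases le_total x (Real.pi / 2) with h | h
    · exact Real.sin_le_sin_of_le_of_le_pi_div_two (by linarith) h hx.1
    · rw [← Real.sin_pi_sub x]
      exact Real.sin_le_sin_of_le_of_le_pi_div_two (by linarith) (by linarith) (by linarith [hx.2])
  have hKc : ContinuousOn K (Icc δ (Real.pi - δ)) := fun x hx =>
    (hKd x hx).continuousAt.continuousWithinAt
  have hmono : StrictMonoOn K (Icc δ (Real.pi - δ)) := by
    refine strictMonoOn_of_deriv_pos (convex_Icc _ _) hKc fun x hx => ?_
    have hx := interior_subset hx
    rw [(hKd x hx).deriv]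
    have h3 := hD (mem_image_of_mem _ hx)
    have h4 := mul_le_mul_of_nonneg_left (hsin x hx) (by positivity : (0 : ℝ) ≤ M + 2)
    nlinarith
  have hGK : ∀ x ∈ Icc δ (Real.pi - δ), A x - (M + 2) * (Real.cos x * B x) = K x * B x := fun x hx => by
    have := (hpos x (hsub hx)).ne'
    rw [hK]
    field_simp
  have hleft : ∀ x ∈ Icc 0 δ, A x - (M + 2) * (Real.cos x * B x) < 0 := fun x hx => by
    have h3 := h1 x (by rw [Metric.mem_ball, Real.dist_eq, sub_zero, abs_of_nonneg hx.1]; linarith [hx.2])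
    have h4 := mul_nonneg (by positivity : (0 : ℝ) ≤ M + 2)
      (mul_nonneg (Real.cos_nonneg_of_mem_Icc (x := x) ⟨by linarith [hx.1], by linarith [hx.2]⟩)
        (hB' x ⟨hx.1, by linarith [hx.2]⟩))
    linarith
  have hright : ∀ x ∈ Icc (Real.pi - δ) Real.pi, 0 < A x - (M + 2) * (Real.cos x * B x) := fun x hx => by
    have h3 := h2 x (by
      rw [Metric.mem_ball, Real.dist_eq, abs_sub_comm, abs_of_nonneg (by linarith [hx.2])]
      linarith [hx.1])
    have h4 := mul_nonneg (by positivity : (0 : ℝ) ≤ M + 2)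
      (mul_nonneg (neg_nonneg.2 (Real.cos_nonpos_of_pi_div_two_le_of_le (x := x)
        (by linarith [hx.1]) (by linarith [hx.2]))) (hB' x ⟨by linarith [hx.1], hx.2⟩))
    linarith
  have hlM : δ ≤ Real.pi - δ := by linarith
  have hKl : K δ < 0 := by
    have h3 := hleft δ ⟨hδ0.le, le_rfl⟩
    rw [hGK δ ⟨le_rfl, hlM⟩] at h3
    exact neg_of_mul_neg_left h3 (hpos δ (hsub ⟨le_rfl, hlM⟩)).le
  have hKr : 0 < K (Real.pi - δ) := by
    have h3 := hright (Real.pi - δ) ⟨le_rfl, by linarith⟩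
    rw [hGK _ ⟨hlM, le_rfl⟩] at h3
    exact pos_of_mul_pos_left h3 (hpos _ (hsub ⟨hlM, le_rfl⟩)).le
  obtain ⟨φs, hφs, h0⟩ := intermediate_value_Icc hlM hKc ⟨hKl.le, hKr.le⟩
  refine ⟨M, φs, hsub hφs, fun x hx => ?_, fun x hx => ?_, by rw [hGK _ hφs, h0, zero_mul]⟩
  · rcases le_or_gt x δ with h | h
    · exact hleft x ⟨hx.1, h⟩
    · have hx' : x ∈ Icc δ (Real.pi - δ) := ⟨h.le, hx.2.le.trans hφs.2⟩
      rw [hGK x hx']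
      exact mul_neg_of_neg_of_pos (h0 ▸ hmono hx' hφs hx.2) (hpos x (hsub hx'))
  · rcases le_or_gt (Real.pi - δ) x with h | h
    · exact hright x ⟨h, hx.2⟩
    · have hx' : x ∈ Icc δ (Real.pi - δ) := ⟨hφs.1.trans hx.1.le, h.le⟩
      rw [hGK x hx']
      exact mul_pos (h0 ▸ hmono hφs hx' hx.1) (hpos x (hsub hx'))

/-- Two compact sets on which a continuous function is injective with the same image are
homeomorphic. -/
theorem exists_homeomorph_of_image_eq {A B : Set (ℝ × ℝ)} {f : ℝ × ℝ → ℝ} (hf : Continuous f)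
    (hA : IsCompact A) (hB : IsCompact B) (hfA : InjOn f A) (hfB : InjOn f B)
    (himg : f '' A = f '' B) : ∃ e : A ≃ₜ B, ∀ x : A, f (e x) = f x := by
  have key : ∀ {C : Set (ℝ × ℝ)}, IsCompact C → InjOn f C →
      ∃ e : C ≃ₜ f '' C, ∀ x : C, (e x : ℝ) = f x := fun {C} hC hfC => by
    have := isCompact_iff_compactSpace.1 hC
    exact ⟨Continuous.homeoOfEquivCompactToT2 (f := Equiv.Set.imageOfInjOn f C hfC)
      (by
        refine Continuous.subtype_mk (f := fun x : C => f x) ?_ _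
        exact hf.comp continuous_subtype_val), fun x => rfl⟩
  obtain ⟨e₁, h1⟩ := key hA hfA
  obtain ⟨e₂, h2⟩ := key hB hfB
  refine ⟨e₁.trans ((Homeomorph.setCongr himg).trans e₂.symm), fun x => ?_⟩
  have h3 := h2 (e₂.symm (Homeomorph.setCongr himg (e₁ x)))
  rw [Homeomorph.apply_symm_apply] at h3
  simp only [Homeomorph.trans_apply]
  rw [← h3, ← h1 x]
  rfl

namespace IsDefiningFunctionAt

variable {N : Set (ℝ × ℝ)} {x w : ℝ × ℝ} {f g : ℝ × ℝ → ℝ}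

/-- Both functions describe the same side: a line entering `N` for f cannot leave it for g. Equality
dg(w) = 0 is excluded by perturbing w, as df(w) < 0 is an open condition and dg ≠ 0. -/
theorem neg_of_neg (hf : IsDefiningFunctionAt N x f) (hg : IsDefiningFunctionAt N x g)
    (hw : fderiv ℝ f x w < 0) : fderiv ℝ g x w < 0 := by
  have key : ∀ u, fderiv ℝ f x u < 0 → fderiv ℝ g x u ≤ 0 := fun u hu => by
    by_contra hcon
    have hd : HasDerivAt (fun t : ℝ => x + t • u) u 0 := by
      simpa using ((hasDerivAt_id (0 : ℝ)).smul_const u).const_add x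
    have h1 := (hf.eventually_of_neg (by simp) hd hu).1
    have hd' : HasDerivAt (fun t : ℝ => x + t • -u) (-u) 0 := by
      simpa using ((hasDerivAt_id (0 : ℝ)).smul_const (-u)).const_add x
    have h2 := (hg.eventually_of_neg (by simp) hd' (by simpa using hcon)).2
    have h3 : ∀ᶠ t in 𝓝[>] (0 : ℝ), x + t • u ∉ N := by
      have : map (fun t : ℝ => -t) (𝓝[>] 0) = 𝓝[<] 0 := by simp
      rw [← this, eventually_map] at h2
      filter_upwards [h2] with t ht
      simpa using ht
    obtain ⟨t, ht, ht'⟩ := (h1.and h3).exists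
    exact ht' ht
  refine lt_of_le_of_ne (key w hw) fun h0 => ?_
  obtain ⟨u, hu⟩ : ∃ u, fderiv ℝ g x u ≠ 0 := by
    by_contra hcon
    push Not at hcon
    exact hg.2.2.1 (ContinuousLinearMap.ext hcon)
  have h1 : ∀ᶠ s in 𝓝 (0 : ℝ), fderiv ℝ f x (w + (s * fderiv ℝ g x u) • u) < 0 := by
    have hc : Continuous fun s : ℝ => fderiv ℝ f x (w + (s * fderiv ℝ g x u) • u) := by fun_prop
    exact (hc.tendsto 0).eventually_lt_const (by simpa using hw)
  obtain ⟨s, hs, hs'⟩ := ((h1.filter_mono nhdsWithin_le_nhds).and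
    (self_mem_nhdsWithin : ∀ᶠ s in 𝓝[>] (0 : ℝ), s ∈ Ioi 0)).exists
  have h2 := key _ hs
  rw [map_add, map_smul, h0, zero_add, smul_eq_mul, mul_assoc] at h2
  exact absurd h2 (not_le.2 (mul_pos hs' (mul_self_pos.2 hu)))

/-- The tangency condition does not depend on the defining function. -/
theorem ne_zero_of_ne_zero (hf : IsDefiningFunctionAt N x f) (hg : IsDefiningFunctionAt N x g)
    (hw : fderiv ℝ f x w ≠ 0) : fderiv ℝ g x w ≠ 0 := by
  rcases lt_or_gt_of_ne hw with h | h
  · exact (hf.neg_of_neg hg h).ne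
  · have := hf.neg_of_neg hg (w := -w) (by simpa using h)
    simp only [map_neg, neg_lt_zero] at this
    exact this.ne'

end IsDefiningFunctionAt

end PlanarReg

namespace PlanarReg

variable {v : ℝ × ℝ → ℝ × ℝ} {k : ℕ} {R Θ : ℝ → ℝ}

/-! ### The isolating block -/

/-- The polynomial that defines the block. -/
noncomputable def blockFun (θ₀ : ℝ) (M : ℕ) (z : ℝ × ℝ) : ℝ :=
  (z.1 ^ 2 + z.2 ^ 2 + (z.1 * Real.cos θ₀ + z.2 * Real.sin θ₀) ^ 2) ^ (M + 2) -
    (z.1 ^ 2 + z.2 ^ 2) ^ (M + 1)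

/-- The block. -/
def blockSet (θ₀ : ℝ) (M : ℕ) : Set (ℝ × ℝ) := {z | blockFun θ₀ M z ≤ 0}

/-- The radius of the block in the direction `θ`. -/
noncomputable def blockRad (θ₀ : ℝ) (M : ℕ) (θ : ℝ) : ℝ :=
  (√(1 + Real.cos (θ - θ₀) ^ 2))⁻¹ ^ (M + 2)

/-- The boundary curve of the block. -/
noncomputable def blockCurve (θ₀ : ℝ) (M : ℕ) (θ : ℝ) : ℝ × ℝ := pt (blockRad θ₀ M θ) θ

/-- The function whose sign tells whether the boundary is crossed inwards or outwards. -/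
noncomputable def crossing (R Θ : ℝ → ℝ) (θ₀ : ℝ) (M : ℕ) (θ : ℝ) : ℝ :=
  R θ * (1 + Real.cos (θ - θ₀) ^ 2) -
    (M + 2) * (Real.cos (θ - θ₀) * (Real.sin (θ - θ₀) * Θ θ))

variable {θ₀ : ℝ} {M : ℕ}

@[fun_prop]
theorem contDiff_blockFun : ContDiff ℝ (⊤ : ℕ∞) (blockFun θ₀ M) := by
  unfold blockFun
  fun_prop

theorem blockRad_pos (θ : ℝ) : 0 < blockRad θ₀ M θ := by
  unfold blockRad
  positivity

theorem blockRad_sq (θ : ℝ) :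
    blockRad θ₀ M θ ^ 2 * (1 + Real.cos (θ - θ₀) ^ 2) ^ (M + 2) = 1 := by
  have h : 0 < 1 + Real.cos (θ - θ₀) ^ 2 := by positivity
  rw [blockRad, ← pow_mul, mul_comm (M + 2) 2, pow_mul, inv_pow, Real.sq_sqrt h.le, ← mul_pow,
    inv_mul_cancel₀ h.ne', one_pow]

theorem log_blockRad (θ : ℝ) :
    Real.log (blockRad θ₀ M θ) = -((M + 2) / 2 * Real.log (1 + Real.cos (θ - θ₀) ^ 2)) := by
  rw [blockRad, Real.log_pow, Real.log_inv, Real.log_sqrt (by positivity)]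
  push_cast
  ring

theorem blockRad_add_pi (θ : ℝ) : blockRad θ₀ M (θ + Real.pi) = blockRad θ₀ M θ := by
  rw [blockRad, blockRad, add_sub_right_comm, Real.cos_add_pi, neg_sq]

theorem blockCurve_add_two_pi (θ : ℝ) :
    blockCurve θ₀ M (θ + 2 * Real.pi) = blockCurve θ₀ M θ := by
  rw [blockCurve, pt_add_two_pi, two_mul, ← add_assoc, blockRad_add_pi, blockRad_add_pi]
  rfl

theorem blockCurve_ne_zero (θ : ℝ) : blockCurve θ₀ M θ ≠ 0 := pt_ne_zero (blockRad_pos θ) θ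

theorem hasDerivAt_log_blockRad (θ : ℝ) :
    HasDerivAt (fun θ => Real.log (blockRad θ₀ M θ))
      ((M + 2) * (Real.cos (θ - θ₀) * Real.sin (θ - θ₀)) / (1 + Real.cos (θ - θ₀) ^ 2)) θ := by
  have h : 1 + Real.cos (θ - θ₀) ^ 2 ≠ 0 := by positivity
  have h1 := ((((hasDerivAt_id θ).sub_const θ₀).cos.pow 2).const_add 1).log h
  simp only [log_blockRad]
  refine (h1.const_mul (((M : ℝ) + 2) / 2)).neg.congr_deriv ?_
  simp only [id, Pi.pow_apply]
  push_cast
  field_simp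

theorem continuous_blockRad : Continuous (blockRad θ₀ M) := by
  unfold blockRad
  exact ((Real.continuous_sqrt.comp (by fun_prop)).inv₀ fun θ => by
    have : 0 < 1 + Real.cos (θ - θ₀) ^ 2 := by positivity
    exact (Real.sqrt_pos.2 this).ne').pow _

theorem continuous_blockCurve : Continuous (blockCurve θ₀ M) :=
  continuous_pt.comp (continuous_blockRad.prodMk continuous_id)

theorem pt_sq (r θ : ℝ) : (pt r θ).1 ^ 2 + (pt r θ).2 ^ 2 = r ^ 2 := by
  simp only [pt]
  linear_combination r ^ 2 * Real.cos_sq_add_sin_sq θ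

theorem pt_dot (r θ : ℝ) :
    (pt r θ).1 * Real.cos θ₀ + (pt r θ).2 * Real.sin θ₀ = r * Real.cos (θ - θ₀) := by
  rw [pt, Real.cos_sub]
  ring

/-- The block condition is r² (1 + cos²)^(M+2) ≤ 1; the factor r^(2M+2) clears its denominators and
makes the defining function a polynomial. -/
theorem blockFun_pt (r θ : ℝ) : blockFun θ₀ M (pt r θ) =
    (r ^ 2) ^ (M + 1) * (r ^ 2 * (1 + Real.cos (θ - θ₀) ^ 2) ^ (M + 2) - 1) := by
  have h : r ^ 2 + (r * Real.cos (θ - θ₀)) ^ 2 = r ^ 2 * (1 + Real.cos (θ - θ₀) ^ 2) := by ring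
  rw [blockFun, pt_sq, pt_dot, h, mul_pow]
  ring

theorem pt_mem_blockSet {r : ℝ} (hr : 0 < r) (θ : ℝ) :
    pt r θ ∈ blockSet θ₀ M ↔ r ≤ blockRad θ₀ M θ := by
  have hw : 0 < (1 + Real.cos (θ - θ₀) ^ 2) ^ (M + 2) := by positivity
  change blockFun θ₀ M _ ≤ 0 ↔ _
  have h2 : 0 < (r ^ 2) ^ (M + 1) := by positivity
  rw [blockFun_pt, ← not_lt, mul_pos_iff_of_pos_left h2, not_lt, sub_nonpos]
  have hsq := blockRad_sq (θ₀ := θ₀) (M := M) θ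
  generalize (1 + Real.cos (θ - θ₀) ^ 2) ^ (M + 2) = w at hw hsq ⊢
  rw [← hsq, mul_le_mul_iff_left₀ hw,
    pow_le_pow_iff_left₀ hr.le (blockRad_pos θ).le two_ne_zero]

theorem mem_blockSet {z : ℝ × ℝ} (hz : z ≠ 0) (m : ℝ) :
    z ∈ blockSet θ₀ M ↔ rad z ≤ blockRad θ₀ M (m + ang m z) := by
  rw [← pt_mem_blockSet (rad_pos.2 hz), pt_rad_ang]

theorem blockFun_blockCurve (θ : ℝ) : blockFun θ₀ M (blockCurve θ₀ M θ) = 0 := by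
  rw [blockCurve, blockFun_pt, blockRad_sq, sub_self, mul_zero]

theorem rad_le_one_of_mem_blockSet {z : ℝ × ℝ} (hz : z ∈ blockSet θ₀ M) : rad z ≤ 1 := by
  rcases eq_or_ne z 0 with rfl | h0
  · rw [rad_zero]
    exact zero_le_one
  refine ((mem_blockSet h0 0).1 hz).trans ?_
  refine pow_le_one₀ (by positivity) (inv_le_one_of_one_le₀ ?_)
  rw [Real.one_le_sqrt]
  linarith [sq_nonneg (Real.cos (0 + ang 0 z - θ₀))]

theorem isCompact_blockSet : IsCompact (blockSet θ₀ M) := by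
  have h1 : IsClosed (blockSet θ₀ M) :=
    isClosed_le contDiff_blockFun.continuous continuous_const
  refine IsCompact.of_isClosed_subset
    (toC.symm.toHomeomorph.isCompact_image.2 (isCompact_closedBall (0 : ℂ) 1)) h1 fun z hz => ?_
  refine ⟨toC z, ?_, toC.symm_apply_apply z⟩
  simpa [rad] using rad_le_one_of_mem_blockSet hz

theorem zero_mem_interior_blockSet : (0 : ℝ × ℝ) ∈ interior (blockSet θ₀ M) := by
  rw [mem_interior_iff_mem_nhds]
  have h1 : (0 : ℝ) < (√2)⁻¹ ^ (M + 2) := by positivity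
  filter_upwards [continuous_rad.continuousAt.eventually_lt_const (by rwa [rad_zero])] with z hz
  rcases eq_or_ne z 0 with rfl | h0
  · simp [blockSet, blockFun]
  refine (mem_blockSet h0 0).2 (hz.le.trans ?_)
  unfold blockRad
  gcongr
  have := Real.cos_sq_le_one (0 + ang 0 z - θ₀)
  linarith

theorem frontier_blockSet : frontier (blockSet θ₀ M) = range (blockCurve θ₀ M) := by
  have hcl : IsClosed (blockSet θ₀ M) := isCompact_blockSet.isClosed
  rw [hcl.frontier_eq]
  apply Subset.antisymm
  · rintro z ⟨hz, hz'⟩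
    have h0 : z ≠ 0 := fun h => hz' (h ▸ zero_mem_interior_blockSet)
    have h1 : blockFun θ₀ M z = 0 := by
      by_contra hne
      refine hz' (mem_interior_iff_mem_nhds.2 ?_)
      filter_upwards [contDiff_blockFun.continuous.continuousAt.eventually_lt_const
        (lt_of_le_of_ne hz hne)] with y hy using hy.le
    refine ⟨0 + ang 0 z, ?_⟩
    have h2 := rad_pos.2 h0
    have h3 : (rad z ^ 2) ^ (M + 1) ≠ 0 := (pow_pos (pow_pos h2 2) _).ne'
    rw [← pt_rad_ang 0 z, blockFun_pt, mul_eq_zero, or_iff_right h3, sub_eq_zero] at h1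
    have h3 := mul_right_cancel₀ (by positivity)
      (h1.trans (blockRad_sq (θ₀ := θ₀) (M := M) (0 + ang 0 z)).symm)
    rw [pow_left_inj₀ h2.le (blockRad_pos _).le two_ne_zero] at h3
    rw [blockCurve, ← h3, pt_rad_ang]
  · rintro _ ⟨θ, rfl⟩
    refine ⟨(blockFun_blockCurve θ).le, fun hint => ?_⟩
    have hc : Continuous fun r => pt r θ := by fun_prop
    have h1 : ∀ᶠ r in 𝓝 (blockRad θ₀ M θ), pt r θ ∈ blockSet θ₀ M :=
      hc.continuousAt.eventually_mem (mem_interior_iff_mem_nhds.1 hint)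
    obtain ⟨r, hr, hr'⟩ := ((h1.filter_mono nhdsWithin_le_nhds).and
      (self_mem_nhdsWithin : ∀ᶠ r in 𝓝[>] (blockRad θ₀ M θ), r ∈ Ioi _)).exists
    change _ < r at hr'
    rw [pt_mem_blockSet ((blockRad_pos θ).trans hr')] at hr
    linarith

theorem fderiv_blockFun (z w : ℝ × ℝ) : fderiv ℝ (blockFun θ₀ M) z w =
    (M + 2) * (z.1 ^ 2 + z.2 ^ 2 + (z.1 * Real.cos θ₀ + z.2 * Real.sin θ₀) ^ 2) ^ (M + 1) *
      (2 * (z.1 * w.1 + z.2 * w.2) + 2 * (z.1 * Real.cos θ₀ + z.2 * Real.sin θ₀) *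
        (w.1 * Real.cos θ₀ + w.2 * Real.sin θ₀)) -
    (M + 1) * (z.1 ^ 2 + z.2 ^ 2) ^ M * (2 * (z.1 * w.1 + z.2 * w.2)) := by
  have h1 : HasDerivAt (fun t : ℝ => z + t • w) w 0 := by
    simpa using ((hasDerivAt_id (0 : ℝ)).smul_const w).const_add z
  have h2 := ((contDiff_blockFun (θ₀ := θ₀) (M := M)).differentiable
    (by simp) (z + (0 : ℝ) • w)).hasFDerivAt.comp_hasDerivAt 0 h1
  rw [zero_smul, add_zero] at h2
  have ha : HasDerivAt (fun t : ℝ => z.1 + t * w.1) w.1 0 := by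
    simpa using ((hasDerivAt_id (0 : ℝ)).mul_const w.1).const_add z.1
  have hb : HasDerivAt (fun t : ℝ => z.2 + t * w.2) w.2 0 := by
    simpa using ((hasDerivAt_id (0 : ℝ)).mul_const w.2).const_add z.2
  have hq := (ha.pow 2).add (hb.pow 2)
  have hl := (ha.mul_const (Real.cos θ₀)).add (hb.mul_const (Real.sin θ₀))
  have h3 := ((hq.add (hl.pow 2)).pow (M + 2)).sub (hq.pow (M + 1))
  refine (h2.unique (h3.congr_of_eventuallyEq (Eventually.of_forall fun t => ?_))).trans ?_
  · simp [blockFun]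
  · simp
    ring

theorem isDefiningFunctionAt_blockFun (θ : ℝ) :
    IsDefiningFunctionAt (blockSet θ₀ M) (blockCurve θ₀ M θ) (blockFun θ₀ M) := by
  refine ⟨contDiff_blockFun, blockFun_blockCurve θ, fun h => ?_, Eventually.of_forall fun z => Iff.rfl⟩
  set z := blockCurve θ₀ M θ with hz
  -- Euler's relation: the two terms are homogeneous of degrees 2M + 4 and 2M + 2 and agree on the
  -- boundary, so the derivative along z is 2 |z|^(2M+2).
  have h1 := fderiv_blockFun (θ₀ := θ₀) (M := M) z z
  rw [h, zero_apply] at h1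
  have h2 := blockFun_blockCurve (θ₀ := θ₀) (M := M) θ
  rw [← hz, blockFun] at h2
  have h3 : 0 < (z.1 ^ 2 + z.2 ^ 2) ^ (M + 1) := by
    have := blockRad_pos (θ₀ := θ₀) (M := M) θ
    rw [hz, blockCurve, pt_sq]
    positivity
  have h4 : (0 : ℝ) = 2 * (z.1 ^ 2 + z.2 ^ 2) ^ (M + 1) := by
    linear_combination h1 + 2 * ((M : ℝ) + 2) * h2
  linarith

theorem fderiv_blockFun_blockCurve (hv : IsPolarField v k R Θ) (θ : ℝ) :
    fderiv ℝ (blockFun θ₀ M) (blockCurve θ₀ M θ) (v (blockCurve θ₀ M θ)) =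
      2 * blockRad θ₀ M θ ^ (2 * M + k + 2) / (1 + Real.cos (θ - θ₀) ^ 2) *
        crossing R Θ θ₀ M θ := by
  have hsq := blockRad_sq (θ₀ := θ₀) (M := M) θ
  have hsc : ∀ r s, (pt r θ).1 * (pt s θ).1 + (pt r θ).2 * (pt s θ).2 = r * s := fun r s => by
    simp only [pt]
    linear_combination r * s * Real.cos_sq_add_sin_sq θ
  have hsp : ∀ r s, (pt r θ).1 * (pt s (θ + Real.pi / 2)).1 +
      (pt r θ).2 * (pt s (θ + Real.pi / 2)).2 = 0 := fun r s => by
    simp only [pt, Real.cos_add_pi_div_two, Real.sin_add_pi_div_two]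
    ring
  rw [fderiv_blockFun, blockCurve, pt_sq, pt_dot, hv.apply_pt]
  set r := blockRad θ₀ M θ with hr
  have hr0 : 0 < r := blockRad_pos θ
  have hd : ∀ a b : ℝ, (pt r θ).1 * (pt a θ + pt b (θ + Real.pi / 2)).1 +
      (pt r θ).2 * (pt a θ + pt b (θ + Real.pi / 2)).2 = r * a := fun a b => by
    rw [Prod.fst_add, Prod.snd_add]
    linear_combination hsc r a + hsp r b
  have hl : ∀ a b : ℝ, (pt a θ + pt b (θ + Real.pi / 2)).1 * Real.cos θ₀ +
      (pt a θ + pt b (θ + Real.pi / 2)).2 * Real.sin θ₀ =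
      a * Real.cos (θ - θ₀) - b * Real.sin (θ - θ₀) := fun a b => by
    have h1 := pt_dot (θ₀ := θ₀) b (θ + Real.pi / 2)
    rw [add_sub_right_comm, Real.cos_add_pi_div_two] at h1
    rw [Prod.fst_add, Prod.snd_add]
    linear_combination pt_dot (θ₀ := θ₀) a θ + h1
  rw [hd, hl, crossing]
  set c := Real.cos (θ - θ₀)
  set s := Real.sin (θ - θ₀)
  have hw : 0 < 1 + c ^ 2 := by positivity
  have h1 : r ^ 2 + (r * c) ^ 2 = r ^ 2 * (1 + c ^ 2) := by ring
  rw [h1, mul_pow, eq_comm, div_mul_eq_mul_div, div_eq_iff hw.ne']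
  have e2 : (r ^ 2) ^ (M + 1) * (1 + c ^ 2) ^ (M + 1) * (1 + c ^ 2) = (r ^ 2) ^ M := by
    linear_combination (r ^ 2) ^ M * hsq
  linear_combination -((M + 2) * 2 * r ^ (k + 2) * (R θ * (1 + c ^ 2) - Θ θ * s * c)) * e2

theorem eventually_pos_of_mul_deriv_pos {u d : ℝ → ℝ} (hu : ∀ᶠ t in 𝓝 (0 : ℝ), HasDerivAt u (d t) t)
    (hd : ∀ᶠ t in 𝓝[≠] (0 : ℝ), 0 < t * d t) (h0 : u 0 = 0) : ∀ᶠ t in 𝓝[≠] (0 : ℝ), 0 < u t := by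
  rw [eventually_nhdsWithin_iff] at hd ⊢
  obtain ⟨ε, hε, h⟩ := Metric.eventually_nhds_iff_ball.1 (hu.and hd)
  rw [Real.ball_eq_Ioo, zero_sub, zero_add] at h
  filter_upwards [Ioo_mem_nhds (neg_lt_zero.2 hε) hε] with t ht ht0
  rcases lt_or_gt_of_ne ht0 with hlt | hlt
  · obtain ⟨s, hs, hs'⟩ := exists_hasDerivAt_eq_slope u d hlt
      (fun s hs => (h s ⟨ht.1.trans_le hs.1, hs.2.trans_lt hε⟩).1.continuousAt.continuousWithinAt)
      fun s hs => (h s ⟨ht.1.trans hs.1, hs.2.trans hε⟩).1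
    have h1 := (h s ⟨ht.1.trans hs.1, hs.2.trans hε⟩).2 hs.2.ne
    rw [hs', h0, zero_sub, zero_sub, div_neg, neg_div, neg_neg] at h1
    have h2 := neg_of_mul_pos_right h1 hs.2.le
    by_contra hcon
    exact absurd h2 (not_lt.2 (div_nonneg_of_nonpos (not_lt.1 hcon) hlt.le))
  · obtain ⟨s, hs, hs'⟩ := exists_hasDerivAt_eq_slope u d hlt
      (fun s hs => (h s ⟨(neg_lt_zero.2 hε).trans_le hs.1, hs.2.trans_lt ht.2⟩).1.continuousAt.continuousWithinAt)
      fun s hs => (h s ⟨(neg_lt_zero.2 hε).trans hs.1, hs.2.trans ht.2⟩).1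
    have h1 := (h s ⟨(neg_lt_zero.2 hε).trans hs.1, hs.2.trans ht.2⟩).2 hs.1.ne'
    rw [hs', h0, sub_zero, sub_zero] at h1
    by_contra hcon
    exact absurd (pos_of_mul_pos_right h1 hs.1.le) (not_lt.2 (div_nonpos_of_nonpos_of_nonneg (not_lt.1 hcon) hlt.le))

/-- At a tangency the orbit runs outside of the block on both sides. -/
theorem eventually_notMem_of_crossing (hv : IsPolarField v k R Θ) {χ : ℝ × ℝ → ℝ}
    {Γ : ℝ → ℝ × ℝ → ℝ × ℝ} {U : Set (ℝ × ℝ)} (h : IsAdaptedFlow v χ Γ (blockSet θ₀ M) U) {θ : ℝ}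
    (hθ : ∀ᶠ a in 𝓝[≠] (0 : ℝ), 0 < Θ θ * (a * crossing R Θ θ₀ M (θ + a))) :
    ∀ᶠ t in 𝓝[≠] (0 : ℝ), Γ t (blockCurve θ₀ M θ) ∉ blockSet θ₀ M := by
  set x := blockCurve θ₀ M θ with hx
  set ψ : ℝ → ℝ := fun t => ang θ (Γ t x) with hψ
  have hxN : x ∈ blockSet θ₀ M := (blockFun_blockCurve θ).le
  have hne : ∀ t, Γ t x ≠ 0 := fun t => h.ne_of_zero hv.apply_zero (blockCurve_ne_zero θ) t
  have hpt : ∀ t, Γ t x = pt (rad (Γ t x)) (θ + ψ t) := fun t => (pt_rad_ang θ _).symm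
  have hψ0 : ψ 0 = 0 := by
    have := ang_pt (blockRad_pos (θ₀ := θ₀) (M := M) θ) (m := θ) (a := 0)
      ⟨neg_lt_zero.2 Real.pi_pos, Real.pi_pos.le⟩
    rw [add_zero] at this
    rw [hψ]
    simp only [h.zero]
    exact this
  have hψc : ContinuousAt ψ 0 := by
    refine ContinuousAt.comp (f := fun t => Γ t x) (continuousAt_ang (hne 0) ?_)
      (h.continuous x).continuousAt
    rw [show ang θ (Γ 0 x) = 0 from hψ0]
    exact Real.pi_pos.ne
  have hψπ : ∀ᶠ t in 𝓝 0, ψ t < Real.pi := hψc.eventually_lt_const (by rw [hψ0]; exact Real.pi_pos)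
  have hψd : ∀ᶠ t in 𝓝 0, HasDerivAt ψ (χ (Γ t x) * (rad (Γ t x) ^ k * Θ (θ + ψ t))) t := by
    filter_upwards [hψπ] with t ht
    exact hv.hasDerivAt_ang (h.hasDerivAt x t) (rad_pos.2 (hne t)) (hpt t) ht.ne
  obtain ⟨ε, hε, hχ⟩ := h.exists_Ioo hxN
  have hχ' : ∀ᶠ t in 𝓝 (0 : ℝ), χ (Γ t x) = 1 := by
    filter_upwards [Ioo_mem_nhds (neg_lt_zero.2 hε) hε] with t ht using hχ t ht
  have hΘ : Θ θ ≠ 0 := fun h0 => by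
    obtain ⟨a, ha⟩ := hθ.exists
    rw [h0, zero_mul] at ha
    exact ha.false
  have hslope : ∀ᶠ t in 𝓝[≠] (0 : ℝ), 0 < Θ θ * ψ t / t := by
    have h1 := (hasDerivAt_iff_tendsto_slope.1 hψd.self_of_nhds).const_mul (Θ θ)
    have h2 : 0 < Θ θ * (χ (Γ 0 x) * (rad (Γ 0 x) ^ k * Θ (θ + ψ 0))) := by
      rw [hχ'.self_of_nhds, hψ0, add_zero, one_mul, mul_left_comm]
      exact mul_pos (pow_pos (rad_pos.2 (hne 0)) k) (mul_self_pos.2 hΘ)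
    filter_upwards [h1.eventually_const_lt h2] with t ht
    rwa [slope_def_field, hψ0, sub_zero, sub_zero, ← mul_div_assoc] at ht
  -- The angular displacement `ψ t` has the sign of `Θ θ * t`, so the hypothesis at `a = ψ t`
  -- becomes a sign condition in t.
  have hcross : ∀ᶠ t in 𝓝[≠] (0 : ℝ), 0 < t * crossing R Θ θ₀ M (θ + ψ t) := by
    have h1 : Tendsto ψ (𝓝[≠] 0) (𝓝[≠] 0) := by
      refine tendsto_nhdsWithin_iff.2 ⟨?_, ?_⟩
      · have := hψc.tendsto
        rw [hψ0] at this
        exact this.mono_left nhdsWithin_le_nhds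
      · filter_upwards [hslope] with t ht h0
        rw [h0, mul_zero, zero_div] at ht
        exact ht.false
    filter_upwards [hslope, h1.eventually hθ, self_mem_nhdsWithin] with t h2 h3 h4
    have h4 : t ≠ 0 := h4
    have h5 := mul_pos (mul_pos h2 h3) (mul_self_pos.2 h4)
    have h6 : Θ θ * ψ t / t * (Θ θ * (ψ t * crossing R Θ θ₀ M (θ + ψ t))) * (t * t) =
        (Θ θ * ψ t) ^ 2 * (t * crossing R Θ θ₀ M (θ + ψ t)) := by
      field_simp
    rw [h6] at h5
    exact pos_of_mul_pos_right h5 (sq_nonneg _)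
  -- The logarithmic distance to the boundary curve has derivative r^k crossing / (1 + cos²) up to
  -- the cut-off. It decreases before t = 0 and increases afterwards, so it is positive on both
  -- sides.
  have hpos := eventually_pos_of_mul_deriv_pos
    (u := fun t => Real.log (rad (Γ t x)) - Real.log (blockRad θ₀ M (θ + ψ t)))
    (d := fun t => χ (Γ t x) * (rad (Γ t x) ^ k * (crossing R Θ θ₀ M (θ + ψ t) /
      (1 + Real.cos (θ + ψ t - θ₀) ^ 2)))) ?_ ?_ ?_
  · filter_upwards [hpos] with t ht
    rw [mem_blockSet (hne t) θ, not_le]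
    exact (Real.log_lt_log_iff (blockRad_pos _) (rad_pos.2 (hne t))).1 (sub_pos.1 ht)
  · filter_upwards [hψd] with t ht
    have h1 := hv.hasDerivAt_log_rad (h.hasDerivAt x t) (rad_pos.2 (hne t)) (hpt t)
    have h2 := (hasDerivAt_log_blockRad (θ₀ := θ₀) (M := M) (θ + ψ t)).comp t (ht.const_add θ)
    refine (h1.sub h2).congr_deriv ?_
    have h3 : 1 + Real.cos (θ + ψ t - θ₀) ^ 2 ≠ 0 := by positivity
    rw [crossing]
    field_simp
  · filter_upwards [hcross, hχ'.filter_mono nhdsWithin_le_nhds] with t h1 h2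
    rw [h2, one_mul, mul_left_comm, mul_div_assoc']
    have := rad_pos.2 (hne t)
    positivity
  · simp only [h.zero, hψ0, add_zero, hx, blockCurve, rad_pt (blockRad_pos θ).le, sub_self]

end PlanarReg

/-! ### The first integral along the boundary of the block -/

namespace PlanarReg

variable {v : ℝ × ℝ → ℝ × ℝ} {k : ℕ} {R Θ : ℝ → ℝ} {θ₀ θs : ℝ} {M : ℕ}

theorem IsPolarField.add_int_mul (hv : IsPolarField v k R Θ) (θ : ℝ) (n : ℤ) :
    R (θ + n * (2 * Real.pi)) = R θ ∧ Θ (θ + n * (2 * Real.pi)) = Θ θ :=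
  ⟨(show Function.Periodic R (2 * Real.pi) from fun θ => (hv.add_two_pi θ).1).int_mul n θ,
    (show Function.Periodic Θ (2 * Real.pi) from fun θ => (hv.add_two_pi θ).2).int_mul n θ⟩

/-- On the curve log H = log blockRad - W, and W has derivative R/Θ in θ; subtracting from the
derivative of log blockRad leaves -crossing / ((1 + cos²) Θ). The integer `n` relates θ to the angle
measured in the sector. -/
theorem FlowSector.hasDerivAt_H_blockCurve {S : FlowSector R Θ} (hv : IsPolarField v k R Θ) {θ : ℝ}
    (hθ : blockCurve θ₀ M θ ∈ S.region) : 0 < S.τ * Θ θ ∧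
      HasDerivAt (fun θ => S.H (blockCurve θ₀ M θ))
        (S.H (blockCurve θ₀ M θ) * -(crossing R Θ θ₀ M θ / ((1 + Real.cos (θ - θ₀) ^ 2) * Θ θ)))
        θ := by
  set a := S.coord (blockCurve θ₀ M θ) with ha
  have hmem : a ∈ Ioo (-S.l) S.l := S.coord_mem hθ
  have h1 := S.pt_coord (blockCurve θ₀ M θ)
  have hρ := fun θ => blockRad_pos (θ₀ := θ₀) (M := M) θ
  rw [← ha, blockCurve, rad_pt (hρ θ).le] at h1
  obtain ⟨-, n, hn⟩ := (pt_eq_pt_iff (hρ θ) (hρ θ)).1 h1.symm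
  have hR : R θ = R (S.m + S.τ * a) := by rw [hn, (hv.add_int_mul _ n).1]
  have hΘ : Θ θ = Θ (S.m + S.τ * a) := by rw [hn, (hv.add_int_mul _ n).2]
  have hpos : 0 < S.τ * Θ θ := by rw [hΘ]; exact S.pos a hmem
  refine ⟨hpos, ?_⟩
  have hnear : ∀ᶠ x in 𝓝 θ, a + S.τ * (x - θ) ∈ Ioo (-S.l) S.l := by
    have hc : ContinuousAt (fun x => a + S.τ * (x - θ)) θ := by fun_prop
    exact hc.eventually_mem (by simpa using Ioo_mem_nhds hmem.1 hmem.2)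
  have hEq : (fun x => S.H (blockCurve θ₀ M x)) =ᶠ[𝓝 θ]
      fun x => Real.exp (Real.log (blockRad θ₀ M x) - S.W (a + S.τ * (x - θ))) := by
    filter_upwards [hnear] with x hx
    have h2 : blockCurve θ₀ M x = pt (blockRad θ₀ M x) (S.m + S.τ * (a + S.τ * (x - θ))) := by
      rw [blockCurve, pt_eq_pt_iff (hρ x) (hρ x)]
      exact ⟨rfl, n, by linear_combination hn - (x - θ) * S.τ_mul_self⟩
    have hx' := abs_lt.2 hx
    rw [h2, H_of_mem (S.pt_mem_region (hρ x) hx'), L, S.coord_pt (hρ x) hx'.le, rad_pt (hρ x).le]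
  have hlin : HasDerivAt (fun x => a + S.τ * (x - θ)) S.τ θ := by
    simpa using (((hasDerivAt_id θ).sub_const θ).const_mul S.τ).const_add a
  have hW : HasDerivAt S.W (S.radial a / S.speed a) (a + S.τ * (θ - θ)) := by
    rw [sub_self, mul_zero, add_zero]
    exact hasDerivAt_W hv hmem
  have h3 := ((hasDerivAt_log_blockRad (θ₀ := θ₀) (M := M) θ).sub (hW.comp θ hlin)).exp
  have h4 := h3.congr_of_eventuallyEq hEq
  refine h4.congr_deriv ?_
  have h8 : S.H (blockCurve θ₀ M θ) = Real.exp _ := hEq.self_of_nhds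
  rw [h8]
  refine congrArg₂ _ rfl ?_
  have h5 : Θ θ ≠ 0 := fun h => by rw [h, mul_zero] at hpos; exact hpos.false
  have h6 : S.τ ≠ 0 := fun h => by rw [h, zero_mul] at hpos; exact hpos.false
  have h7 : 1 + Real.cos (θ - θ₀) ^ 2 ≠ 0 := by positivity
  rw [radial, speed, ← hR, ← hΘ, crossing]
  field_simp
  ring

/-- A homogeneous field of even degree `k + 1` with two opposite invariant rays, at the
angles `θ₀` (incoming) and `θ₀ + π` (outgoing), with the block of exponent `M` whose boundary is
crossed inwards before the angle `θs` and outwards after it. -/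
structure HasTangencyAngle (v : ℝ × ℝ → ℝ × ℝ) (k : ℕ) (R Θ : ℝ → ℝ) (θ₀ θs : ℝ) (M : ℕ) : Prop where
  isPolarField : IsPolarField v k R Θ
  add_pi : ∀ θ, R (θ + Real.pi) = -R θ ∧ Θ (θ + Real.pi) = -Θ θ
  zero : Θ θ₀ = 0
  neg : R θ₀ < 0
  pos : ∀ θ ∈ Ioo θ₀ (θ₀ + Real.pi), 0 < Θ θ
  mem : θs ∈ Ioo θ₀ (θ₀ + Real.pi)
  crossing_neg : ∀ θ ∈ Ioo (θs - Real.pi) θs, crossing R Θ θ₀ M θ < 0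
  crossing_zero : crossing R Θ θ₀ M θs = 0

theorem crossing_add_pi (h : ∀ θ, R (θ + Real.pi) = -R θ ∧ Θ (θ + Real.pi) = -Θ θ) (θ : ℝ) :
    crossing R Θ θ₀ M (θ + Real.pi) = -crossing R Θ θ₀ M θ := by
  simp only [crossing, h, add_sub_right_comm, Real.cos_add_pi, Real.sin_add_pi]
  ring

theorem exists_hasTangencyAngle (hv : IsPolarField v k R Θ) (h0 : Θ θ₀ = 0) (hR : R θ₀ < 0)
    (hpos : ∀ θ ∈ Ioo θ₀ (θ₀ + Real.pi), 0 < Θ θ) (hd : deriv Θ θ₀ ≠ 0) :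
    ∃ θs M, HasTangencyAngle v k R Θ θ₀ θs M := by
  have hπ := Real.pi_pos
  -- For even k the function Θ is π-periodic, hence positive on both sides of `θ₀`, which would be a
  -- minimum with zero derivative.
  have hk : Odd k := by
    by_contra hk
    rw [Nat.not_odd_iff_even] at hk
    refine hd (IsLocalMin.deriv_eq_zero ?_)
    filter_upwards [Ioo_mem_nhds (show θ₀ - Real.pi < θ₀ by linarith)
      (show θ₀ < θ₀ + Real.pi by linarith)] with θ hθ
    rw [h0]
    rcases lt_trichotomy θ θ₀ with h | h | h
    · have := (hv.add_pi θ).2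
      rw [hk.neg_one_pow, one_mul] at this
      rw [← this]
      exact (hpos _ ⟨by linarith [hθ.1], by linarith⟩).le
    · rw [h, h0]
    · exact (hpos _ ⟨h, hθ.2⟩).le
  have hap : ∀ θ, R (θ + Real.pi) = -R θ ∧ Θ (θ + Real.pi) = -Θ θ := fun θ => by
    have := hv.add_pi θ
    rwa [hk.neg_one_pow, neg_one_mul, neg_one_mul] at this
  have hRc : ContDiff ℝ 1 R := hv.contDiff_R.of_le one_le_two
  have hΘc : ContDiff ℝ 1 Θ := hv.contDiff_Θ.of_le one_le_two
  -- In φ = θ - θ₀, the end values of A are 2 R(θ₀) < 0 and 2 R(θ₀ + π) = -2 R(θ₀) > 0.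
  obtain ⟨M, φs, hφs, h1, h2, h3⟩ := exists_sign_change
    (A := fun φ => R (θ₀ + φ) * (1 + Real.cos φ ^ 2)) (B := fun φ => Real.sin φ * Θ (θ₀ + φ))
    ((hRc.comp (by fun_prop)).mul (by fun_prop)) (Real.contDiff_sin.mul (hΘc.comp (by fun_prop)))
    (fun φ hφ => mul_pos (Real.sin_pos_of_mem_Ioo hφ)
      (hpos _ ⟨by linarith [hφ.1], by linarith [hφ.2]⟩)) (by simp) (by simp)
    (by simpa using mul_neg_of_neg_of_pos hR (by norm_num : (0 : ℝ) < 1 + 1))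
    (by simpa [(hap θ₀).1] using mul_neg_of_neg_of_pos hR (by norm_num : (0 : ℝ) < 1 + 1))
  have key : ∀ φ, R (θ₀ + φ) * (1 + Real.cos φ ^ 2) - (M + 2) * (Real.cos φ * (Real.sin φ *
      Θ (θ₀ + φ))) = crossing R Θ θ₀ M (θ₀ + φ) := fun φ => by rw [crossing, add_sub_cancel_left]
  simp only [key] at h1 h2 h3
  refine ⟨θ₀ + φs, M, hv, hap, h0, hR, hpos, ⟨by linarith [hφs.1], by linarith [hφs.2]⟩,
    fun θ hθ => ?_, h3⟩
  rcases le_or_gt θ₀ θ with h | h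
  · have := h1 (θ - θ₀) ⟨by linarith, by linarith [hθ.2]⟩
    rwa [add_sub_cancel] at this
  -- Angles below `θ₀` are shifted by π, which changes the sign of `crossing`.
  · have := h2 (θ + Real.pi - θ₀) ⟨by linarith [hθ.1], by linarith⟩
    rw [add_sub_cancel, crossing_add_pi hap] at this
    linarith

/-- Strict monotonicity from the derivative off one interior point. -/
theorem strictMonoOn_of_hasDerivAt_pos {f : ℝ → ℝ} {a b c : ℝ} (hf : Continuous f) (hac : a ≤ c)
    (hcb : c ≤ b) (h1 : ∀ x ∈ Ioo a c, ∃ d > 0, HasDerivAt f d x)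
    (h2 : ∀ x ∈ Ioo c b, ∃ d > 0, HasDerivAt f d x) : StrictMonoOn f (Icc a b) := by
  have key : ∀ {p q : ℝ}, (∀ x ∈ Ioo p q, ∃ d > 0, HasDerivAt f d x) → StrictMonoOn f (Icc p q) :=
    fun {p q} h => strictMonoOn_of_deriv_pos (convex_Icc p q) hf.continuousOn fun x hx => by
      rw [interior_Icc] at hx
      obtain ⟨d, hd, hd'⟩ := h x hx
      rwa [hd'.deriv]
  rw [← Icc_union_Icc_eq_Icc hac hcb]
  exact (key h1).union (key h2) (isGreatest_Icc hac) (isLeast_Icc hcb)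

/-- The coordinate transversal to the direction `θ₀`. -/
noncomputable def cross (θ₀ : ℝ) (z : ℝ × ℝ) : ℝ := z.2 * Real.cos θ₀ - z.1 * Real.sin θ₀

theorem cross_pt (r θ : ℝ) : cross θ₀ (pt r θ) = r * Real.sin (θ - θ₀) := by
  rw [cross, pt, Real.sin_sub]
  ring

@[fun_prop]
theorem continuous_cross : Continuous (cross θ₀) := by unfold cross; fun_prop

theorem abs_ang_lt_iff {m : ℝ} {z : ℝ × ℝ} :
    (z ≠ 0 ∧ |ang m z| < Real.pi / 2) ↔ 0 < rad z * Real.cos (ang m z) := by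
  constructor
  · rintro ⟨h0, h⟩
    exact mul_pos (rad_pos.2 h0) (Real.cos_pos_of_mem_Ioo (abs_lt.1 h))
  · intro h
    have h0 : z ≠ 0 := fun h0 => by rw [h0, rad_zero, zero_mul] at h; exact h.false
    refine ⟨h0, ?_⟩
    by_contra hcon
    have h1 := ang_mem m z
    have h2 : |ang m z| ≤ Real.pi := abs_le.2 ⟨h1.1.le, h1.2⟩
    have h3 := Real.cos_nonpos_of_pi_div_two_le_of_le (not_lt.1 hcon) (by linarith [Real.pi_pos])
    rw [Real.cos_abs] at h3
    exact absurd h (not_lt.2 (mul_nonpos_of_nonneg_of_nonpos (rad_nonneg z) h3))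

namespace HasTangencyAngle

variable (h : HasTangencyAngle v k R Θ θ₀ θs M)
include h

theorem sub_pi (θ : ℝ) : R (θ - Real.pi) = -R θ ∧ Θ (θ - Real.pi) = -Θ θ := by
  have := h.add_pi (θ - Real.pi)
  rw [sub_add_cancel] at this
  exact ⟨by rw [this.1, neg_neg], by rw [this.2, neg_neg]⟩

/-- The half-plane to the left of the invariant line. -/
noncomputable def leftSector : FlowSector R Θ where
  m := θ₀ + Real.pi / 2
  τ := 1
  l := Real.pi / 2
  τ_eq := Or.inl rfl
  l_pos := by positivity
  l_le := le_rfl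
  pos a ha := by
    rw [one_mul, one_mul]
    exact h.pos _ ⟨by linarith [ha.1], by linarith [ha.2]⟩
  zero_right := by rw [one_mul, add_assoc, add_halves, (h.add_pi _).2, h.zero, neg_zero]
  zero_left := by rw [one_mul, add_neg_cancel_right, h.zero]
  ne_right := by
    rw [one_mul, add_assoc, add_halves, (h.add_pi _).1]
    exact neg_ne_zero.2 h.neg.ne
  ne_left := by rw [one_mul, add_neg_cancel_right]; exact h.neg.ne

/-- The half-plane to the right of the invariant line. -/
noncomputable def rightSector : FlowSector R Θ where
  m := θ₀ - Real.pi / 2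
  τ := -1
  l := Real.pi / 2
  τ_eq := Or.inr rfl
  l_pos := by positivity
  l_le := le_rfl
  pos a ha := by
    have h1 := h.pos (θ₀ - Real.pi / 2 + -1 * a + Real.pi)
      ⟨by linarith [ha.2], by linarith [ha.1]⟩
    rw [(h.add_pi _).2] at h1
    linarith
  zero_right := by
    rw [show θ₀ - Real.pi / 2 + -1 * (Real.pi / 2) = θ₀ - Real.pi by ring, (h.sub_pi _).2, h.zero,
      neg_zero]
  zero_left := by
    rw [show θ₀ - Real.pi / 2 + -1 * -(Real.pi / 2) = θ₀ by ring, h.zero]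
  ne_right := by
    rw [show θ₀ - Real.pi / 2 + -1 * (Real.pi / 2) = θ₀ - Real.pi by ring, (h.sub_pi _).1]
    exact neg_ne_zero.2 h.neg.ne
  ne_left := by
    rw [show θ₀ - Real.pi / 2 + -1 * -(Real.pi / 2) = θ₀ by ring]
    exact h.neg.ne

theorem leftSector_right : 0 < R (h.leftSector.m + h.leftSector.τ * h.leftSector.l) := by
  change 0 < R (θ₀ + Real.pi / 2 + 1 * (Real.pi / 2))
  rw [one_mul, add_assoc, add_halves, (h.add_pi _).1]
  exact neg_pos.2 h.neg

theorem leftSector_left : R (h.leftSector.m + h.leftSector.τ * -h.leftSector.l) < 0 := by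
  change R (θ₀ + Real.pi / 2 + 1 * -(Real.pi / 2)) < 0
  rw [one_mul, add_neg_cancel_right]
  exact h.neg

theorem rightSector_right : 0 < R (h.rightSector.m + h.rightSector.τ * h.rightSector.l) := by
  change 0 < R (θ₀ - Real.pi / 2 + -1 * (Real.pi / 2))
  rw [show θ₀ - Real.pi / 2 + -1 * (Real.pi / 2) = θ₀ - Real.pi by ring, (h.sub_pi _).1]
  exact neg_pos.2 h.neg

theorem rightSector_left : R (h.rightSector.m + h.rightSector.τ * -h.rightSector.l) < 0 := by
  change R (θ₀ - Real.pi / 2 + -1 * -(Real.pi / 2)) < 0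
  rw [show θ₀ - Real.pi / 2 + -1 * -(Real.pi / 2) = θ₀ by ring]
  exact h.neg

theorem mem_leftSector {z : ℝ × ℝ} : z ∈ h.leftSector.region ↔ 0 < cross θ₀ z := by
  have h1 : cross θ₀ z = rad z * Real.cos (ang (θ₀ + Real.pi / 2) z) := by
    conv_lhs => rw [← pt_rad_ang (θ₀ + Real.pi / 2) z]
    rw [cross_pt, show ∀ a, θ₀ + Real.pi / 2 + a - θ₀ = a + Real.pi / 2 by intro a; ring,
      Real.sin_add_pi_div_two]
  rw [h1]
  exact abs_ang_lt_iff

theorem mem_rightSector {z : ℝ × ℝ} : z ∈ h.rightSector.region ↔ cross θ₀ z < 0 := by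
  have h1 : cross θ₀ z = -(rad z * Real.cos (ang (θ₀ - Real.pi / 2) z)) := by
    conv_lhs => rw [← pt_rad_ang (θ₀ - Real.pi / 2) z]
    rw [cross_pt, show ∀ a, θ₀ - Real.pi / 2 + a - θ₀ = a - Real.pi / 2 by intro a; ring,
      Real.sin_sub_pi_div_two]
    ring
  rw [h1, neg_lt_zero]
  exact abs_ang_lt_iff

/-- A continuous first integral on the plane. -/
noncomputable def firstIntegral (z : ℝ × ℝ) : ℝ := h.leftSector.H z - h.rightSector.H z

theorem continuous_firstIntegral : Continuous h.firstIntegral :=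
  (FlowSector.continuous_H h.isPolarField h.leftSector_right h.leftSector_left).sub
    (FlowSector.continuous_H h.isPolarField h.rightSector_right h.rightSector_left)

theorem firstIntegral_flow {χ : ℝ × ℝ → ℝ} {Γ : ℝ → ℝ × ℝ → ℝ × ℝ} (hΓ : IsCutoffFlow v χ Γ)
    (x : ℝ × ℝ) (t : ℝ) : h.firstIntegral (Γ t x) = h.firstIntegral x := by
  rw [firstIntegral, firstIntegral, FlowSector.H_flow h.isPolarField hΓ,
    FlowSector.H_flow h.isPolarField hΓ]

theorem firstIntegral_of_pos {z : ℝ × ℝ} (hz : 0 < cross θ₀ z) :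
    h.firstIntegral z = h.leftSector.H z := by
  rw [firstIntegral, FlowSector.H_of_notMem (S := h.rightSector)
    fun h1 => lt_asymm hz (h.mem_rightSector.1 h1), sub_zero]

theorem firstIntegral_of_neg {z : ℝ × ℝ} (hz : cross θ₀ z < 0) :
    h.firstIntegral z = -h.rightSector.H z := by
  rw [firstIntegral, FlowSector.H_of_notMem (S := h.leftSector)
    fun h1 => lt_asymm hz (h.mem_leftSector.1 h1), zero_sub]

theorem firstIntegral_of_eq {z : ℝ × ℝ} (hz : cross θ₀ z = 0) : h.firstIntegral z = 0 := by
  rw [firstIntegral, FlowSector.H_of_notMem fun h1 => (h.mem_leftSector.1 h1).ne' hz,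
    FlowSector.H_of_notMem fun h1 => (h.mem_rightSector.1 h1).ne hz, sub_zero]

/-- Θ is positive on the left half-plane and negative on the right, and H enters with opposite
signs; hence one sign rule with positive κ holds on both. -/
theorem hasDerivAt_firstIntegral {θ : ℝ} (hθ : Real.sin (θ - θ₀) ≠ 0) : ∃ κ > 0,
    HasDerivAt (fun θ => h.firstIntegral (blockCurve θ₀ M θ)) (-κ * crossing R Θ θ₀ M θ) θ := by
  have hc : Continuous fun θ => cross θ₀ (blockCurve θ₀ M θ) :=
    continuous_cross.comp continuous_blockCurve
  have hs : cross θ₀ (blockCurve θ₀ M θ) = blockRad θ₀ M θ * Real.sin (θ - θ₀) := cross_pt _ _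
  have hρ := blockRad_pos (θ₀ := θ₀) (M := M) θ
  have hw : 0 < 1 + Real.cos (θ - θ₀) ^ 2 := by positivity
  rcases lt_or_gt_of_ne hθ with h1 | h1
  · have h2 : cross θ₀ (blockCurve θ₀ M θ) < 0 := hs ▸ mul_neg_of_pos_of_neg hρ h1
    have h3 := h.mem_rightSector.2 h2
    obtain ⟨h4, h5⟩ := FlowSector.hasDerivAt_H_blockCurve h.isPolarField h3
    have h4 : 0 < -1 * Θ θ := h4
    refine ⟨h.rightSector.H (blockCurve θ₀ M θ) / ((1 + Real.cos (θ - θ₀) ^ 2) * (-1 * Θ θ)),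
      div_pos (FlowSector.H_pos.2 h3) (mul_pos hw h4), ?_⟩
    refine (h5.neg.congr_of_eventuallyEq ?_).congr_deriv ?_
    · filter_upwards [hc.continuousAt.eventually_lt_const h2] with x hx
      exact h.firstIntegral_of_neg hx
    · have : Θ θ ≠ 0 := by linarith
      field_simp
  · have h2 : 0 < cross θ₀ (blockCurve θ₀ M θ) := hs ▸ mul_pos hρ h1
    have h3 := h.mem_leftSector.2 h2
    obtain ⟨h4, h5⟩ := FlowSector.hasDerivAt_H_blockCurve h.isPolarField h3
    have h4 : 0 < 1 * Θ θ := h4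
    refine ⟨h.leftSector.H (blockCurve θ₀ M θ) / ((1 + Real.cos (θ - θ₀) ^ 2) * (1 * Θ θ)),
      div_pos (FlowSector.H_pos.2 h3) (mul_pos hw h4), ?_⟩
    refine (h5.congr_of_eventuallyEq ?_).congr_deriv ?_
    · filter_upwards [hc.continuousAt.eventually_const_lt h2] with x hx
      exact h.firstIntegral_of_pos hx
    · have : Θ θ ≠ 0 := by linarith
      field_simp

theorem crossing_pos {θ : ℝ} (hθ : θ ∈ Ioo θs (θs + Real.pi)) : 0 < crossing R Θ θ₀ M θ := by
  have h1 := h.crossing_neg (θ - Real.pi) ⟨by linarith [hθ.1], by linarith [hθ.2]⟩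
  have h2 := crossing_add_pi (θ₀ := θ₀) (M := M) h.add_pi (θ - Real.pi)
  rw [sub_add_cancel] at h2
  linarith

/-- On the entry arc `crossing` is negative, so the derivative is positive except at `θ₀`, where the
arc meets the invariant line and continuity suffices. -/
theorem strictMonoOn_firstIntegral :
    StrictMonoOn (fun θ => h.firstIntegral (blockCurve θ₀ M θ)) (Icc (θs - Real.pi) θs) := by
  have hm := h.mem
  refine strictMonoOn_of_hasDerivAt_pos (c := θ₀)
    (h.continuous_firstIntegral.comp continuous_blockCurve) (by linarith [hm.2]) hm.1.le
    (fun θ hθ => ?_) fun θ hθ => ?_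
  · have h1 : Real.sin (θ - θ₀) ≠ 0 :=
      (Real.sin_neg_of_neg_of_neg_pi_lt (by linarith [hθ.2]) (by linarith [hθ.1, hm.1])).ne
    obtain ⟨κ, hκ, h2⟩ := h.hasDerivAt_firstIntegral h1
    exact ⟨_, mul_pos_of_neg_of_neg (neg_lt_zero.2 hκ)
      (h.crossing_neg θ ⟨hθ.1, hθ.2.trans hm.1⟩), h2⟩
  · have h1 : Real.sin (θ - θ₀) ≠ 0 :=
      (Real.sin_pos_of_pos_of_lt_pi (by linarith [hθ.1]) (by linarith [hθ.2, hm.2])).ne'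
    obtain ⟨κ, hκ, h2⟩ := h.hasDerivAt_firstIntegral h1
    exact ⟨_, mul_pos_of_neg_of_neg (neg_lt_zero.2 hκ)
      (h.crossing_neg θ ⟨by linarith [hθ.1, hm.2], hθ.2⟩), h2⟩

theorem strictAntiOn_firstIntegral :
    StrictAntiOn (fun θ => h.firstIntegral (blockCurve θ₀ M θ)) (Icc θs (θs + Real.pi)) := by
  have hm := h.mem
  have key : StrictMonoOn (fun θ => -h.firstIntegral (blockCurve θ₀ M θ))
      (Icc θs (θs + Real.pi)) := by
    refine strictMonoOn_of_hasDerivAt_pos (c := θ₀ + Real.pi)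
      (h.continuous_firstIntegral.comp continuous_blockCurve).neg hm.2.le (by linarith [hm.1])
      (fun θ hθ => ?_) fun θ hθ => ?_
    · have h1 : Real.sin (θ - θ₀) ≠ 0 :=
        (Real.sin_pos_of_pos_of_lt_pi (by linarith [hθ.1, hm.1]) (by linarith [hθ.2])).ne'
      obtain ⟨κ, hκ, h2⟩ := h.hasDerivAt_firstIntegral h1
      exact ⟨_, neg_pos.2 (mul_neg_of_neg_of_pos (neg_lt_zero.2 hκ)
        (h.crossing_pos ⟨hθ.1, by linarith [hθ.2, hm.1]⟩)), h2.neg⟩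
    · have h1 : Real.sin (θ - θ₀) ≠ 0 := by
        rw [← Real.sin_sub_two_pi]
        exact (Real.sin_neg_of_neg_of_neg_pi_lt (by linarith [hθ.2, hm.2]) (by linarith [hθ.1])).ne
      obtain ⟨κ, hκ, h2⟩ := h.hasDerivAt_firstIntegral h1
      exact ⟨_, neg_pos.2 (mul_neg_of_neg_of_pos (neg_lt_zero.2 hκ)
        (h.crossing_pos ⟨by linarith [hθ.1, hm.2], hθ.2⟩)), h2.neg⟩
  intro a ha b hb hab
  have := key ha hb hab
  simp only at this ⊢
  linarith

end HasTangencyAngle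

end PlanarReg

/-! ### The block is isolating and trivialisable -/

namespace PlanarReg

variable {v : ℝ × ℝ → ℝ × ℝ} {k : ℕ} {R Θ : ℝ → ℝ} {θ₀ θs : ℝ} {M : ℕ}

namespace HasTangencyAngle

section

variable (h : HasTangencyAngle v k R Θ θ₀ θs M) {χ : ℝ × ℝ → ℝ} {Γ : ℝ → ℝ × ℝ → ℝ × ℝ}
  {U : Set (ℝ × ℝ)} (hΓ : IsAdaptedFlow v χ Γ (blockSet θ₀ M) U)
include h hΓ

omit h hΓ in
theorem mem_frontier (θ : ℝ) : blockCurve θ₀ M θ ∈ frontier (blockSet θ₀ M) := by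
  rw [frontier_blockSet]
  exact mem_range_self θ

omit h hΓ in
theorem notMem_tangencySet {θ : ℝ}
    (hθ : fderiv ℝ (blockFun θ₀ M) (blockCurve θ₀ M θ) (v (blockCurve θ₀ M θ)) ≠ 0) :
    blockCurve θ₀ M θ ∉ tangencySet v (blockSet θ₀ M) := fun ⟨_, _, hg, hg'⟩ =>
  (isDefiningFunctionAt_blockFun θ).ne_zero_of_ne_zero hg hθ hg'

theorem entry_of_mem {θ : ℝ} (hθ : θ ∈ Ioo (θs - Real.pi) θs) :
    blockCurve θ₀ M θ ∈ entrySet v (blockSet θ₀ M) ∧ blockCurve θ₀ M θ ∉ exitSet v (blockSet θ₀ M) ∧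
      blockCurve θ₀ M θ ∉ tangencySet v (blockSet θ₀ M) := by
  have h1 : fderiv ℝ (blockFun θ₀ M) (blockCurve θ₀ M θ) (v (blockCurve θ₀ M θ)) < 0 := by
    rw [fderiv_blockFun_blockCurve h.isPolarField]
    have := blockRad_pos (θ₀ := θ₀) (M := M) θ
    exact mul_neg_of_pos_of_neg (by positivity) (h.crossing_neg θ hθ)
  have h2 := hΓ.inward (mem_frontier θ) (isDefiningFunctionAt_blockFun θ) h1
  exact ⟨h2.1, h2.2.1, notMem_tangencySet h1.ne⟩

theorem exit_of_mem {θ : ℝ} (hθ : θ ∈ Ioo θs (θs + Real.pi)) :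
    blockCurve θ₀ M θ ∈ exitSet v (blockSet θ₀ M) ∧ blockCurve θ₀ M θ ∉ entrySet v (blockSet θ₀ M) ∧
      blockCurve θ₀ M θ ∉ tangencySet v (blockSet θ₀ M) := by
  have h1 : 0 < fderiv ℝ (blockFun θ₀ M) (blockCurve θ₀ M θ) (v (blockCurve θ₀ M θ)) := by
    rw [fderiv_blockFun_blockCurve h.isPolarField]
    have := blockRad_pos (θ₀ := θ₀) (M := M) θ
    exact mul_pos (by positivity) (h.crossing_pos hθ)
  have h2 := hΓ.outward (mem_frontier θ) (isDefiningFunctionAt_blockFun θ) h1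
  exact ⟨h2.1, h2.2, notMem_tangencySet h1.ne'⟩

/-- Passing from θs to θs - π changes the sign of both Θ and `crossing`, so their product behaves
alike at the two points, and both are outer tangencies. -/
theorem tangency_of_eq {θ : ℝ} (hθ : θ = θs ∨ θ = θs - Real.pi) :
    blockCurve θ₀ M θ ∈ entrySet v (blockSet θ₀ M) ∧ blockCurve θ₀ M θ ∈ exitSet v (blockSet θ₀ M) ∧
      blockCurve θ₀ M θ ∈ tangencySet v (blockSet θ₀ M) := by
  have hπ := Real.pi_pos
  have hap := crossing_add_pi (θ₀ := θ₀) (M := M) h.add_pi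
  have h1 : ∀ a ∈ Ioo (-Real.pi) Real.pi, a ≠ 0 → 0 < a * crossing R Θ θ₀ M (θs + a) := by
    intro a ha h0
    rcases lt_or_gt_of_ne h0 with h2 | h2
    · exact mul_pos_of_neg_of_neg h2 (h.crossing_neg _ ⟨by linarith [ha.1], by linarith⟩)
    · exact mul_pos h2 (h.crossing_pos ⟨by linarith, by linarith [ha.2]⟩)
  have h2 := h.pos θs h.mem
  have h3 : crossing R Θ θ₀ M θ = 0 ∧ ∀ a ∈ Ioo (-Real.pi) Real.pi, a ≠ 0 →
      0 < Θ θ * (a * crossing R Θ θ₀ M (θ + a)) := by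
    rcases hθ with rfl | rfl
    · exact ⟨h.crossing_zero, fun a ha h0 => mul_pos h2 (h1 a ha h0)⟩
    · have h4 : ∀ x, crossing R Θ θ₀ M x = -crossing R Θ θ₀ M (x + Real.pi) := fun x => by
        rw [hap, neg_neg]
      refine ⟨by rw [h4, sub_add_cancel, h.crossing_zero, neg_zero], fun a ha h0 => ?_⟩
      rw [h4, (h.sub_pi _).2, show θs - Real.pi + a + Real.pi = θs + a by ring]
      have := mul_pos h2 (h1 a ha h0)
      linarith
  have h5 := eventually_notMem_of_crossing h.isPolarField hΓ (θ := θ) (by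
    filter_upwards [nhdsWithin_le_nhds (Ioo_mem_nhds (neg_lt_zero.2 hπ) hπ), self_mem_nhdsWithin]
      with a ha h0 using h3.2 a ha h0)
  refine ⟨hΓ.mem_entrySet.2 ⟨mem_frontier θ, h5.filter_mono
      (nhdsWithin_mono _ fun t (ht : t < 0) => ht.ne)⟩, hΓ.mem_exitSet.2 ⟨mem_frontier θ,
    h5.filter_mono (nhdsWithin_mono _ fun t (ht : 0 < t) => ht.ne')⟩, mem_frontier θ,
    blockFun θ₀ M, isDefiningFunctionAt_blockFun θ, ?_⟩
  rw [fderiv_blockFun_blockCurve h.isPolarField, h3.1, mul_zero]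

omit h hΓ in
theorem exists_angle {x : ℝ × ℝ} (hx : x ∈ frontier (blockSet θ₀ M)) (θs : ℝ) :
    ∃ θ, x = blockCurve θ₀ M θ ∧
      ((θ = θs ∨ θ = θs - Real.pi) ∨ θ ∈ Ioo (θs - Real.pi) θs ∨ θ ∈ Ioo θs (θs + Real.pi)) := by
  rw [frontier_blockSet] at hx
  obtain ⟨θ₁, rfl⟩ := hx
  obtain ⟨θ, hθ, h1⟩ := Function.Periodic.exists_mem_Ico (f := blockCurve θ₀ M)
    blockCurve_add_two_pi Real.two_pi_pos θ₁ (θs - Real.pi)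
  refine ⟨θ, h1, ?_⟩
  have h2 : θ < θs + Real.pi := by linarith [hθ.2]
  rcases hθ.1.eq_or_lt with h3 | h3
  · exact Or.inl (Or.inr h3.symm)
  rcases lt_trichotomy θ θs with h4 | h4 | h4
  · exact Or.inr (Or.inl ⟨h3, h4⟩)
  · exact Or.inl (Or.inl h4)
  · exact Or.inr (Or.inr ⟨h4, h2⟩)

theorem isIsolatingBlock : IsIsolatingBlock v (blockSet θ₀ M) where
  isCompact := isCompact_blockSet
  smooth_boundary p hp := by
    obtain ⟨θ, rfl, -⟩ := exists_angle hp θs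
    exact ⟨_, isDefiningFunctionAt_blockFun θ⟩
  union_eq := by
    refine Subset.antisymm (union_subset (fun x hx => hx.1) fun x hx => hx.1) fun x hx => ?_
    obtain ⟨θ, rfl, h1 | h1 | h1⟩ := exists_angle hx θs
    · exact Or.inl (h.tangency_of_eq hΓ h1).1
    · exact Or.inl (h.entry_of_mem hΓ h1).1
    · exact Or.inr (h.exit_of_mem hΓ h1).1
  inter_eq := by
    ext x
    by_cases hx : x ∈ frontier (blockSet θ₀ M)
    · obtain ⟨θ, rfl, h1 | h1 | h1⟩ := exists_angle hx θs
      · have := h.tangency_of_eq hΓ h1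
        simp [this.1, this.2.1, this.2.2]
      · have := h.entry_of_mem hΓ h1
        simp [this.2.1, this.2.2]
      · have := h.exit_of_mem hΓ h1
        simp [this.2.1, this.2.2]
    · exact ⟨fun h1 => absurd h1.1.1 hx, fun h1 => absurd h1.1 hx⟩
  finite_tangency := by
    refine (Set.toFinite {blockCurve θ₀ M θs, blockCurve θ₀ M (θs - Real.pi)}).subset fun x hx => ?_
    obtain ⟨θ, rfl, (rfl | rfl) | h1 | h1⟩ := exists_angle hx.1 θs
    · exact Or.inl rfl
    · exact Or.inr rfl
    · exact absurd hx (h.entry_of_mem hΓ h1).2.2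
    · exact absurd hx (h.exit_of_mem hΓ h1).2.2

theorem entrySet_eq :
    entrySet v (blockSet θ₀ M) = blockCurve θ₀ M '' Icc (θs - Real.pi) θs := by
  have hπ := Real.pi_pos
  apply Subset.antisymm
  · intro x hx
    obtain ⟨θ, rfl, (rfl | rfl) | h1 | h1⟩ := exists_angle hx.1 θs
    · exact mem_image_of_mem _ ⟨by linarith, le_rfl⟩
    · exact mem_image_of_mem _ ⟨le_rfl, by linarith⟩
    · exact mem_image_of_mem _ (Ioo_subset_Icc_self h1)
    · exact absurd hx (h.exit_of_mem hΓ h1).2.1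
  · rintro _ ⟨θ, hθ, rfl⟩
    rcases hθ.1.eq_or_lt with h1 | h1
    · exact (h.tangency_of_eq hΓ (Or.inr h1.symm)).1
    rcases hθ.2.eq_or_lt with h2 | h2
    · exact (h.tangency_of_eq hΓ (Or.inl h2)).1
    · exact (h.entry_of_mem hΓ ⟨h1, h2⟩).1

omit h hΓ in
theorem blockCurve_add_pi_eq : blockCurve θ₀ M (θs + Real.pi) = blockCurve θ₀ M (θs - Real.pi) := by
  rw [← blockCurve_add_two_pi (θs - Real.pi)]
  congr 1
  ring

theorem exitSet_eq :
    exitSet v (blockSet θ₀ M) = blockCurve θ₀ M '' Icc θs (θs + Real.pi) := by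
  have hπ := Real.pi_pos
  apply Subset.antisymm
  · intro x hx
    obtain ⟨θ, rfl, (rfl | rfl) | h1 | h1⟩ := exists_angle hx.1 θs
    · exact mem_image_of_mem _ ⟨le_rfl, by linarith⟩
    · exact ⟨θs + Real.pi, ⟨by linarith, le_rfl⟩, blockCurve_add_pi_eq⟩
    · exact absurd hx (h.entry_of_mem hΓ h1).2.1
    · exact mem_image_of_mem _ (Ioo_subset_Icc_self h1)
  · rintro _ ⟨θ, hθ, rfl⟩
    rcases hθ.1.eq_or_lt with h1 | h1
    · exact (h.tangency_of_eq hΓ (Or.inl h1.symm)).2.1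
    rcases hθ.2.eq_or_lt with h2 | h2
    · rw [h2, blockCurve_add_pi_eq]
      exact (h.tangency_of_eq hΓ (Or.inr rfl)).2.1
    · exact (h.exit_of_mem hΓ ⟨h1, h2⟩).1

theorem injOn_entrySet : InjOn h.firstIntegral (entrySet v (blockSet θ₀ M)) := by
  rw [h.entrySet_eq hΓ]
  rintro _ ⟨a, ha, rfl⟩ _ ⟨b, hb, rfl⟩ hab
  rw [h.strictMonoOn_firstIntegral.injOn ha hb hab]

theorem injOn_exitSet : InjOn h.firstIntegral (exitSet v (blockSet θ₀ M)) := by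
  rw [h.exitSet_eq hΓ]
  rintro _ ⟨a, ha, rfl⟩ _ ⟨b, hb, rfl⟩ hab
  rw [h.strictAntiOn_firstIntegral.injOn ha hb hab]

/-- Both arcs join the same two tangency points and the first integral is monotone on each, so the
images are the same interval. -/
theorem image_entrySet_eq : h.firstIntegral '' entrySet v (blockSet θ₀ M) =
    h.firstIntegral '' exitSet v (blockSet θ₀ M) := by
  have hπ := Real.pi_pos
  set f := fun θ => h.firstIntegral (blockCurve θ₀ M θ) with hf
  have hc : Continuous f := h.continuous_firstIntegral.comp continuous_blockCurve
  have h1 : h.firstIntegral '' entrySet v (blockSet θ₀ M) = Icc (f (θs - Real.pi)) (f θs) := by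
    rw [h.entrySet_eq hΓ, image_image]
    refine Subset.antisymm ?_ (intermediate_value_Icc (by linarith) hc.continuousOn)
    rintro _ ⟨a, ha, rfl⟩
    exact ⟨h.strictMonoOn_firstIntegral.monotoneOn ⟨le_rfl, by linarith⟩ ha ha.1,
      h.strictMonoOn_firstIntegral.monotoneOn ha ⟨by linarith, le_rfl⟩ ha.2⟩
  have h2 : h.firstIntegral '' exitSet v (blockSet θ₀ M) = Icc (f (θs + Real.pi)) (f θs) := by
    rw [h.exitSet_eq hΓ, image_image]
    refine Subset.antisymm ?_ (intermediate_value_Icc' (by linarith) hc.continuousOn)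
    rintro _ ⟨a, ha, rfl⟩
    exact ⟨h.strictAntiOn_firstIntegral.antitoneOn ha ⟨by linarith, le_rfl⟩ ha.2,
      h.strictAntiOn_firstIntegral.antitoneOn ⟨le_rfl, by linarith⟩ ha ha.1⟩
  have h3 : f (θs + Real.pi) = f (θs - Real.pi) := congrArg h.firstIntegral blockCurve_add_pi_eq
  rw [h1, h2, h3]

/-- An orbit that stays in the block forwards lies on the invariant line. -/
theorem cross_eq_zero_of_stays {x : ℝ × ℝ} (hx : ∀ t, 0 ≤ t → Γ t x ∈ blockSet θ₀ M) :
    cross θ₀ x = 0 := by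
  have hχ : ∀ t, 0 ≤ t → χ (Γ t x) = 1 := fun t ht => hΓ.eq_one _ (hΓ.subset (hx t ht))
  have hρ : ∀ t, 0 ≤ t → rad (Γ t x) ≤ 1 := fun t ht => rad_le_one_of_mem_blockSet (hx t ht)
  by_contra hne
  rcases lt_or_gt_of_ne hne with h1 | h1
  · exact FlowSector.not_forward_bounded h.isPolarField hΓ.toIsCutoffFlow h.rightSector_right
      (h.mem_rightSector.2 h1) hχ hρ
  · exact FlowSector.not_forward_bounded h.isPolarField hΓ.toIsCutoffFlow h.leftSector_right
      (h.mem_leftSector.2 h1) hχ hρ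

theorem maximalInvariantSet_eq : maximalInvariantSet v (blockSet θ₀ M) = {0} := by
  ext x
  rw [hΓ.mem_maximalInvariantSet, mem_singleton_iff]
  have h0N : (0 : ℝ × ℝ) ∈ blockSet θ₀ M := interior_subset zero_mem_interior_blockSet
  constructor
  · intro hx
    by_contra hx0
    have hr := rad_pos.2 hx0
    have h1 := h.cross_eq_zero_of_stays hΓ fun t _ => hx t
    have hχ : ∀ t, χ (Γ t x) = 1 := fun t => hΓ.eq_one _ (hΓ.subset (hx t))
    have hρ : ∀ t, rad (Γ t x) ≤ 1 := fun t => rad_le_one_of_mem_blockSet (hx t)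
    have hpt := pt_rad_ang θ₀ x
    have hang := ang_mem θ₀ x
    rw [← hpt, cross_pt, add_sub_cancel_left, mul_eq_zero, or_iff_right hr.ne'] at h1
    have h2 : ang θ₀ x = 0 ∨ ang θ₀ x = Real.pi := by
      rcases hang.2.eq_or_lt with h2 | h2
      · exact Or.inr h2
      · exact Or.inl ((Real.sin_eq_zero_iff_of_lt_of_lt hang.1 h2).1 h1)
    rcases h2 with h2 | h2
    · rw [h2, add_zero] at hpt
      rw [← hpt] at hχ hρ
      exact h.isPolarField.neg.ray_not_forward_bounded hΓ.toIsCutoffFlow.reverse hr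
        (by simp [h.zero]) (neg_pos.2 h.neg) (fun t _ => hχ (-t)) (fun t _ => hρ (-t))
    · rw [h2] at hpt
      rw [← hpt] at hχ hρ
      refine h.isPolarField.ray_not_forward_bounded hΓ.toIsCutoffFlow hr (θ := θ₀ + Real.pi)
        (by rw [(h.add_pi _).2, h.zero, neg_zero]) ?_ (fun t _ => hχ t) (fun t _ => hρ t)
      rw [(h.add_pi _).1]
      exact neg_pos.2 h.neg
  · rintro rfl t
    rw [hΓ.eq_of_zero h.isPolarField.apply_zero]
    exact h0N

end

/-- The homeomorphism matches values of the first integral, which orbits preserve and which is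
injective on n⁺ and on n⁻; so it agrees with the block map wherever that is defined. -/
theorem isC0Regularisable (h : HasTangencyAngle v k R Θ θ₀ θs M) : IsC0Regularisable v 0 := by
  obtain ⟨χ, Γ, hc, U, hU, hNU, hχ⟩ :=
    exists_cutoffFlow h.isPolarField.contDiff (isCompact_blockSet (θ₀ := θ₀) (M := M))
  have hΓ : IsAdaptedFlow v χ Γ (blockSet θ₀ M) U := ⟨hc, isCompact_blockSet, hU, hNU, hχ⟩
  have hB := h.isIsolatingBlock hΓ
  refine ⟨blockSet θ₀ M, hB, h.maximalInvariantSet_eq hΓ, ?_⟩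
  obtain ⟨e, he⟩ := exists_homeomorph_of_image_eq h.continuous_firstIntegral
    (by rw [h.entrySet_eq hΓ]; exact isCompact_Icc.image continuous_blockCurve)
    (by rw [h.exitSet_eq hΓ]; exact isCompact_Icc.image continuous_blockCurve)
    (h.injOn_entrySet hΓ) (h.injOn_exitSet hΓ) (h.image_entrySet_eq hΓ)
  have huniq : ∀ (x : entrySet v (blockSet θ₀ M)) (y : exitSet v (blockSet θ₀ M)),
      BlockMapGraph v (blockSet θ₀ M) x y → y = e x := by
    intro x y hxy
    obtain ⟨-, -, T, -, hT, -⟩ := hΓ.blockMapGraph_iff.1 hxy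
    refine Subtype.ext (h.injOn_exitSet hΓ y.2 (e x).2 ?_)
    rw [he, ← hT, h.firstIntegral_flow hΓ.toIsCutoffFlow]
  have hasym : ∀ x ∈ asymptoticEntrySet v (blockSet θ₀ M), h.firstIntegral x = 0 := fun x hx =>
    h.firstIntegral_of_eq (h.cross_eq_zero_of_stays hΓ (hΓ.mem_asymptoticEntrySet.1 hx).2)
  refine ⟨e, fun x hx => ?_, fun e' he' => ?_⟩
  · rcases hΓ.forward_exit hB (hΓ.frontier_subset x.2.1) with h1 | ⟨T, hT, hex, hst⟩
    · exact absurd (hΓ.mem_asymptoticEntrySet.2 ⟨x.2, h1⟩) hx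
    · have h1 : BlockMapGraph v (blockSet θ₀ M) x (Γ T x) :=
        hΓ.blockMapGraph_iff.2 ⟨x.2, hex, T, hT, rfl, hst⟩
      rw [← huniq x ⟨_, hex⟩ h1]
      exact h1
  · have h1 : ∀ x : entrySet v (blockSet θ₀ M),
        (x : ℝ × ℝ) ∉ asymptoticEntrySet v (blockSet θ₀ M) → e' x = e x :=
      fun x hx => huniq x _ (he' x hx)
    ext1 x
    by_cases hx : (x : ℝ × ℝ) ∈ asymptoticEntrySet v (blockSet θ₀ M)
    -- Two extensions agree off a⁺, and a⁺ has at most one point, since the first integral vanishes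
    -- on it. Bijectivity then fixes the value at that point.
    · set y := e.symm (e' x) with hy
      have h2 : e y = e' x := e.apply_symm_apply _
      have hyx : y = x := by
        by_cases hya : (y : ℝ × ℝ) ∈ asymptoticEntrySet v (blockSet θ₀ M)
        · exact Subtype.ext (h.injOn_entrySet hΓ y.2 x.2 (by rw [hasym _ hya, hasym _ hx]))
        · exact e'.injective ((h1 y hya).trans h2)
      rw [← h2, hyx]
    · exact h1 x hx

end HasTangencyAngle

theorem IsPolarField.isC0Regularisable (hv : IsPolarField v k R Θ) (h0 : Θ θ₀ = 0) (hR : R θ₀ < 0)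
    (hpos : ∀ θ ∈ Ioo θ₀ (θ₀ + Real.pi), 0 < Θ θ) (hd : deriv Θ θ₀ ≠ 0) :
    IsC0Regularisable v 0 := by
  obtain ⟨θs, M, h⟩ := exists_hasTangencyAngle hv h0 hR hpos hd
  exact h.isC0Regularisable

end PlanarReg
namespace PlanarReg

/-! ### Homogeneous polynomial fields in polar coordinates -/

theorem charpoly_smul_id (a : ℝ) : (a • LinearMap.id : ℝ →ₗ[ℝ] ℝ).charpoly = Polynomial.X - Polynomial.C a := by
  rw [← LinearMap.charpoly_toMatrix _ (Module.Basis.singleton (Fin 1) ℝ), Matrix.charpoly, Matrix.det_fin_one]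
  simp [Module.Basis.toMatrix_apply]

/-- The eigenvector determines the first eigenvalue; cancelling its factor in the characteristic
polynomial determines the second. -/
theorem isEigenvalueRatio_diag {A : (ℝ × ℝ) →ₗ[ℝ] (ℝ × ℝ)} {a b r : ℝ} 
    (hA : A = (a • LinearMap.id).prodMap (b • LinearMap.id)) :
    (IsEigenvalueRatio A (0, 1) r ↔ a ≠ 0 ∧ r = b / a) ∧
      (IsEigenvalueRatio A (1, 0) r ↔ b ≠ 0 ∧ r = a / b) := by
  have hc : A.charpoly = (Polynomial.X - Polynomial.C a) * (Polynomial.X - Polynomial.C b) := by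
    rw [hA, LinearMap.charpoly_prodMap, charpoly_smul_id, charpoly_smul_id]
  constructor
  · constructor
    · rintro ⟨l₁, l₂, h1, h2, h3, rfl⟩
      have h4 : l₁ = b := by simpa [hA] using (congrArg Prod.snd h1).symm
      rw [hc, h4, mul_comm] at h2
      have h5 := mul_left_cancel₀ (Polynomial.X_sub_C_ne_zero b) h2
      have h6 : a = l₂ := Polynomial.C_injective (sub_right_injective h5)
      exact ⟨h6 ▸ h3, by rw [h4, h6]⟩
    · rintro ⟨h1, rfl⟩
      exact ⟨b, a, by simp [hA], by rw [hc, mul_comm], h1, rfl⟩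
  · constructor
    · rintro ⟨l₁, l₂, h1, h2, h3, rfl⟩
      have h4 : l₁ = a := by simpa [hA] using (congrArg Prod.fst h1).symm
      rw [hc, h4] at h2
      have h5 := mul_left_cancel₀ (Polynomial.X_sub_C_ne_zero a) h2
      have h6 : b = l₂ := Polynomial.C_injective (sub_right_injective h5)
      exact ⟨h6 ▸ h3, by rw [h4, h6]⟩
    · rintro ⟨h1, rfl⟩
      exact ⟨a, b, by simp [hA], hc, h1, rfl⟩

theorem contDiff_eval {E : Type*} [NormedAddCommGroup E] [NormedSpace ℝ E] {m : WithTop ℕ∞}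
    {g : E → Fin 2 → ℝ} (hg : ∀ i, ContDiff ℝ m fun e => g e i) (P : MvPolynomial (Fin 2) ℝ) :
    ContDiff ℝ m fun e => MvPolynomial.eval (g e) P := by
  induction P using MvPolynomial.induction_on with
  | C a => simpa using contDiff_const
  | add p q hp hq => simpa using hp.add hq
  | mul_X p i hp => simpa using hp.mul (hg i)

theorem eval_homogeneous {P : MvPolynomial (Fin 2) ℝ} {n : ℕ} (hP : P.IsHomogeneous n) (r x y : ℝ) :
    MvPolynomial.eval ![r * x, r * y] P = r ^ n * MvPolynomial.eval ![x, y] P := by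
  rw [MvPolynomial.eval_eq', MvPolynomial.eval_eq', Finset.mul_sum]
  refine Finset.sum_congr rfl fun d hd => ?_
  have h1 := hP (MvPolynomial.mem_support_iff.1 hd)
  have h2 : d 0 + d 1 = n := by
    rw [← h1, Finsupp.weight_apply, Finsupp.sum_fintype _ _ (by simp)]
    simp
  rw [← h2]
  simp [Fin.prod_univ_two]
  ring

theorem eval_hat (P : MvPolynomial (Fin 2) ℝ) (s : ℝ) :
    (MvPolynomial.aeval ![1, Polynomial.X] P : Polynomial ℝ).eval s = MvPolynomial.eval ![1, s] P := by
  induction P using MvPolynomial.induction_on with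
  | C a => simp
  | add p q hp hq => simp [hp, hq]
  | mul_X p i hp => fin_cases i <;> simp [hp]

theorem eval_bar (P : MvPolynomial (Fin 2) ℝ) (s : ℝ) :
    (MvPolynomial.aeval ![Polynomial.X, 1] P : Polynomial ℝ).eval s = MvPolynomial.eval ![s, 1] P := by
  induction P using MvPolynomial.induction_on with
  | C a => simp
  | add p q hp hq => simp [hp, hq]
  | mul_X p i hp => fin_cases i <;> simp [hp]

theorem derivative_ne_zero_of_simple {p : Polynomial ℝ} {s : ℝ} (h : p.rootMultiplicity s = 1) :
    p.derivative.eval s ≠ 0 := by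
  have hp : p ≠ 0 := by
    rintro rfl
    simp at h
  intro h0
  have h1 : p.IsRoot s := by
    rw [← Polynomial.rootMultiplicity_pos hp, h]
    exact one_pos
  have := (Polynomial.one_lt_rootMultiplicity_iff_isRoot hp).2 ⟨h1, h0⟩
  omega

/-- The radial component of the field on the unit circle. -/
noncomputable def radialComp (P Q : MvPolynomial (Fin 2) ℝ) (θ : ℝ) : ℝ :=
  Real.cos θ * MvPolynomial.eval ![Real.cos θ, Real.sin θ] P +
    Real.sin θ * MvPolynomial.eval ![Real.cos θ, Real.sin θ] Q

/-- The angular component of the field on the unit circle. -/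
noncomputable def angularComp (P Q : MvPolynomial (Fin 2) ℝ) (θ : ℝ) : ℝ :=
  Real.cos θ * MvPolynomial.eval ![Real.cos θ, Real.sin θ] Q -
    Real.sin θ * MvPolynomial.eval ![Real.cos θ, Real.sin θ] P

/-- The angle in `(-π / 2, π / 2]` of a point of the projective line. -/
noncomputable def dirAngle : OnePoint ℝ → ℝ
  | none => Real.pi / 2
  | some s => Real.arctan s

theorem exists_dirAngle (θ : ℝ) : ∃ (ω : OnePoint ℝ) (n : ℤ), θ = dirAngle ω + n * Real.pi := by
  obtain ⟨n, hn, -⟩ := existsUnique_sub_zsmul_mem_Ioc Real.pi_pos θ (-(Real.pi / 2))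
  rw [zsmul_eq_mul, show -(Real.pi / 2) + Real.pi = Real.pi / 2 by ring] at hn
  rcases hn.2.eq_or_lt with h | h
  · exact ⟨none, n, by rw [dirAngle, ← h]; ring⟩
  · refine ⟨some (Real.tan (θ - n * Real.pi)), n, ?_⟩
    rw [dirAngle, Real.arctan_tan hn.1 h]
    ring

theorem dirAngle_mem (ω : OnePoint ℝ) : dirAngle ω ∈ Ioc (-(Real.pi / 2)) (Real.pi / 2) := by
  rcases ω with _ | s
  · exact ⟨by simp only [dirAngle]; linarith [Real.pi_pos], le_rfl⟩
  · exact ⟨Real.neg_pi_div_two_lt_arctan s, (Real.arctan_lt_pi_div_two s).le⟩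

theorem dirAngle_injective : Function.Injective dirAngle := by
  rintro (_ | s) (_ | t) h
  · rfl
  · exact absurd h.symm (Real.arctan_lt_pi_div_two t).ne
  · exact absurd h (Real.arctan_lt_pi_div_two s).ne
  · exact congrArg some (Real.arctan_injective h)

theorem eq_of_dirAngle_eq_add {ω ω' : OnePoint ℝ} {n : ℤ}
    (h : dirAngle ω' = dirAngle ω + n * Real.pi) : ω' = ω := by
  have h1 := dirAngle_mem ω
  have h2 := dirAngle_mem ω'
  have h3 := Real.pi_pos
  have h4 : ((-1 : ℤ) : ℝ) < n := by
    push_cast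
    by_contra hcon
    nlinarith [h1.1, h1.2, h2.1, h2.2]
  have h5 : (n : ℝ) < ((1 : ℤ) : ℝ) := by
    push_cast
    by_contra hcon
    nlinarith [h1.1, h1.2, h2.1, h2.2]
  have h6 : n = 0 := by
    have h4 := Int.cast_lt.1 h4
    have h5 := Int.cast_lt.1 h5
    omega
  rw [h6, Int.cast_zero, zero_mul, add_zero] at h
  exact dirAngle_injective h

section

variable {P Q : MvPolynomial (Fin 2) ℝ} {k : ℕ}

theorem isPolarField_field (hP : P.IsHomogeneous (k + 1)) (hQ : Q.IsHomogeneous (k + 1)) :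
    IsPolarField (field P Q) k (radialComp P Q) (angularComp P Q) := by
  have hg : ∀ {m : WithTop ℕ∞} (i : Fin 2),
      ContDiff ℝ m fun θ => (![Real.cos θ, Real.sin θ] : Fin 2 → ℝ) i := fun i => by
    fin_cases i
    · exact Real.contDiff_cos
    · exact Real.contDiff_sin
  have hz : ∀ i : Fin 2, ContDiff ℝ 1 fun z : ℝ × ℝ => (![z.1, z.2] : Fin 2 → ℝ) i := fun i => by
    fin_cases i
    · exact contDiff_fst
    · exact contDiff_snd
  refine ⟨(contDiff_eval hz P).prodMk (contDiff_eval hz Q), ?_, ?_, fun r θ => ?_⟩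
  · exact (Real.contDiff_cos.mul (contDiff_eval hg P)).add
      (Real.contDiff_sin.mul (contDiff_eval hg Q))
  · exact (Real.contDiff_cos.mul (contDiff_eval hg Q)).sub
      (Real.contDiff_sin.mul (contDiff_eval hg P))
  · have h := Real.cos_sq_add_sin_sq θ
    simp only [field, pt, eval_homogeneous hP, eval_homogeneous hQ, radialComp, angularComp,
      Real.cos_add_pi_div_two, Real.sin_add_pi_div_two]
    refine Prod.ext ?_ ?_
    · simp only [Prod.fst_add]
      linear_combination -(r ^ (k + 1) * MvPolynomial.eval ![Real.cos θ, Real.sin θ] P) * h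
    · simp only [Prod.snd_add]
      linear_combination -(r ^ (k + 1) * MvPolynomial.eval ![Real.cos θ, Real.sin θ] Q) * h

/-- Otherwise the field vanishes along a whole ray ending at the origin. -/
theorem IsIsolatedSingularPoint.radial_ne_zero {v : ℝ × ℝ → ℝ × ℝ} {R Θ : ℝ → ℝ}
    (h : IsIsolatedSingularPoint v 0) (hv : IsPolarField v k R Θ) {θ : ℝ} (hΘ : Θ θ = 0) :
    R θ ≠ 0 := by
  intro hR
  have h1 : Tendsto (fun r => pt r θ) (𝓝[>] 0) (𝓝[≠] 0) := by
    refine tendsto_nhdsWithin_iff.2 ⟨?_, ?_⟩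
    · have hc : Continuous fun r => pt r θ := by fun_prop
      have := hc.tendsto 0
      rw [pt_zero] at this
      exact this.mono_left nhdsWithin_le_nhds
    · filter_upwards [self_mem_nhdsWithin] with r hr using pt_ne_zero hr θ
  obtain ⟨r, hr⟩ := (h1.eventually h.2).exists
  exact hr (by rw [hv.apply_ray hΘ, hR, mul_zero, zero_smul])

theorem IsVhom.ne_zero {n : ℕ} (hX : IsVhom n P Q) : n ≠ 0 := by
  rintro rfl
  obtain ⟨z, hz⟩ := hX.isolated.2.exists
  refine hz ?_
  rw [← hX.isolated.1]
  have h1 := eval_homogeneous hX.homogeneous_P 0 z.1 z.2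
  have h2 := eval_homogeneous hX.homogeneous_Q 0 z.1 z.2
  simp only [zero_mul, pow_zero, one_mul] at h1 h2
  simp [field, h1, h2]

theorem hasDerivAt_eval (p : Polynomial ℝ) (f : ℝ → ℝ) (hf : ∀ s, p.eval s = f s) (s : ℝ) :
    HasDerivAt f (p.derivative.eval s) s := by
  rw [← funext hf]
  exact p.hasDerivAt s

theorem hatPoly_eval (s : ℝ) : (hatPoly P Q).eval s =
    MvPolynomial.eval ![1, s] Q - s * MvPolynomial.eval ![1, s] P := by
  rw [hatPoly, eval_hat, directionalPoly]
  simp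

theorem barPoly_eval (s : ℝ) : (barPoly P Q).eval s =
    s * MvPolynomial.eval ![s, 1] Q - MvPolynomial.eval ![s, 1] P := by
  rw [barPoly, eval_bar, directionalPoly]
  simp

/-- The first component carries a factor x, which kills its y-derivative on the critical manifold,
and the second depends on y only; so the Jacobian is diagonal. -/
theorem fderiv_hatField (s : ℝ) :
    (fderiv ℝ (hatField P Q) (0, s) : (ℝ × ℝ) →ₗ[ℝ] (ℝ × ℝ)) =
      (MvPolynomial.eval ![1, s] P • LinearMap.id).prodMap
        ((hatPoly P Q).derivative.eval s • LinearMap.id) := by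
  have h1 := (hasDerivAt_eval _ _ (eval_hat P) s).comp_hasFDerivAt ((0, s) : ℝ × ℝ)
    (hasFDerivAt_snd (𝕜 := ℝ))
  have h2 := (hasDerivAt_eval _ _ (hatPoly_eval (P := P) (Q := Q)) s).comp_hasFDerivAt
    ((0, s) : ℝ × ℝ) (hasFDerivAt_snd (𝕜 := ℝ))
  have h3 : HasFDerivAt (hatField P Q) _ ((0, s) : ℝ × ℝ) :=
    ((hasFDerivAt_fst (𝕜 := ℝ)).mul h1).prodMk h2
  rw [h3.fderiv]
  refine LinearMap.ext fun w => ?_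
  simp

theorem fderiv_barField :
    (fderiv ℝ (barField P Q) (0, 0) : (ℝ × ℝ) →ₗ[ℝ] (ℝ × ℝ)) =
      (-(barPoly P Q).derivative.eval 0 • LinearMap.id).prodMap
        (MvPolynomial.eval ![0, 1] Q • LinearMap.id) := by
  have h1 := (hasDerivAt_eval _ _ (eval_bar Q) 0).comp_hasFDerivAt ((0, 0) : ℝ × ℝ)
    (hasFDerivAt_fst (𝕜 := ℝ))
  have h2 := ((hasDerivAt_eval _ _ (barPoly_eval (P := P) (Q := Q)) 0).neg).comp_hasFDerivAt
    ((0, 0) : ℝ × ℝ) (hasFDerivAt_fst (𝕜 := ℝ))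
  have h3 := h2.prodMk ((hasFDerivAt_snd (𝕜 := ℝ)).mul h1)
  have h4 : HasFDerivAt (barField P Q) _ ((0, 0) : ℝ × ℝ) :=
    h3.congr_of_eventuallyEq (Eventually.of_forall fun z => by simp [barField])
  rw [h4.fderiv]
  refine LinearMap.ext fun w => ?_
  simp

theorem angularComp_of_cos_ne_zero (hP : P.IsHomogeneous (k + 1)) (hQ : Q.IsHomogeneous (k + 1))
    {θ : ℝ} (hθ : Real.cos θ ≠ 0) :
    angularComp P Q θ = Real.cos θ ^ (k + 2) * (hatPoly P Q).eval (Real.tan θ) := by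
  have h1 : Real.sin θ = Real.cos θ * Real.tan θ := by
    rw [mul_comm, Real.tan_mul_cos hθ]
  have hh := eval_homogeneous hP (Real.cos θ) 1 (Real.tan θ)
  have hh' := eval_homogeneous hQ (Real.cos θ) 1 (Real.tan θ)
  rw [mul_one, ← h1] at hh hh'
  rw [angularComp, hatPoly_eval, hh, hh', h1]
  ring

theorem angularComp_of_sin_ne_zero (hP : P.IsHomogeneous (k + 1)) (hQ : Q.IsHomogeneous (k + 1))
    {θ : ℝ} (hθ : Real.sin θ ≠ 0) :
    angularComp P Q θ = Real.sin θ ^ (k + 2) * (barPoly P Q).eval (Real.cos θ / Real.sin θ) := by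
  have h1 : Real.sin θ * (Real.cos θ / Real.sin θ) = Real.cos θ := mul_div_cancel₀ _ hθ
  have hh := eval_homogeneous hP (Real.sin θ) (Real.cos θ / Real.sin θ) 1
  have hh' := eval_homogeneous hQ (Real.sin θ) (Real.cos θ / Real.sin θ) 1
  rw [mul_one, h1] at hh hh'
  rw [angularComp, barPoly_eval, hh, hh']
  field_simp
  ring

theorem isCharDirection_iff (hP : P.IsHomogeneous (k + 1)) (hQ : Q.IsHomogeneous (k + 1))
    (ω : OnePoint ℝ) : IsCharDirection P Q ω ↔ angularComp P Q (dirAngle ω) = 0 := by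
  rcases ω with _ | s
  · change (barPoly P Q).eval 0 = 0 ↔ angularComp P Q (Real.pi / 2) = 0
    rw [angularComp_of_sin_ne_zero hP hQ (by simp)]
    simp
  · change (hatPoly P Q).eval s = 0 ↔ angularComp P Q (Real.arctan s) = 0
    have h := (Real.cos_arctan_pos s).ne'
    rw [angularComp_of_cos_ne_zero hP hQ h, Real.tan_arctan, mul_eq_zero,
      or_iff_right (pow_ne_zero _ h)]

/-- Near a finite direction Θ = cos^(k+2) hatPoly(tan). At the root this gives Θ' = cos^k
hatPoly'(s) and R = cos^k P(1, s), so the ratio is that of the Jacobian's eigenvalues. At ∞ the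
other chart is used, with sin = 1. -/
theorem IsVhom.isCriticalValueAt_iff (hX : IsVhom (k + 1) P Q) {ω : OnePoint ℝ}
    (hω : IsCharDirection P Q ω) : deriv (angularComp P Q) (dirAngle ω) ≠ 0 ∧
      ∀ r, IsCriticalValueAt P Q r ω ↔ radialComp P Q (dirAngle ω) ≠ 0 ∧
        r = deriv (angularComp P Q) (dirAngle ω) / radialComp P Q (dirAngle ω) := by
  have hP := hX.homogeneous_P
  have hQ := hX.homogeneous_Q
  have hsimple := hX.simple ω hω
  rcases ω with _ | s
  · have h0 : (barPoly P Q).eval 0 = 0 := hω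
    have hne := derivative_ne_zero_of_simple hsimple
    have hR : radialComp P Q (Real.pi / 2) = MvPolynomial.eval ![0, 1] Q := by
      simp [radialComp]
    have hd : deriv (angularComp P Q) (Real.pi / 2) = -(barPoly P Q).derivative.eval 0 := by
      have h1 := ((Real.hasDerivAt_cos (Real.pi / 2)).div (Real.hasDerivAt_sin (Real.pi / 2))
        (by simp))
      have h2 : HasDerivAt (fun θ => (barPoly P Q).eval (Real.cos θ / Real.sin θ)) _
          (Real.pi / 2) := HasDerivAt.comp (h₂ := fun s => (barPoly P Q).eval s) (Real.pi / 2)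
        ((barPoly P Q).hasDerivAt (Real.cos (Real.pi / 2) / Real.sin (Real.pi / 2))) h1
      have h3 := ((Real.hasDerivAt_sin (Real.pi / 2)).pow (k + 2)).mul h2
      have h4 : ∀ᶠ θ in 𝓝 (Real.pi / 2), Real.sin θ ≠ 0 :=
        Real.continuous_sin.continuousAt.eventually_ne (by simp)
      have h5 := h3.congr_of_eventuallyEq (h4.mono fun θ hθ => angularComp_of_sin_ne_zero hP hQ hθ)
      rw [h5.deriv]
      simp
    change deriv (angularComp P Q) (Real.pi / 2) ≠ 0 ∧ ∀ r, IsEigenvalueRatio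
      (fderiv ℝ (barField P Q) (0, 0) : (ℝ × ℝ) →ₗ[ℝ] (ℝ × ℝ)) (1, 0) r ↔
      radialComp P Q (Real.pi / 2) ≠ 0 ∧
        r = deriv (angularComp P Q) (Real.pi / 2) / radialComp P Q (Real.pi / 2)
    rw [hd, hR]
    exact ⟨neg_ne_zero.2 hne, fun r => (isEigenvalueRatio_diag fderiv_barField).2⟩
  · have h0 : (hatPoly P Q).eval s = 0 := hω
    have hne := derivative_ne_zero_of_simple hsimple
    have hc := Real.cos_arctan_pos s
    have h1 : Real.sin (Real.arctan s) = Real.cos (Real.arctan s) * s := by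
      rw [mul_comm]
      conv_rhs => rw [← Real.tan_arctan s, Real.arctan_tan (Real.neg_pi_div_two_lt_arctan s)
        (Real.arctan_lt_pi_div_two s)]
      rw [Real.tan_mul_cos hc.ne']
    have hR : radialComp P Q (Real.arctan s) =
        Real.cos (Real.arctan s) ^ k * MvPolynomial.eval ![1, s] P := by
      have hh := eval_homogeneous hP (Real.cos (Real.arctan s)) 1 s
      have hh' := eval_homogeneous hQ (Real.cos (Real.arctan s)) 1 s
      rw [mul_one, ← h1] at hh hh'
      rw [hatPoly_eval] at h0
      have h2 := Real.cos_sq_add_sin_sq (Real.arctan s)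
      rw [radialComp, hh, hh', h1]
      rw [h1] at h2
      generalize Real.cos (Real.arctan s) = c at *
      linear_combination c ^ k * MvPolynomial.eval ![1, s] P * h2 + s * c ^ (k + 2) * h0
    have hd : deriv (angularComp P Q) (Real.arctan s) =
        Real.cos (Real.arctan s) ^ k * (hatPoly P Q).derivative.eval s := by
      have h2 : HasDerivAt (fun θ => (hatPoly P Q).eval (Real.tan θ)) _ (Real.arctan s) :=
        HasDerivAt.comp (h₂ := fun s => (hatPoly P Q).eval s) (Real.arctan s)
          ((hatPoly P Q).hasDerivAt (Real.tan (Real.arctan s))) (Real.hasDerivAt_tan hc.ne')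
      have h3 := ((Real.hasDerivAt_cos (Real.arctan s)).pow (k + 2)).mul h2
      have h4 : ∀ᶠ θ in 𝓝 (Real.arctan s), Real.cos θ ≠ 0 :=
        Real.continuous_cos.continuousAt.eventually_ne hc.ne'
      have h5 := h3.congr_of_eventuallyEq (h4.mono fun θ hθ => angularComp_of_cos_ne_zero hP hQ hθ)
      rw [h5.deriv, Real.tan_arctan, h0, mul_zero, zero_add, Pi.pow_apply]
      generalize Real.cos (Real.arctan s) = c at *
      field_simp
      ring
    change deriv (angularComp P Q) (Real.arctan s) ≠ 0 ∧ ∀ r, IsEigenvalueRatio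
      (fderiv ℝ (hatField P Q) (0, s) : (ℝ × ℝ) →ₗ[ℝ] (ℝ × ℝ)) (0, 1) r ↔
      radialComp P Q (Real.arctan s) ≠ 0 ∧
        r = deriv (angularComp P Q) (Real.arctan s) / radialComp P Q (Real.arctan s)
    have hck := (pow_pos hc k).ne'
    rw [hd, hR, mul_div_mul_left _ _ hck]
    refine ⟨mul_ne_zero hck hne, fun r => ?_⟩
    rw [(isEigenvalueRatio_diag (fderiv_hatField s)).1, mul_ne_zero_iff, and_iff_right hck]

end

/-- R and Θ' both acquire the factor (-1)^k, so the sign of the critical value does not depend on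
which of the two opposite rays represents the direction. -/
theorem IsPolarField.periodic_mul_deriv {v : ℝ × ℝ → ℝ × ℝ} {R Θ : ℝ → ℝ} {k : ℕ}
    (hv : IsPolarField v k R Θ) : Function.Periodic (fun θ => R θ * deriv Θ θ) Real.pi := by
  intro θ
  have h1 : deriv Θ (θ + Real.pi) = (-1) ^ k * deriv Θ θ := by
    rw [← deriv_comp_add_const, funext fun θ => (hv.add_pi θ).2, deriv_const_mul_field]
  have h2 : ((-1 : ℝ) ^ k) * (-1) ^ k = 1 := by rw [← mul_pow]; simp
  simp only [h1, (hv.add_pi θ).1]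
  linear_combination R θ * deriv Θ θ * h2

theorem IsPolarField.zero_add_int_mul {v : ℝ × ℝ → ℝ × ℝ} {R Θ : ℝ → ℝ} {k : ℕ}
    (hv : IsPolarField v k R Θ) (θ : ℝ) (n : ℤ) : Θ (θ + n * Real.pi) = 0 ↔ Θ θ = 0 := by
  have h : Function.Periodic (fun θ => Θ θ = 0) Real.pi := fun θ => by
    simp [(hv.add_pi θ).2]
  exact iff_of_eq (h.int_mul n θ)

end PlanarReg

/-! ### From the sign of the critical value to regularisability; the theorem -/

namespace PlanarReg

variable {v : ℝ × ℝ → ℝ × ℝ} {k : ℕ} {R Θ : ℝ → ℝ}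

/-- Between consecutive zeros the angular component has the sign of its derivative at the first. -/
theorem pos_of_deriv_pos {f : ℝ → ℝ} {f' a b : ℝ} (hf : Continuous f) (ha : f a = 0)
    (hd : HasDerivAt f f' a) (hf' : 0 < f') (hne : ∀ x ∈ Ioo a b, f x ≠ 0) :
    ∀ x ∈ Ioo a b, 0 < f x := by
  intro x hx
  have h1 : ∀ᶠ y in 𝓝[>] a, 0 < f y := by
    have h2 := (hasDerivAt_iff_tendsto_slope.1 hd).eventually_const_lt hf'
    filter_upwards [h2.filter_mono (nhdsWithin_mono _ fun y (hy : a < y) => hy.ne'),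
      self_mem_nhdsWithin] with y hy hay
    have hay : 0 < y - a := sub_pos.2 hay
    rw [slope_def_field, ha, sub_zero] at hy
    exact (div_pos_iff_of_pos_right hay).1 hy
  obtain ⟨y, hy, hy'⟩ := (h1.and (Ioo_mem_nhdsGT (hx.1.trans hx.2))).exists
  by_contra hcon
  have h0 : (0 : ℝ) ∈ uIcc (f y) (f x) :=
    ⟨inf_le_right.trans (not_lt.1 hcon), hy.le.trans le_sup_left⟩
  obtain ⟨s, hs, hs'⟩ := intermediate_value_uIcc hf.continuousOn h0
  exact hne s (ordConnected_Ioo.uIcc_subset hy' hx hs) hs'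

/-- A homogeneous field with one characteristic direction and negative critical value is
regularisable. -/
theorem IsPolarField.isC0Regularisable_of_mul_deriv_neg (hv : IsPolarField v k R Θ) {a : ℝ}
    (h0 : Θ a = 0) (hneg : R a * deriv Θ a < 0)
    (hne : ∀ θ, Θ θ = 0 → ∃ n : ℤ, θ = a + n * Real.pi) : IsC0Regularisable v 0 := by
  have hπ := Real.pi_pos
  have hd : ∀ θ, HasDerivAt Θ (deriv Θ θ) θ := fun θ =>
    (hv.contDiff_Θ.differentiable two_ne_zero θ).hasDerivAt
  have hΘc := hv.contDiff_Θ.continuous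
  have key : ∀ b, Θ b = 0 → (∃ m : ℤ, b = a + m * Real.pi) → ∀ x ∈ Ioo b (b + Real.pi), Θ x ≠ 0 := by
    rintro b hb ⟨m, rfl⟩ x hx hx0
    obtain ⟨n, rfl⟩ := hne x hx0
    have h1 : (m : ℝ) < n := by
      by_contra hcon
      nlinarith [hx.1]
    have h2 : (n : ℝ) < ((m + 1 : ℤ) : ℝ) := by
      push_cast
      by_contra hcon
      nlinarith [hx.2]
    have h1 := Int.cast_lt.1 h1
    have h2 := Int.cast_lt.1 h2
    omega
  have step : ∀ b, Θ b = 0 → (∃ m : ℤ, b = a + m * Real.pi) → R b < 0 → 0 < deriv Θ b →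
      IsC0Regularisable v 0 := fun b hb hm hR hd' =>
    hv.isC0Regularisable hb hR (pos_of_deriv_pos hΘc hb (hd b) hd' (key b hb hm)) hd'.ne'
  -- The construction starts from the incoming ray. If R is positive at `a`, that ray is the
  -- opposite one, because k turns out to be odd.
  rcases lt_or_ge (R a) 0 with hR | hR
  · exact step a h0 ⟨0, by simp⟩ hR (pos_of_mul_neg_right hneg hR.le)
  have hd' : deriv Θ a < 0 := neg_of_mul_neg_right hneg hR
  have hR : 0 < R a := lt_of_le_of_ne hR fun h => by rw [← h, zero_mul] at hneg; exact hneg.false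
  have hsign : ∀ x ∈ Ioo a (a + Real.pi), 0 < -Θ x :=
    pos_of_deriv_pos hΘc.neg (by simp [h0]) (hd a).neg (neg_pos.2 hd')
      fun x hx => neg_ne_zero.2 (key a h0 ⟨0, by simp⟩ x hx)
  have hk : Odd k := by
    by_contra hk
    rw [Nat.not_odd_iff_even] at hk
    refine hd'.ne (IsLocalMax.deriv_eq_zero ?_)
    filter_upwards [Ioo_mem_nhds (show a - Real.pi < a by linarith)
      (show a < a + Real.pi by linarith)] with θ hθ
    rw [h0]
    rcases lt_trichotomy θ a with h | h | h
    · have h1 := (hv.add_pi θ).2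
      have h2 := hsign (θ + Real.pi) ⟨by linarith [hθ.1], by linarith⟩
      rw [hk.neg_one_pow, one_mul] at h1
      linarith
    · rw [h, h0]
    · linarith [hsign θ ⟨h, hθ.2⟩]
  have hap := fun θ => hv.add_pi θ
  simp only [hk.neg_one_pow, neg_one_mul] at hap
  refine hv.isC0Regularisable (θ₀ := a + Real.pi) (by rw [(hap a).2, h0, neg_zero])
    (by rw [(hap a).1]; exact neg_lt_zero.2 hR) (fun θ hθ => ?_) ?_
  · have := hsign (θ - Real.pi) ⟨by linarith [hθ.1], by linarith [hθ.2]⟩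
    rwa [← (hap _).2, sub_add_cancel] at this
  · have h1 := hv.periodic_mul_deriv a
    simp only at h1
    intro h2
    rw [h2, mul_zero] at h1
    exact hneg.ne h1.symm

end PlanarReg

theorem mainTheorem1 (n : ℕ) (P Q : MvPolynomial (Fin 2) ℝ) (hX : PlanarReg.IsVhom n P Q) :
    PlanarReg.IsC0Regularisable (PlanarReg.field P Q) 0 ↔
      ∃ (ω : OnePoint ℝ) (r : ℝ), {ω' | PlanarReg.IsCharDirection P Q ω'} = {ω} ∧
        PlanarReg.IsCriticalValueAt P Q r ω ∧ r < 0 := by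
  open PlanarReg in
  obtain ⟨k, rfl⟩ := Nat.exists_eq_succ_of_ne_zero hX.ne_zero
  have hv := isPolarField_field hX.homogeneous_P hX.homogeneous_Q
  have hchar := isCharDirection_iff hX.homogeneous_P hX.homogeneous_Q
  have hnd : ∀ θ, angularComp P Q θ = 0 → radialComp P Q θ ≠ 0 := fun θ hθ =>
    hX.isolated.radial_ne_zero hv hθ
  have hper : ∀ θ (m : ℤ), radialComp P Q (θ + m * Real.pi) *
      deriv (angularComp P Q) (θ + m * Real.pi) = radialComp P Q θ * deriv (angularComp P Q) θ :=
    fun θ m => hv.periodic_mul_deriv.int_mul m θ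
  constructor
  · intro hreg
    have hsimple : ∀ θ, angularComp P Q θ = 0 → deriv (angularComp P Q) θ ≠ 0 := by
      intro θ hθ
      obtain ⟨ω, m, rfl⟩ := exists_dirAngle θ
      rw [hv.zero_add_int_mul] at hθ
      have h1 := mul_ne_zero (hnd _ hθ) (hX.isCriticalValueAt_iff ((hchar ω).2 hθ)).1
      rw [← hper _ m] at h1
      exact right_ne_zero_of_mul h1
    obtain ⟨θ₀, h0, hR, hpos⟩ := hv.exists_single_direction hnd hsimple hreg
    -- Positivity of Θ to the right of `θ₀` makes the slopes nonnegative, and the zero is simple.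
    have hd : 0 < deriv (angularComp P Q) θ₀ := by
      refine lt_of_le_of_ne ?_ (hsimple θ₀ h0).symm
      have h1 := (hv.contDiff_Θ.differentiable two_ne_zero θ₀).hasDerivAt
      have h2 : Tendsto (slope (angularComp P Q) θ₀) (𝓝[>] θ₀) (𝓝 (deriv (angularComp P Q) θ₀)) :=
        (hasDerivAt_iff_tendsto_slope.1 h1).mono_left
          (nhdsWithin_mono _ fun y (hy : θ₀ < y) => hy.ne')
      refine ge_of_tendsto h2 ?_
      filter_upwards [Ioo_mem_nhdsGT (show θ₀ < θ₀ + Real.pi by linarith [Real.pi_pos])] with y hy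
      rw [slope_def_field, h0, sub_zero]
      exact div_nonneg (hpos y hy).le (sub_pos.2 hy.1).le
    obtain ⟨ω, m, rfl⟩ := exists_dirAngle θ₀
    have hneg := mul_neg_of_neg_of_pos hR hd
    rw [hper] at hneg
    have h0' := (hv.zero_add_int_mul _ _).1 h0
    have hω := (hchar ω).2 h0'
    refine ⟨ω, _, ?_, ((hX.isCriticalValueAt_iff hω).2 _).2 ⟨hnd _ h0', rfl⟩, ?_⟩
    · refine Set.Subset.antisymm (fun ω' hω' => ?_) (Set.singleton_subset_iff.2 hω)
      have h1 := (hchar ω').1 hω'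
      -- Any other characteristic direction, shifted by multiples of π into [θ₀, θ₀ + π), is a zero
      -- of Θ there, and the only one is θ₀.
      obtain ⟨j, hj, -⟩ := existsUnique_sub_zsmul_mem_Ico Real.pi_pos (dirAngle ω')
        (dirAngle ω + m * Real.pi)
      rw [zsmul_eq_mul] at hj
      have h2 : angularComp P Q (dirAngle ω' - j * Real.pi) = 0 := by
        have := (hv.zero_add_int_mul (dirAngle ω') (-j)).2 h1
        rwa [Int.cast_neg, neg_mul, ← sub_eq_add_neg] at this
      rcases hj.1.eq_or_lt with h3 | h3
      · refine eq_of_dirAngle_eq_add (n := m + j) ?_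
        push_cast
        linarith
      · exact absurd h2 (hpos _ ⟨h3, hj.2⟩).ne'
    · rcases mul_neg_iff.1 hneg with h1 | h1
      · exact div_neg_of_neg_of_pos h1.2 h1.1
      · exact div_neg_of_pos_of_neg h1.2 h1.1
  · rintro ⟨ω, r, hω, hr, hr0⟩
    have hω' : IsCharDirection P Q ω := by
      have : ω ∈ {ω' | IsCharDirection P Q ω'} := hω ▸ rfl
      exact this
    obtain ⟨hR, rfl⟩ := ((hX.isCriticalValueAt_iff hω').2 r).1 hr
    refine hv.isC0Regularisable_of_mul_deriv_neg ((hchar ω).1 hω') ?_ fun θ hθ => ?_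
    · rcases div_neg_iff.1 hr0 with h1 | h1
      · exact mul_neg_of_neg_of_pos h1.2 h1.1
      · exact mul_neg_of_pos_of_neg h1.2 h1.1
    · obtain ⟨ω₁, m, rfl⟩ := exists_dirAngle θ
      have h1 : ω₁ ∈ {ω' | IsCharDirection P Q ω'} :=
        (hchar ω₁).2 ((hv.zero_add_int_mul _ _).1 hθ)
      rw [hω] at h1
      exact ⟨m, by rw [Set.mem_singleton_iff.1 h1]⟩
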